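/- Let $\gamma\in(0,\pi/2)$, $J>0$ and $0<h<4J(1+\cos\gamma)$. For $\lambda\in\mathbb C$ put $$K(\lambda|\gamma)=\frac{1}{2\pi i}\bigl(\coth(\lambda-i\gamma)-\coth(\lambda+i\gamma)\bigr),\qquad \varepsilon_0(\lambda)=h-4\pi J\sin(\gamma)\,K(\lambda|\gamma/2),\qquad \varepsilon_u(\lambda)=h-\frac{2\pi J\sin\gamma}{\gamma\cosh(\pi\lambda/\gamma)}.$$ For $Q>0$ let $\varepsilon(\cdot|Q)$ be the continuous solution on $[-Q,Q]$ of $$\varepsilon(\lambda|Q)=\varepsilon_0(\lambda)-\int_{-Q}^{Q}K(\lambda-\mu|\gamma)\,\varepsilon(\mu|Q)\,d\mu,$$ extended by the right-hand side to a meromorphic $i\pi$-periodic function on $\Upsilon_\gamma(Q)=\{z\in\mathbb C: z\notin[-Q,Q]\pm i\gamma \bmod i\pi\}$, whose only poles are at $\pm i\gamma/2 \bmod i\pi$. Let $Q_F>0$ be the Fermi rapidity, i.e. the positive solution of $\varepsilon(Q_F|Q_F)=0$, let $\varepsilon=\varepsilon(\cdot|Q_F)$ be the dressed energy, and let $S_\gamma(Q_F)=\Upsilon_\gamma(Q_F)\cap\{-\pi/2\le\operatorname{Im}z<\pi/2\}$.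 Write $\lambda=x+iy$ with $x,y\in\mathbb R$. Then: (i) On $S_\gamma(Q_F)$, away from the poles, $\operatorname{Re}\varepsilon(x+iy)$ is even in $x$ and even in $y$. (ii) For every $y$ with $0\le y<\gamma/2$ the function $x\mapsto\operatorname{Re}\varepsilon(x+iy)$ is strictly increasing on $[0,\infty)$ and has there exactly one zero $x(y)$; this zero is positive and simple. (iii) The function $y\mapsto x(y)$ is smooth on $[0,\gamma/2)$, $x(0)=Q_F$, and $$x(y)\sim\sqrt{\frac{2J\sin\gamma}{c}\Bigl(\frac{\gamma}{2}-y\Bigr)}\quad\text{as } y\to(\gamma/2)_-,$$ where $$c=\frac{1}{1-\gamma/\pi}\left\{\frac h2+\int_{Q_F}^{\infty}K\!\left(\frac{\mu}{1-\gamma/\pi}\,\Big|\,\frac{\gamma/2}{1-\gamma/\pi}\right)\varepsilon(\mu)\,d\mu\right\}>0$$ and the integral converges absolutely. (iv) If $|\operatorname{Im}\lambda|<\gamma/2$, then $\operatorname{Re}\varepsilon_0(\lambda)<\operatorname{Re}\varepsilon(\lambda)<\operatorname{Re}\varepsilon_u(\lambda)$. (v) $\operatorname{Re}\varepsilon(\lambda)>0$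 for all $\lambda\in S_\gamma(Q_F)$ with $|\operatorname{Im}\lambda|>\gamma/2$. Moreover, for $\lambda=x+iy\in S_\gamma(Q_F)$: $\operatorname{Re}\varepsilon(\lambda)>h$ if $\frac\pi2-\frac12(\frac\pi2-\gamma)<y<\frac\pi2$; $\operatorname{Re}\varepsilon(\lambda)>\frac h2$ if $\gamma<y<\frac\pi2-\frac12(\frac\pi2-\gamma)$; and $\operatorname{Re}\varepsilon(\lambda)>\min\{\frac h2,\frac{h\gamma}{\pi-\gamma}\}$ if $\frac\gamma2<y<\gamma$. (vi) On $S_\gamma(Q_F)$, away from the poles, $\operatorname{Im}\varepsilon(x+iy)$ is odd in $x$ and odd in $y$. (vii) $\operatorname{Im}\varepsilon$ is strictly increasing along the curve $y\mapsto x(y)+iy$, $0\le y<\gamma/2$, with $\frac{d}{dy}\operatorname{Im}\varepsilon(x(y)+iy)>0$ for $0<y<\gamma/2$, $\operatorname{Im}\varepsilon(x(0))=0$, and $$\operatorname{Im}\varepsilon(x(y)+iy)\sim\sqrt{\frac{2J\sin(\gamma)\,c}{\gamma/2-y}}\quad\text{as } y\to(\gamma/2)_-.$$ -/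

import Mathlib

open scoped Topology Real ContDiff

namespace XXZ

/-- The hyperbolic cotangent of a complex number. -/
noncomputable def coth (z : ℂ) : ℂ := Complex.cosh z / Complex.sinh z

/-- The kernel function `K(z|γ) = (coth (z - iγ) - coth (z + iγ)) / (2πi)`. -/
noncomputable def kernelK (z : ℂ) (γ : ℝ) : ℂ :=
  1 / (2 * (π : ℂ) * Complex.I) *
    (coth (z - Complex.I * (γ : ℂ)) - coth (z + Complex.I * (γ : ℂ)))

/-- The domain `Υ_γ(Q)`: the complex plane without the points of `[-Q, Q] ± iγ` modulo `iπ`. -/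
def domainUpsilon (γ Q : ℝ) : Set ℂ :=
  {z | ∀ t ∈ Set.Icc (-Q) Q, ∀ n : ℤ,
    z ≠ (t : ℂ) + Complex.I * (γ : ℂ) + Complex.I * (π : ℂ) * (n : ℂ) ∧
    z ≠ (t : ℂ) - Complex.I * (γ : ℂ) + Complex.I * (π : ℂ) * (n : ℂ)}

/-- The cylinder with cuts `S_γ(Q) = Υ_γ(Q) ∩ {-π/2 ≤ Im z < π/2}`. -/
def cylinderS (γ Q : ℝ) : Set ℂ :=
  domainUpsilon γ Q ∩ {z | -(π / 2) ≤ z.im ∧ z.im < π / 2}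

/-- The bare energy `ε₀(z) = h - 4πJ sin(γ) K(z|γ/2)`, the driving term. -/
noncomputable def bareEnergy (γ J h : ℝ) (z : ℂ) : ℂ :=
  (h : ℂ) - ((4 * π * J * Real.sin γ : ℝ) : ℂ) * kernelK z (γ / 2)

/-- The poles of the bare energy: `± iγ/2` modulo `iπ`. -/
def barePoles (γ : ℝ) : Set ℂ :=
  {z | ∃ n : ℤ,
    z = Complex.I * ((γ / 2 : ℝ) : ℂ) + Complex.I * (π : ℂ) * (n : ℂ) ∨
    z = -(Complex.I * ((γ / 2 : ℝ) : ℂ)) + Complex.I * (π : ℂ) * (n : ℂ)}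

/-- The function `ε_u(z) = h - 2πJ sin(γ) / (γ cosh(πz/γ))`. -/
noncomputable def upperEnergy (γ J h : ℝ) (z : ℂ) : ℂ :=
  (h : ℂ) - ((2 * π * J * Real.sin γ : ℝ) : ℂ) /
    ((γ : ℂ) * Complex.cosh ((π : ℂ) * z / (γ : ℂ)))

/-- The upper critical field `h_c = 4J(1 + Δ)`, where `Δ = cos γ`. -/
noncomputable def upperCriticalField (γ J : ℝ) : ℝ := 4 * J * (1 + Real.cos γ)

/-- `f` is the function `ε(·|Q)`: it is continuous on `[-Q, Q]`, solves there the linear integral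
equation `f(z) = ε₀(z) - ∫_{-Q}^{Q} K(z - μ|γ) f(μ) dμ`, and is extended by the right-hand side of
this equation to `Υ_γ(Q)` without the poles of the driving term. Nothing is said about the values
of `f` on the cuts and at the poles. -/
structure IsDressedEnergyAt (γ J h Q : ℝ) (f : ℂ → ℂ) : Prop where
  continuousOn : ContinuousOn (fun t : ℝ => f (t : ℂ)) (Set.Icc (-Q) Q)
  equation : ∀ z ∈ domainUpsilon γ Q, z ∉ barePoles γ →
    f z = bareEnergy γ J h z - ∫ μ in (-Q)..Q, kernelK (z - (μ : ℂ)) γ * f (μ : ℂ)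

/-- `Q` is the Fermi rapidity and `ε` is the dressed energy: `Q > 0`, `ε = ε(·|Q)` and
`ε(Q|Q) = 0`. -/
structure IsDressedEnergy (γ J h Q : ℝ) (ε : ℂ → ℂ) : Prop where
  pos : 0 < Q
  dressed : IsDressedEnergyAt γ J h Q ε
  fermi : ε (Q : ℂ) = 0

/-- The integrand in the constant `c` below. Both factors are real for real `μ`. -/
noncomputable def constIntegrand (γ : ℝ) (ε : ℂ → ℂ) (μ : ℝ) : ℝ :=
  (kernelK ((μ / (1 - γ / π) : ℝ) : ℂ) ((γ / 2) / (1 - γ / π)) * ε (μ : ℂ)).re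

/-- The constant
`c = (h/2 + ∫_Q^∞ K(μ/(1 - γ/π) | (γ/2)/(1 - γ/π)) ε(μ) dμ) / (1 - γ/π)`. -/
noncomputable def constC (γ h Q : ℝ) (ε : ℂ → ℂ) : ℝ :=
  1 / (1 - γ / π) * (h / 2 + ∫ μ in Set.Ioi Q, constIntegrand γ ε μ)

end XXZ

namespace XXZ

open Complex Filter MeasureTheory Set

/-! Write K for the kernel with parameter γ and a = 1 - γ/π. The integral equation lives on [-Q, Q],
but with the part of ε outside the Fermi zone moved to the right-hand side it becomes (1 + K) ε = ε₀
+ K ε_out on the whole line, and there 1 + K can be inverted explicitly. Two residue computations do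
this. Convolving K with s(z) = 1/(2γ cosh(πz/γ)) gives the kernel of parameter γ/2 minus s
(`integral_stripKernel_mul_sechKernel`), so 1 + K sends s to that kernel. The kernel of parameter
γ/2 convolved with the coth kernel k of period iπa gives K (`integral_stripKernel_mul_stripKernel`).
Since K is positive with mass 1 - 2γ/π < 1, solutions are unique, and therefore ε = h/(2a) - 4πJ
sin(γ) s + s * V, where V = k * ε_out (`dressed_eq_dressedSource`). Both sides are analytic for |Im
z| < γ/2.

Monotonicity on the real axis is a bootstrap (`evenSlope_dressed`). Suppose ε is even with slope at
least -S on the positive half-line. As ε(Q) = 0, cutting out the Fermi zone preserves this.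
Convolution with an even positive unimodal kernel multiplies S by the mass of the kernel, and the
masses of k and s are below 1 and equal to 1/2. The driving term -s is increasing on the half-line,
so the inverted equation returns slope at least -S/2. A finite initial S comes from the original
equation, and iteration gives S = 0. Hence ε < 0 inside the Fermi zone and 0 < ε < h outside.

For |Im z| < γ/2 the real part of s is again even, positive, unimodal and of mass 1/2, so Re ε
increases in x, strictly because of the driving term. The imaginary part of s is odd with a sign, so
Im ε ≥ 0 in the first quadrant of the strip. By Cauchy–Riemann, Re ε decreases along the positive
imaginary axis and stays negative there. As ε → h at infinity, each line carries exactly one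
positive zero. Smoothness of the curve is the implicit function theorem, and along it the derivative
of Im ε times Re ε' equals |ε'|² (`IsZeroCurve.hasDerivAt_im`). The bounds by ε₀ and ε_u follow from
ε < 0 inside and V < h times the mass of k.

When z crosses the lines Im z = γ/2 and Im z = γ, poles cross the contours of the two convolutions.
This gives ε(z) = h/a + V(z - iγ/2) for Im z > γ (`dressed_eq_of_gt`), and ε(z) + ε(z - iγ) equals
the same expression for γ/2 < Im z < γ (`dressed_add_dressed_eq`). The real part of k off the axis
is an average of two real kernels of known sign and mass (`stripKernel_re`), and 0 ≤ ε_out < h turns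
these into the lower bounds.

Near iγ/2 one has ε = 2iJ sin(γ)/w + regular part. Evaluating the second identity at w = iδ and
using evenness shows that the regular part tends to c (`tendsto_dressed_sub_pole`). The condition Re
ε = 0 then balances the pole term against c, which yields both asymptotic laws. -/

/-! ### Moduli of complex cosh and sinh -/

theorem cosh_re_im (z : ℂ) : cosh z = (Real.cosh z.re * Real.cos z.im : ℝ) +
    (Real.sinh z.re * Real.sin z.im : ℝ) * I := by
  conv_lhs => rw [← Complex.re_add_im z]
  rw [Complex.cosh_add, Complex.cosh_mul_I, Complex.sinh_mul_I]
  push_cast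
  ring

theorem sinh_re_im (z : ℂ) : sinh z = (Real.sinh z.re * Real.cos z.im : ℝ) +
    (Real.cosh z.re * Real.sin z.im : ℝ) * I := by
  conv_lhs => rw [← Complex.re_add_im z]
  rw [Complex.sinh_add, Complex.cosh_mul_I, Complex.sinh_mul_I]
  push_cast
  ring

theorem cosh_re (z : ℂ) : (cosh z).re = Real.cosh z.re * Real.cos z.im := by
  rw [cosh_re_im]; simp [-ofReal_mul]

theorem cosh_im (z : ℂ) : (cosh z).im = Real.sinh z.re * Real.sin z.im := by
  rw [cosh_re_im]; simp [-ofReal_mul]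

theorem sinh_re (z : ℂ) : (sinh z).re = Real.sinh z.re * Real.cos z.im := by
  rw [sinh_re_im]; simp [-ofReal_mul]

theorem sinh_im (z : ℂ) : (sinh z).im = Real.cosh z.re * Real.sin z.im := by
  rw [sinh_re_im]; simp [-ofReal_mul]

theorem normSq_cosh (z : ℂ) : ‖cosh z‖ ^ 2 = Real.cosh z.re ^ 2 - Real.sin z.im ^ 2 := by
  rw [← Complex.normSq_eq_norm_sq, Complex.normSq_apply, XXZ.cosh_re, XXZ.cosh_im]
  have h1 := Real.cosh_sq z.re
  have h2 := Real.sin_sq_add_cos_sq z.im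
  ring_nf
  linear_combination (-Real.sin z.im ^ 2) * h1 + Real.cosh z.re ^ 2 * h2

theorem normSq_sinh (z : ℂ) : ‖sinh z‖ ^ 2 = Real.cosh z.re ^ 2 - Real.cos z.im ^ 2 := by
  rw [← Complex.normSq_eq_norm_sq, Complex.normSq_apply, XXZ.sinh_re, XXZ.sinh_im]
  have h1 := Real.cosh_sq z.re
  have h2 := Real.sin_sq_add_cos_sq z.im
  ring_nf
  linear_combination (-Real.cos z.im ^ 2) * h1 + Real.cosh z.re ^ 2 * h2

theorem norm_cosh_le (z : ℂ) : ‖cosh z‖ ≤ Real.cosh z.re := by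
  have h := normSq_cosh z
  have := (Real.cosh_pos z.re).le
  exact abs_le_of_sq_le_sq' (by nlinarith [sq_nonneg (Real.sin z.im)]) this |>.2

theorem norm_sinh_le (z : ℂ) : ‖sinh z‖ ≤ Real.cosh z.re := by
  have h := normSq_sinh z
  have := (Real.cosh_pos z.re).le
  exact abs_le_of_sq_le_sq' (by nlinarith [sq_nonneg (Real.cos z.im)]) this |>.2

theorem cosh_mul_cos_le (z : ℂ) : Real.cosh z.re * |Real.cos z.im| ≤ ‖cosh z‖ := by
  have h := normSq_cosh z
  have h1 := Real.one_le_cosh z.re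
  have h2 := Real.sin_sq_add_cos_sq z.im
  refine abs_le_of_sq_le_sq' ?_ (norm_nonneg _) |>.2
  rw [mul_pow, sq_abs, h]
  nlinarith [mul_nonneg (sq_nonneg (Real.sin z.im)) (by nlinarith : 0 ≤ Real.cosh z.re ^ 2 - 1)]

theorem cosh_mul_sin_le (z : ℂ) : Real.cosh z.re * |Real.sin z.im| ≤ ‖sinh z‖ := by
  have h := normSq_sinh z
  have h1 := Real.one_le_cosh z.re
  have h2 := Real.sin_sq_add_cos_sq z.im
  refine abs_le_of_sq_le_sq' ?_ (norm_nonneg _) |>.2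
  rw [mul_pow, sq_abs, h]
  nlinarith [mul_nonneg (sq_nonneg (Real.cos z.im)) (by nlinarith : 0 ≤ Real.cosh z.re ^ 2 - 1)]

theorem abs_sinh_le (z : ℂ) : |Real.sinh z.re| ≤ ‖sinh z‖ := by
  have h := normSq_sinh z
  have h2 := Real.sin_sq_add_cos_sq z.im
  have h3 := Real.cosh_sq z.re
  refine abs_le_of_sq_le_sq' ?_ (norm_nonneg _) |>.2
  rw [sq_abs, h]
  nlinarith [sq_nonneg (Real.sin z.im)]

theorem abs_sinh_le_norm_cosh (z : ℂ) : |Real.sinh z.re| ≤ ‖cosh z‖ := by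
  have h := normSq_cosh z
  have h2 := Real.sin_sq_add_cos_sq z.im
  have h3 := Real.cosh_sq z.re
  refine abs_le_of_sq_le_sq' ?_ (norm_nonneg _) |>.2
  rw [sq_abs, h]
  nlinarith [sq_nonneg (Real.cos z.im)]

theorem sinh_ne_zero_of_sin {z : ℂ} (h : Real.sin z.im ≠ 0) : sinh z ≠ 0 := by
  intro h0
  have := cosh_mul_sin_le z
  rw [h0, norm_zero] at this
  have := mul_pos (Real.cosh_pos z.re) (abs_pos.2 h)
  linarith

theorem cosh_ne_zero_of_cos {z : ℂ} (h : Real.cos z.im ≠ 0) : cosh z ≠ 0 := by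
  intro h0
  have := cosh_mul_cos_le z
  rw [h0, norm_zero] at this
  have := mul_pos (Real.cosh_pos z.re) (abs_pos.2 h)
  linarith

theorem sinh_ne_zero_of_re {z : ℂ} (h : z.re ≠ 0) : sinh z ≠ 0 := by
  intro h0
  have := abs_sinh_le z
  rw [h0, norm_zero] at this
  have h2 : Real.sinh z.re = 0 := abs_eq_zero.1 (le_antisymm this (abs_nonneg _))
  exact h (Real.sinh_eq_zero.1 h2)

/-! ### The integral of 1/cosh -/

theorem hasDerivAt_arctan_sinh (x : ℝ) :
    HasDerivAt (fun x => Real.arctan (Real.sinh x)) ((Real.cosh x)⁻¹) x := by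
  have h := (Real.hasDerivAt_sinh x).arctan
  convert h using 1
  have := Real.cosh_sq x
  rw [show 1 + Real.sinh x ^ 2 = Real.cosh x ^ 2 by linarith]
  have := (Real.cosh_pos x).ne'
  field_simp

theorem tendsto_sinh_atTop : Tendsto Real.sinh atTop atTop := Real.sinhOrderIso.tendsto_atTop

theorem integrable_sech : Integrable (fun x : ℝ => (Real.cosh x)⁻¹) := by
  refine (integrable_inv_one_add_sq.const_mul 2).mono' ?_ (Eventually.of_forall fun x => ?_)
  · exact (Real.continuous_cosh.inv₀ fun x => (Real.cosh_pos x).ne').aestronglyMeasurable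
  · rw [Real.norm_of_nonneg (inv_nonneg.2 (Real.cosh_pos x).le), ← div_eq_mul_inv]
    rw [inv_eq_one_div, div_le_div_iff₀ (Real.cosh_pos x) (by positivity)]
    -- cosh x = 1 + 2 sinh²(x/2) ≥ 1 + x²/2, whence 1/cosh x ≤ 2/(1 + x²).
    have h : (x / 2) ^ 2 ≤ Real.sinh (x / 2) ^ 2 := by
      rw [sq_le_sq, Real.abs_sinh]
      exact Real.self_le_sinh_iff.2 (abs_nonneg _)
    have h2 := Real.cosh_two_mul (x / 2)
    rw [mul_div_cancel₀ _ two_ne_zero] at h2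
    nlinarith [Real.cosh_sq (x / 2)]

theorem integral_sech : ∫ x : ℝ, (Real.cosh x)⁻¹ = π := by
  rw [integral_of_hasDerivAt_of_tendsto (m := -(π / 2)) (n := π / 2) hasDerivAt_arctan_sinh
    integrable_sech]
  · ring
  · exact (tendsto_nhds_of_tendsto_nhdsWithin Real.tendsto_arctan_atBot).comp
      Real.sinhOrderIso.tendsto_atBot
  · exact (tendsto_nhds_of_tendsto_nhdsWithin Real.tendsto_arctan_atTop).comp tendsto_sinh_atTop

theorem integrable_sech_mul {k : ℝ} (hk : 0 < k) :
    Integrable (fun x : ℝ => (Real.cosh (k * x))⁻¹) :=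
  integrable_sech.comp_mul_left' hk.ne'

/-! ### Contour shifts and residues in a strip -/

/-- Shifting the line of integration across a strip without poles. -/
theorem integral_line_sub_line {H : ℂ → ℂ} {c₁ c₂ : ℝ} {p m : ℂ} {b : ℝ → ℝ} (hc : c₁ ≤ c₂)
    (hd : DifferentiableOn ℂ H (Complex.im ⁻¹' Icc c₁ c₂)) (hb : Tendsto b atTop (𝓝 0))
    (hp : ∀ᶠ x : ℝ in atTop, ∀ y ∈ Icc c₁ c₂, ‖H (x + y * I) - p‖ ≤ b x)
    (hm : ∀ᶠ x : ℝ in atTop, ∀ y ∈ Icc c₁ c₂, ‖H (((-x : ℝ) : ℂ) + y * I) - m‖ ≤ b x)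
    (hi : Integrable (fun t : ℝ => H (t + c₁ * I) - H (t + c₂ * I))) :
    ∫ t : ℝ, (H (t + c₁ * I) - H (t + c₂ * I)) = -I * (c₂ - c₁) * (p - m) := by
  have hcont : ContinuousOn H (Complex.im ⁻¹' Icc c₁ c₂) := hd.continuousOn
  have hline : ∀ c ∈ Icc c₁ c₂, Continuous (fun t : ℝ => H (t + c * I)) := fun c hc' =>
    hcont.comp_continuous (by fun_prop) (fun t => by simpa using hc')
  have hvert : ∀ x : ℝ, ContinuousOn (fun y : ℝ => H (x + y * I)) (uIcc c₁ c₂) := fun x =>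
    hcont.comp (by fun_prop) (fun y hy => by rw [uIcc_of_le hc] at hy; simpa using hy)
  -- The vertical sides need not vanish: they tend to the height of the rectangle times the limits
  -- `p` and `m` of `H`. For coth these limits differ, which produces the masses of the kernels.
  have hlim : ∀ (s : ℝ → ℝ) (q : ℂ),
      (∀ᶠ x : ℝ in atTop, ∀ y ∈ Icc c₁ c₂, ‖H ((s x : ℝ) + y * I) - q‖ ≤ b x) →
      Tendsto (fun x : ℝ => ∫ y in c₁..c₂, H ((s x : ℝ) + y * I)) atTop
        (𝓝 ((c₂ - c₁) * q)) := by
    intro s q h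
    rw [tendsto_iff_norm_sub_tendsto_zero]
    refine squeeze_zero' (Eventually.of_forall fun _ => norm_nonneg _) (?_ : ∀ᶠ x in atTop, _ ≤
      b x * (c₂ - c₁)) (by simpa using hb.mul_const (c₂ - c₁))
    filter_upwards [h] with x hx
    have e : (∫ y in c₁..c₂, H ((s x : ℝ) + y * I)) - (c₂ - c₁) * q
        = ∫ y in c₁..c₂, (H ((s x : ℝ) + y * I) - q) := by
      rw [intervalIntegral.integral_sub (hvert _).intervalIntegrable
        intervalIntegrable_const]
      simp
    rw [e]
    have := intervalIntegral.norm_integral_le_of_norm_le_const (a := c₁) (b := c₂)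
      (f := fun y : ℝ => H ((s x : ℝ) + y * I) - q) (C := b x) (fun y hy => by
        rw [uIoc_of_le hc] at hy
        exact hx y ⟨hy.1.le, hy.2⟩)
    rwa [abs_of_nonneg (by linarith)] at this
  have h1 : Tendsto (fun T : ℝ => ∫ t in (-T)..T, (H (t + c₁ * I) - H (t + c₂ * I))) atTop
      (𝓝 (∫ t : ℝ, (H (t + c₁ * I) - H (t + c₂ * I)))) :=
    intervalIntegral_tendsto_integral hi tendsto_neg_atTop_atBot tendsto_id
  have h2 : (fun T : ℝ => ∫ t in (-T)..T, (H (t + c₁ * I) - H (t + c₂ * I)))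
      = fun T : ℝ => -I * ((∫ y in c₁..c₂, H ((T : ℝ) + y * I)) -
        ∫ y in c₁..c₂, H (((-T : ℝ) : ℂ) + y * I)) := by
    funext T
    rw [intervalIntegral.integral_sub
      (hline c₁ ⟨le_rfl, hc⟩).continuousOn.intervalIntegrable
      (hline c₂ ⟨hc, le_rfl⟩).continuousOn.intervalIntegrable]
    have := Complex.integral_boundary_rect_eq_zero_of_differentiableOn H
      ((-T : ℝ) + c₁ * I) ((T : ℝ) + c₂ * I) (hd.mono (fun z hz => by
        simp only [mem_reProdIm, add_im, ofReal_im, mul_im, ofReal_re, I_im, I_re, mul_zero,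
          mul_one, add_zero, zero_add] at hz
        rw [uIcc_of_le hc] at hz
        exact hz.2))
    simp only [add_im, ofReal_im, mul_im, ofReal_re, I_im, I_re, mul_zero, mul_one, add_zero,
      zero_add, add_re, mul_re, sub_zero, smul_eq_mul] at this
    linear_combination this
  rw [h2] at h1
  have h3 := ((hlim id p hp).sub (hlim (fun x => -x) m hm)).const_mul (-I)
  rw [tendsto_nhds_unique h1 h3]
  ring

theorem norm_inv_sinh_le {κ x : ℝ} (hκ : 0 < κ) (hx : 0 < x) (z : ℂ) (hz : |z.re| = x) :
    ‖(sinh (κ * z))⁻¹‖ ≤ (Real.sinh (κ * x))⁻¹ := by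
  rw [norm_inv]
  have h := abs_sinh_le (κ * z)
  have e : (κ * z : ℂ).re = κ * z.re := by simp
  rw [e, Real.abs_sinh, abs_mul, hz, abs_of_pos hκ] at h
  exact inv_anti₀ (Real.sinh_pos_iff.2 (by positivity)) h

theorem tendsto_inv_sinh {κ : ℝ} (hκ : 0 < κ) (x₀ : ℝ) :
    Tendsto (fun x : ℝ => (Real.sinh (κ * (x - x₀)))⁻¹) atTop (𝓝 0) :=
  tendsto_inv_atTop_zero.comp (tendsto_sinh_atTop.comp
    ((tendsto_atTop_add_const_right _ (-x₀) tendsto_id).const_mul_atTop hκ))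

theorem integrable_inv_sinh_line {κ θ : ℝ} (hκ : 0 < κ) (hs : Real.sin (κ * θ) ≠ 0) :
    Integrable (fun t : ℝ => (sinh (κ * (t + θ * I)))⁻¹) := by
  have hne : ∀ t : ℝ, sinh ((κ : ℂ) * (t + θ * I)) ≠ 0 := fun t =>
    sinh_ne_zero_of_sin (by simpa using hs)
  refine ((integrable_sech_mul hκ).const_mul (|Real.sin (κ * θ)|⁻¹)).mono'
    (Continuous.inv₀ (by fun_prop) hne).aestronglyMeasurable (Eventually.of_forall fun t => ?_)
  have h := cosh_mul_sin_le (κ * (t + θ * I))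
  simp only [mul_re, ofReal_re, ofReal_im, add_re, mul_im, I_re, I_im, add_im, zero_mul, sub_zero,
    mul_zero, mul_one, add_zero, zero_add, sub_self] at h
  rw [norm_inv, ← mul_inv, mul_comm |_|]
  exact inv_anti₀ (mul_pos (Real.cosh_pos _) (abs_pos.2 hs)) h

/-- No pole lies between the lines with 0 < κθ < π, so the line can be moved to κθ = π/2, where sinh
becomes i cosh and the integral is that of 1/cosh. The function is the model of a simple pole used
in the residue theorem below. -/
theorem integral_inv_sinh_line {κ θ : ℝ} (hκ : 0 < κ) (h0 : 0 < κ * θ) (h1 : κ * θ < π) :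
    ∫ t : ℝ, (κ : ℂ) * (sinh (κ * (t + θ * I)))⁻¹ = -(π * I) := by
  have hθ : 0 < θ := pos_of_mul_pos_right h0 hκ.le
  have hθ0 : κ * (π / (2 * κ)) = π / 2 := by field_simp
  have hint : ∀ c, 0 < κ * c → κ * c < π →
      Integrable (fun t : ℝ => (κ : ℂ) * (sinh (κ * (t + c * I)))⁻¹) := fun c hc hc' =>
    (integrable_inv_sinh_line hκ (Real.sin_pos_of_pos_of_lt_pi hc hc').ne').const_mul _
  have key : ∀ c₁ c₂ : ℝ, c₁ ≤ c₂ → 0 < κ * c₁ → κ * c₂ < π →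
      ∫ t : ℝ, (κ : ℂ) * (sinh (κ * (t + c₁ * I)))⁻¹ =
      ∫ t : ℝ, (κ : ℂ) * (sinh (κ * (t + c₂ * I)))⁻¹ := by
    intro c₁ c₂ hc hc₁ hc₂
    have hc₁' : κ * c₁ < π := lt_of_le_of_lt (mul_le_mul_of_nonneg_left hc hκ.le) hc₂
    have hc₂' : 0 < κ * c₂ := lt_of_lt_of_le hc₁ (mul_le_mul_of_nonneg_left hc hκ.le)
    have := integral_line_sub_line (H := fun z => (κ : ℂ) * (sinh (κ * z))⁻¹) (p := 0) (m := 0)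
      (b := fun x => κ * (Real.sinh (κ * (x - 0)))⁻¹) hc ?_
      (by simpa using (tendsto_inv_sinh hκ 0).const_mul κ) ?_ ?_
      ((hint _ hc₁ hc₁').sub (hint _ hc₂' hc₂))
    · rw [integral_sub (hint _ hc₁ hc₁') (hint _ hc₂' hc₂)] at this
      simp only [sub_self, mul_zero] at this
      exact sub_eq_zero.1 this
    · intro z hz
      have hz' : sinh (κ * z) ≠ 0 := sinh_ne_zero_of_sin (by
        have h1 : κ * c₁ ≤ κ * z.im := mul_le_mul_of_nonneg_left hz.1 hκ.le
        have h2 : κ * z.im ≤ κ * c₂ := mul_le_mul_of_nonneg_left hz.2 hκ.le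
        simpa using (Real.sin_pos_of_pos_of_lt_pi (by linarith) (by linarith)).ne')
      have : DifferentiableAt ℂ (fun z => (κ : ℂ) * (sinh (κ * z))⁻¹) z :=
        (DifferentiableAt.fun_inv (h := fun z : ℂ => sinh (κ * z)) (by fun_prop) hz').const_mul _
      exact this.differentiableWithinAt
    · filter_upwards [eventually_gt_atTop 0] with x hx y _
      rw [sub_zero, sub_zero, norm_mul, norm_real, Real.norm_of_nonneg hκ.le]
      exact mul_le_mul_of_nonneg_left (norm_inv_sinh_le hκ hx _ (by simp [abs_of_pos hx])) hκ.le
    · filter_upwards [eventually_gt_atTop 0] with x hx y _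
      rw [sub_zero, sub_zero, norm_mul, norm_real, Real.norm_of_nonneg hκ.le]
      exact mul_le_mul_of_nonneg_left (norm_inv_sinh_le hκ hx _ (by simp [abs_of_pos hx])) hκ.le
  have mid : ∫ t : ℝ, (κ : ℂ) * (sinh (κ * (t + (π / (2 * κ) : ℝ) * I)))⁻¹ = -(π * I) := by
    have e : ∀ t : ℝ, (κ : ℂ) * (sinh (κ * (t + (π / (2 * κ) : ℝ) * I)))⁻¹
        = -I * ((κ * (Real.cosh (κ * t))⁻¹ : ℝ) : ℂ) := by
      intro t
      have : (κ : ℂ) * (t + (π / (2 * κ) : ℝ) * I) = (κ * t : ℝ) + (π / 2) * I := by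
        have : (κ : ℂ) ≠ 0 := by exact_mod_cast hκ.ne'
        push_cast
        field_simp
      rw [this, Complex.sinh_add, Complex.sinh_mul_I, Complex.cosh_mul_I]
      simp only [Complex.cos_pi_div_two, Complex.sin_pi_div_two]
      have h := Complex.I_mul_I
      have hc : (Complex.cosh (κ * t : ℝ)) ≠ 0 := by
        rw [← Complex.ofReal_cosh]; exact_mod_cast (Real.cosh_pos _).ne'
      push_cast at hc ⊢
      field_simp
      linear_combination (Complex.cosh (κ * t) * κ) * h
    simp_rw [e]
    rw [integral_const_mul, integral_complex_ofReal, integral_const_mul,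
      MeasureTheory.Measure.integral_comp_mul_left (fun x => (Real.cosh x)⁻¹) κ, integral_sech,
      abs_of_pos (inv_pos.2 hκ), smul_eq_mul, mul_inv_cancel_left₀ hκ.ne']
    ring
  rcases le_total θ (π / (2 * κ)) with h | h
  · rw [key _ _ h h0 (by rw [hθ0]; linarith [Real.pi_pos]), mid]
  · rw [← key _ _ h (by rw [hθ0]; linarith [Real.pi_pos]) h1, mid]

theorem integral_inv_sinh_line_neg {κ θ : ℝ} (hκ : 0 < κ) (h0 : κ * θ < 0) (h1 : -π < κ * θ) :
    ∫ t : ℝ, (κ : ℂ) * (sinh (κ * (t + θ * I)))⁻¹ = π * I := by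
  have h := integral_inv_sinh_line (κ := κ) (θ := -θ) hκ (by linarith) (by linarith)
  rw [← integral_neg_eq_self] at h
  rw [← neg_eq_iff_eq_neg] at h
  rw [← h, ← integral_neg]
  congr 1
  funext t
  rw [show (κ : ℂ) * (((-t : ℝ) : ℂ) + ((-θ : ℝ) : ℂ) * I) = -(κ * (t + θ * I)) by push_cast; ring,
    Complex.sinh_neg, inv_neg]
  ring

theorem tendsto_mul_inv_sinh {κ : ℝ} (hκ : 0 < κ) (s : ℂ) :
    Tendsto (fun w : ℂ => (w - s) * (κ * (sinh (κ * (w - s)))⁻¹)) (𝓝[≠] s) (𝓝 1) := by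
  have hd : HasDerivAt (fun w : ℂ => sinh (κ * (w - s))) (κ : ℂ) s := by
    have h := (((hasDerivAt_id s).sub_const s).const_mul (κ : ℂ)).csinh
    simpa using h
  have h := hd.tendsto_slope
  have hκ' : (κ : ℂ) ≠ 0 := by exact_mod_cast hκ.ne'
  have h2 := (h.inv₀ hκ').const_mul (κ : ℂ)
  rw [mul_inv_cancel₀ hκ'] at h2
  refine h2.congr fun w => ?_
  simp only [slope_def_field, sub_self, mul_zero, Complex.sinh_zero, sub_zero, inv_div]
  rw [div_eq_mul_inv]
  ring

/-- The residue theorem for a strip, for functions that decay along it. -/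
theorem integral_line_sub_line_eq_residues {c₁ c₂ : ℝ} (hc : c₁ < c₂) (r : ℂ → ℂ) (S : Finset ℂ) :
    ∀ (H : ℂ → ℂ) (b : ℝ → ℝ),
    DifferentiableOn ℂ H (Complex.im ⁻¹' Icc c₁ c₂ \ S) →
    (∀ s ∈ S, s.im ∈ Ioo c₁ c₂) →
    (∀ s ∈ S, Tendsto (fun w => (w - s) * H w) (𝓝[≠] s) (𝓝 (r s))) →
    Tendsto b atTop (𝓝 0) →
    (∀ᶠ x : ℝ in atTop, ∀ y ∈ Icc c₁ c₂, ‖H (x + y * I)‖ ≤ b x) →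
    (∀ᶠ x : ℝ in atTop, ∀ y ∈ Icc c₁ c₂, ‖H (((-x : ℝ) : ℂ) + y * I)‖ ≤ b x) →
    Integrable (fun t : ℝ => H (t + c₁ * I)) → Integrable (fun t : ℝ => H (t + c₂ * I)) →
    (∫ t : ℝ, H (t + c₁ * I)) - ∫ t : ℝ, H (t + c₂ * I) = 2 * π * I * ∑ s ∈ S, r s := by
  classical
  induction S using Finset.induction_on with
  | empty =>
    intro H b hd _ _ hb hp hm h1 h2
    rw [← integral_sub h1 h2, integral_line_sub_line (p := 0) (m := 0) hc.le (by simpa using hd) hb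
      (by simpa using hp) (by simpa using hm) (h1.sub h2)]
    simp
  | insert s S hsS ih =>
    intro H b hd hS hr hb hp hm h1 h2
    -- With this scale, 1/sinh(κ(w - s)) has `s` as its only pole in the closed strip, since the
    -- next poles are one strip width c₂ - c₁ away.
    set κ : ℝ := π / (c₂ - c₁) with hκdef
    have hκ : 0 < κ := div_pos Real.pi_pos (by linarith)
    have hκc : κ * (c₂ - c₁) = π := by rw [hκdef]; field_simp [(by linarith : c₂ - c₁ ≠ 0)]
    have hs : s.im ∈ Ioo c₁ c₂ := hS s (Finset.mem_insert_self _ _)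
    set E : ℂ → ℂ := fun w => κ * (sinh (κ * (w - s)))⁻¹ with hE
    have hsinh : ∀ w : ℂ, w.im ∈ Icc c₁ c₂ → w ≠ s → sinh (κ * (w - s)) ≠ 0 := by
      intro w hw hws
      by_cases hre : w.re = s.re
      · have him : w.im - s.im ≠ 0 := fun h => hws (Complex.ext hre (by linarith))
        apply sinh_ne_zero_of_sin
        have e : ((κ : ℂ) * (w - s)).im = κ * (w.im - s.im) := by simp
        rw [e]
        rcases lt_or_gt_of_ne him with h | h
        · refine (Real.sin_neg_of_neg_of_neg_pi_lt (mul_neg_of_pos_of_neg hκ h) ?_).ne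
          nlinarith [hw.1, hs.2]
        · refine (Real.sin_pos_of_pos_of_lt_pi (mul_pos hκ h) ?_).ne'
          nlinarith [hw.2, hs.1]
      · apply sinh_ne_zero_of_re
        simpa [hκ.ne', sub_eq_zero] using hre
    have hEd : ∀ w : ℂ, w.im ∈ Icc c₁ c₂ → w ≠ s → DifferentiableAt ℂ E w := fun w hw hws =>
      (DifferentiableAt.fun_inv (h := fun w : ℂ => sinh (κ * (w - s))) (by fun_prop)
        (hsinh w hw hws)).const_mul _
    have hEc : ∀ w : ℂ, w.im ∈ Icc c₁ c₂ → w ≠ s → ContinuousAt E w := fun w hw hws =>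
      (hEd w hw hws).continuousAt
    have hEline : ∀ c : ℝ, (fun t : ℝ => E (t + c * I)) = fun t : ℝ =>
        (fun t : ℝ => (κ : ℂ) * (sinh (κ * (t + (c - s.im : ℝ) * I)))⁻¹) (t - s.re) := by
      intro c
      funext t
      simp only [hE]
      congr 3
      conv_lhs => rw [← Complex.re_add_im s]
      push_cast
      ring
    have hκ1 : κ * (c₁ - s.im) < 0 ∧ -π < κ * (c₁ - s.im) :=
      ⟨by nlinarith [hs.1], by nlinarith [hs.2]⟩
    have hκ2 : 0 < κ * (c₂ - s.im) ∧ κ * (c₂ - s.im) < π :=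
      ⟨by nlinarith [hs.2], by nlinarith [hs.1]⟩
    have hE1 : Integrable (fun t : ℝ => E (t + c₁ * I)) := by
      rw [hEline]
      exact ((integrable_inv_sinh_line hκ
        (Real.sin_neg_of_neg_of_neg_pi_lt hκ1.1 hκ1.2).ne).const_mul _).comp_sub_right s.re
    have hE2 : Integrable (fun t : ℝ => E (t + c₂ * I)) := by
      rw [hEline]
      exact ((integrable_inv_sinh_line hκ
        (Real.sin_pos_of_pos_of_lt_pi hκ2.1 hκ2.2).ne').const_mul _).comp_sub_right s.re
    have hEi1 : ∫ t : ℝ, E (t + c₁ * I) = π * I := by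
      rw [hEline, integral_sub_right_eq_self (fun t : ℝ =>
        (κ : ℂ) * (sinh (κ * (t + (c₁ - s.im : ℝ) * I)))⁻¹) s.re]
      exact integral_inv_sinh_line_neg hκ hκ1.1 hκ1.2
    have hEi2 : ∫ t : ℝ, E (t + c₂ * I) = -(π * I) := by
      rw [hEline, integral_sub_right_eq_self (fun t : ℝ =>
        (κ : ℂ) * (sinh (κ * (t + (c₂ - s.im : ℝ) * I)))⁻¹) s.re]
      exact integral_inv_sinh_line hκ hκ2.1 hκ2.2
    -- Subtracting r(s)E removes the pole at `s`. The singularity is then filled with its limit, so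
    -- the induction hypothesis applies to `S`, and E itself contributes πi - (-πi) = 2πi times
    -- r(s).
    set H₁ : ℂ → ℂ := fun w => H w - r s * E w with hH₁
    set H₂ : ℂ → ℂ := Function.update H₁ s ((𝓝[≠] s).limUnder H₁) with hH₂
    have hne : ∀ w : ℂ, w ≠ s → H₂ w = H w - r s * E w := fun w hw => by
      rw [hH₂, Function.update_of_ne hw]
    have hopen : Complex.im ⁻¹' Icc c₁ c₂ \ (S : Set ℂ) ∈ 𝓝 s := by
      refine inter_mem ?_ (S.finite_toSet.isClosed.isOpen_compl.mem_nhds (by simpa using hsS))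
      exact mem_of_superset ((isOpen_Ioo.preimage Complex.continuous_im).mem_nhds hs)
        (preimage_mono Ioo_subset_Icc_self)
    have hH₂d : DifferentiableOn ℂ H₂ (Complex.im ⁻¹' Icc c₁ c₂ \ S) := by
      refine Complex.differentiableOn_update_limUnder_of_isLittleO hopen ?_ ?_
      · intro w hw
        have hws : w ≠ s := hw.2
        refine ((hd w ⟨hw.1.1, ?_⟩).mono ?_).sub
          (((hEd w hw.1.1 hws).const_mul _).differentiableWithinAt)
        · simp only [Finset.coe_insert, mem_insert_iff, not_or]
          exact ⟨hws, hw.1.2⟩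
        · intro v hv
          simp only [Finset.coe_insert, Set.mem_sdiff, mem_insert_iff, not_or]
          exact ⟨hv.1.1, hv.2, hv.1.2⟩
      · rw [Asymptotics.isLittleO_iff_tendsto']
        · have l1 := (hr s (Finset.mem_insert_self _ _)).sub
            ((tendsto_mul_inv_sinh hκ s).const_mul (r s))
          have l2 : Tendsto (fun w : ℂ => (w - s) * H₁ s) (𝓝[≠] s) (𝓝 0) := by
            have : ContinuousAt (fun w : ℂ => (w - s) * H₁ s) s := by fun_prop
            simpa using this.continuousWithinAt (s := {s}ᶜ) |>.tendsto
          have l3 := l1.sub l2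
          simp only [mul_one, sub_self] at l3
          refine l3.congr fun w => ?_
          simp only [hH₁, hE, div_inv_eq_mul]
          ring
        · filter_upwards [self_mem_nhdsWithin] with w hw h0
          exact absurd (inv_eq_zero.1 h0) (sub_ne_zero.2 hw)
    have hoff : ∀ c ∈ ({c₁, c₂} : Set ℝ), ∀ t : ℝ, (t + c * I : ℂ) ≠ s := by
      intro c hc' t h
      have := congrArg Complex.im h
      simp at this
      rcases hc' with rfl | rfl
      · linarith [hs.1]
      · linarith [hs.2]
    have hb' : Tendsto (fun x => b x + ‖r s‖ * (κ * (Real.sinh (κ * (x - |s.re|)))⁻¹)) atTop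
        (𝓝 0) := by
      simpa using hb.add (((tendsto_inv_sinh hκ |s.re|).const_mul κ).const_mul ‖r s‖)
    have htail : ∀ x y u : ℝ, |s.re| < x → |u| = x → ‖E (u + y * I)‖ ≤
        κ * (Real.sinh (κ * (x - |s.re|)))⁻¹ := by
      intro x y u hx hu
      rw [hE]
      simp only [norm_mul, norm_real, Real.norm_of_nonneg hκ.le]
      refine mul_le_mul_of_nonneg_left ?_ hκ.le
      have hre : (u + y * I - s : ℂ).re = u - s.re := by simp
      have h1 : x - |s.re| ≤ |u - s.re| := by rw [← hu]; exact abs_sub_abs_le_abs_sub _ _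
      refine (norm_inv_sinh_le hκ (x := |u - s.re|) (by linarith) _ (by rw [hre])).trans ?_
      exact inv_anti₀ (Real.sinh_pos_iff.2 (mul_pos hκ (by linarith)))
        (Real.sinh_le_sinh.2 (mul_le_mul_of_nonneg_left h1 hκ.le))
    have key := ih H₂ _ hH₂d (fun w hw => hS w (Finset.mem_insert_of_mem hw)) ?_ hb' ?_ ?_ ?_ ?_
    · rw [Finset.sum_insert hsS]
      have e : ∀ c ∈ ({c₁, c₂} : Set ℝ), (fun t : ℝ => H₂ (t + c * I)) =
          fun t : ℝ => H (t + c * I) - r s * E (t + c * I) := fun c hc' => by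
        funext t; exact hne _ (hoff c hc' t)
      rw [e c₁ (by simp), e c₂ (by simp), integral_sub h1 (hE1.const_mul _),
        integral_sub h2 (hE2.const_mul _), integral_const_mul (r s) (fun t : ℝ => E (t + c₁ * I)),
        integral_const_mul (r s) (fun t : ℝ => E (t + c₂ * I)), hEi1, hEi2] at key
      linear_combination key
    · intro w hw
      have hws : w ≠ s := fun h => hsS (h ▸ hw)
      have hwim := hS w (Finset.mem_insert_of_mem hw)
      have l1 := hr w (Finset.mem_insert_of_mem hw)
      have l2 : Tendsto (fun v : ℂ => (v - w) * (r s * E v)) (𝓝[≠] w) (𝓝 0) := by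
        have : ContinuousAt (fun v : ℂ => (v - w) * (r s * E v)) w :=
          (by fun_prop : ContinuousAt (fun v : ℂ => v - w) w).mul
            (continuousAt_const.mul (hEc w (Ioo_subset_Icc_self hwim) hws))
        simpa using this.continuousWithinAt (s := {w}ᶜ) |>.tendsto
      have l3 := l1.sub l2
      rw [sub_zero] at l3
      refine l3.congr' ?_
      filter_upwards [nhdsWithin_le_nhds (isOpen_ne.mem_nhds hws)] with v hv
      rw [hne v hv]
      ring
    · filter_upwards [hp, eventually_gt_atTop |s.re|] with x hx hxs y hy
      have hx0 : 0 < x := lt_of_le_of_lt (abs_nonneg _) hxs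
      have hws : (x + y * I : ℂ) ≠ s := fun h => by
        have := congrArg Complex.re h
        simp at this
        rw [← this, abs_of_pos hx0] at hxs
        exact lt_irrefl _ hxs
      rw [hne _ hws]
      refine (norm_sub_le _ _).trans (add_le_add (hx y hy) ?_)
      rw [norm_mul]
      exact mul_le_mul_of_nonneg_left (htail x y x hxs (abs_of_pos hx0)) (norm_nonneg _)
    · filter_upwards [hm, eventually_gt_atTop |s.re|] with x hx hxs y hy
      have hx0 : 0 < x := lt_of_le_of_lt (abs_nonneg _) hxs
      have hws : (((-x : ℝ) : ℂ) + y * I : ℂ) ≠ s := fun h => by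
        have := congrArg Complex.re h
        simp at this
        rw [← this, abs_neg, abs_of_pos hx0] at hxs
        exact lt_irrefl _ hxs
      rw [hne _ hws]
      refine (norm_sub_le _ _).trans (add_le_add (hx y hy) ?_)
      rw [norm_mul]
      exact mul_le_mul_of_nonneg_left (htail x y (-x) hxs (by rw [abs_neg, abs_of_pos hx0]))
        (norm_nonneg _)
    · have e : (fun t : ℝ => H₂ (t + c₁ * I)) =
          fun t : ℝ => H (t + c₁ * I) - r s * E (t + c₁ * I) := by
        funext t; exact hne _ (hoff c₁ (by simp) t)
      rw [e]
      exact h1.sub (hE1.const_mul _)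
    · have e : (fun t : ℝ => H₂ (t + c₂ * I)) =
          fun t : ℝ => H (t + c₂ * I) - r s * E (t + c₂ * I) := by
        funext t; exact hne _ (hoff c₂ (by simp) t)
      rw [e]
      exact h2.sub (hE2.const_mul _)

/-! ### The kernels: periods, symmetries, decay and residues -/

theorem sinh_eq_zero_iff' {z : ℂ} : sinh z = 0 ↔ z.re = 0 ∧ Real.sin z.im = 0 := by
  constructor
  · intro h
    refine ⟨?_, ?_⟩
    · by_contra h1; exact sinh_ne_zero_of_re h1 h
    · by_contra h1; exact sinh_ne_zero_of_sin h1 h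
  · rintro ⟨h1, h2⟩
    rw [sinh_re_im, h1, h2]; simp

theorem cosh_eq_zero_iff' {z : ℂ} : cosh z = 0 ↔ z.re = 0 ∧ Real.cos z.im = 0 := by
  constructor
  · intro h
    refine ⟨?_, ?_⟩
    · by_contra h1
      have := abs_sinh_le_norm_cosh z
      rw [h, norm_zero] at this
      exact h1 (Real.sinh_eq_zero.1 (abs_eq_zero.1 (le_antisymm this (abs_nonneg _))))
    · by_contra h1; exact cosh_ne_zero_of_cos h1 h
  · rintro ⟨h1, h2⟩
    rw [cosh_re_im, h1, h2]; simp

/-- The kernel `coth (z / b) / (2πib)`, of period `iπb` and residue `1 / (2πi)` at the origin. -/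
noncomputable def cothKernel (b : ℝ) (z : ℂ) : ℂ :=
  1 / (2 * π * I * b) * cosh (z / b) * (sinh (z / b))⁻¹

/-- The difference `cothKernel b (z - iθ) - cothKernel b (z + iθ)`. -/
noncomputable def stripKernel (b θ : ℝ) (z : ℂ) : ℂ :=
  cothKernel b (z - I * θ) - cothKernel b (z + I * θ)

/-- The kernel `1 / (2γ cosh (πz / γ))`. -/
noncomputable def sechKernel (γ : ℝ) (z : ℂ) : ℂ := (2 * γ * cosh (π * z / γ))⁻¹

theorem kernelK_eq (z : ℂ) (γ : ℝ) : kernelK z γ = stripKernel 1 γ z := by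
  simp only [kernelK, stripKernel, cothKernel, coth, ofReal_one, mul_one, div_eq_mul_inv, inv_one]
  ring

/-- Rescaling the argument and the parameter by 1/a changes the period from iπ to iπa. This
identifies the kernel in the constant c with the one in the inverted equation. -/
theorem kernelK_div (z : ℂ) {a : ℝ} (ha : a ≠ 0) (θ : ℝ) :
    kernelK (z / a) (θ / a) = a * stripKernel a θ z := by
  have ha' : (a : ℂ) ≠ 0 := by exact_mod_cast ha
  have e1 : z / a - I * ((θ / a : ℝ) : ℂ) = (z - I * θ) / a := by push_cast; ring
  have e2 : z / a + I * ((θ / a : ℝ) : ℂ) = (z + I * θ) / a := by push_cast; ring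
  rw [kernelK, e1, e2]
  simp only [stripKernel, cothKernel, coth]
  rw [mul_sub, mul_sub]
  congr 1 <;> field_simp

theorem cothKernel_add_period {b : ℝ} (hb : b ≠ 0) (z : ℂ) :
    cothKernel b (z + π * b * I) = cothKernel b z := by
  have hb' : (b : ℂ) ≠ 0 := by exact_mod_cast hb
  have e : (z + π * b * I) / b = z / b + π * I := by field_simp
  rw [cothKernel, e, Complex.cosh_add, Complex.sinh_add]
  simp [cothKernel, Complex.cosh_mul_I, Complex.sinh_mul_I, inv_neg]

theorem cothKernel_neg (b : ℝ) (z : ℂ) : cothKernel b (-z) = -cothKernel b z := by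
  simp [cothKernel, neg_div, inv_neg]

theorem cothKernel_conj (b : ℝ) (z : ℂ) :
    cothKernel b ((starRingEnd ℂ) z) = -(starRingEnd ℂ) (cothKernel b z) := by
  simp only [cothKernel, map_mul, map_inv₀, ← Complex.cosh_conj, ← Complex.sinh_conj, map_div₀,
    conj_ofReal, map_one, conj_I, map_ofNat]
  simp only [mul_neg, neg_mul, div_neg, neg_neg]

theorem differentiableAt_cothKernel {b : ℝ} {z : ℂ} (h : sinh (z / b) ≠ 0) :
    DifferentiableAt ℂ (cothKernel b) z := by
  unfold cothKernel
  exact DifferentiableAt.mul (by fun_prop)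
    (DifferentiableAt.fun_inv (h := fun z : ℂ => sinh (z / b)) (by fun_prop) h)

theorem norm_cothKernel_le {b : ℝ} (hb : 0 < b) {z : ℂ} (h : Real.sin (z.im / b) ≠ 0) :
    ‖cothKernel b z‖ ≤ 1 / (2 * π * b) * |Real.sin (z.im / b)|⁻¹ := by
  have e1 : (z / b).re = z.re / b := by simp
  have e2 : (z / b).im = z.im / b := by simp
  have h1 := cosh_mul_sin_le (z / b)
  have h2 := norm_cosh_le (z / b)
  rw [e1, e2] at h1
  rw [e1] at h2
  have hp := Real.cosh_pos (z.re / b)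
  have hs := abs_pos.2 h
  rw [cothKernel, mul_assoc, norm_mul, norm_mul, norm_inv]
  have e3 : ‖(1 / (2 * π * I * b) : ℂ)‖ = 1 / (2 * π * b) := by
    simp [abs_of_pos hb, abs_of_pos Real.pi_pos]
  rw [e3]
  refine mul_le_mul_of_nonneg_left ?_ (by positivity)
  rw [← div_eq_mul_inv, div_le_iff₀ (lt_of_lt_of_le (by positivity) h1)]
  calc ‖cosh (z / b)‖ ≤ Real.cosh (z.re / b) := h2
    _ = |Real.sin (z.im / b)|⁻¹ * (Real.cosh (z.re / b) * |Real.sin (z.im / b)|) := by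
        field_simp
    _ ≤ _ := mul_le_mul_of_nonneg_left h1 (by positivity)

/-- The subtraction formula for sinh exhibits the difference as a product of two factors 1/sinh;
this is where the decay of the strip kernels comes from. -/
theorem cothKernel_sub {b : ℝ} {z w : ℂ} (hz : sinh (z / b) ≠ 0)
    (hw : sinh (w / b) ≠ 0) : cothKernel b z - cothKernel b w =
      1 / (2 * π * I * b) * sinh ((w - z) / b) * ((sinh (z / b))⁻¹ * (sinh (w / b))⁻¹) := by
  rw [sub_div, Complex.sinh_sub, cothKernel, cothKernel]
  field_simp

/-- The kernel `coth` away from the imaginary axis. -/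
theorem norm_cothKernel_sub_le {b : ℝ} (hb : 0 < b) {z : ℂ} (hz : 0 < z.re) :
    ‖cothKernel b z - 1 / (2 * π * I * b)‖ ≤
      1 / (2 * π * b) * (Real.sinh (b⁻¹ * (z.re - 0)))⁻¹ := by
  have e1 : (z / b).re = z.re / b := by simp
  have hre : 0 < z.re / b := div_pos hz hb
  have hne : sinh (z / b) ≠ 0 := sinh_ne_zero_of_re (by rw [e1]; exact hre.ne')
  -- coth w - 1 = e^{-w}/sinh w.
  have e : cothKernel b z - 1 / (2 * π * I * b) =
      1 / (2 * π * I * b) * (exp (-(z / b)) * (sinh (z / b))⁻¹) := by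
    rw [cothKernel, ← Complex.cosh_sub_sinh]
    field_simp
  have e3 : ‖(1 / (2 * π * I * b) : ℂ)‖ = 1 / (2 * π * b) := by
    simp [abs_of_pos hb, abs_of_pos Real.pi_pos]
  rw [e, norm_mul, e3, norm_mul, norm_inv, Complex.norm_exp]
  refine mul_le_mul_of_nonneg_left ?_ (by positivity)
  have h := abs_sinh_le (z / b)
  rw [e1, abs_of_pos (Real.sinh_pos_iff.2 hre)] at h
  have h1 : Real.exp (-(z / b)).re ≤ 1 := Real.exp_le_one_iff.2 (by rw [neg_re, e1]; linarith)
  have h2 : ‖sinh (z / b)‖⁻¹ ≤ (Real.sinh (z.re / b))⁻¹ :=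
    inv_anti₀ (Real.sinh_pos_iff.2 hre) h
  calc _ ≤ 1 * (Real.sinh (z.re / b))⁻¹ := mul_le_mul h1 h2 (by positivity) zero_le_one
    _ = _ := by rw [one_mul, sub_zero, div_eq_inv_mul]

theorem norm_cothKernel_add_le {b : ℝ} (hb : 0 < b) {z : ℂ} (hz : z.re < 0) :
    ‖cothKernel b z - -(1 / (2 * π * I * b))‖ ≤
      1 / (2 * π * b) * (Real.sinh (b⁻¹ * (-z.re - 0)))⁻¹ := by
  have h := norm_cothKernel_sub_le hb (z := -z) (by simpa using hz)
  rw [cothKernel_neg, ← norm_neg, neg_sub, sub_neg_eq_add, add_comm, ← sub_neg_eq_add] at h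
  exact h

theorem tendsto_sub_mul_inv {f : ℂ → ℂ} {d s : ℂ} (hf : HasDerivAt f d s) (h0 : f s = 0)
    (hd : d ≠ 0) : Tendsto (fun w => (w - s) * (f w)⁻¹) (𝓝[≠] s) (𝓝 d⁻¹) := by
  refine (hf.tendsto_slope.inv₀ hd).congr fun w => ?_
  simp [slope_def_field, h0, div_eq_mul_inv]

theorem tendsto_sub_mul_of_continuousAt {f : ℂ → ℂ} {s : ℂ} (hf : ContinuousAt f s) :
    Tendsto (fun w => (w - s) * f w) (𝓝[≠] s) (𝓝 0) := by
  have : ContinuousAt (fun w : ℂ => (w - s) * f w) s :=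
    (by fun_prop : ContinuousAt (fun w : ℂ => w - s) s).mul hf
  simpa using this.continuousWithinAt (s := {s}ᶜ) |>.tendsto

theorem tendsto_residue_mul {f g : ℂ → ℂ} {r s : ℂ}
    (hf : Tendsto (fun w => (w - s) * f w) (𝓝[≠] s) (𝓝 r)) (hg : ContinuousAt g s) :
    Tendsto (fun w => (w - s) * (g w * f w)) (𝓝[≠] s) (𝓝 (g s * r)) := by
  refine ((hg.continuousWithinAt (s := {s}ᶜ)).tendsto.mul hf).congr fun w => ?_
  ring

theorem tendsto_residue_cothKernel {b : ℝ} (hb : b ≠ 0) {c s : ℂ}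
    (h : sinh ((s - c) / b) = 0) :
    Tendsto (fun w => (w - s) * cothKernel b (w - c)) (𝓝[≠] s) (𝓝 (1 / (2 * π * I))) := by
  have hb' : (b : ℂ) ≠ 0 := by exact_mod_cast hb
  have hc : cosh ((s - c) / b) ≠ 0 := by
    intro h'
    have := Complex.cosh_sq_sub_sinh_sq ((s - c) / b)
    rw [h, h'] at this
    norm_num at this
  have hd : HasDerivAt (fun w : ℂ => sinh ((w - c) / b)) (cosh ((s - c) / b) * (1 / b)) s :=
    (((hasDerivAt_id s).sub_const c).div_const (b : ℂ)).csinh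
  have h1 := tendsto_sub_mul_inv hd h (by simp [hc, hb'])
  have h2 := tendsto_residue_mul h1
    (g := fun w => 1 / (2 * π * I * b) * cosh ((w - c) / b)) (by fun_prop)
  have e : 1 / (2 * π * I * b) * cosh ((s - c) / b) * (cosh ((s - c) / b) * (1 / b))⁻¹ =
      1 / (2 * π * I) := by
    field_simp
  rw [e] at h2
  exact h2

theorem tendsto_residue_cothKernel_sub (z : ℂ) {s : ℂ} (h : sinh (z - s) = 0) :
    Tendsto (fun w => (w - s) * cothKernel 1 (z - w)) (𝓝[≠] s) (𝓝 (-(1 / (2 * π * I)))) := by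
  have := (tendsto_residue_cothKernel (b := 1) one_ne_zero (c := z) (s := s) (by
    rw [← neg_sub z s, ofReal_one, div_one, Complex.sinh_neg, h, neg_zero])).neg
  refine this.congr fun w => ?_
  rw [← neg_sub w z, cothKernel_neg]
  ring

theorem sechKernel_neg (γ : ℝ) (z : ℂ) : sechKernel γ (-z) = sechKernel γ z := by
  simp [sechKernel, neg_div]

theorem sechKernel_add_period {γ : ℝ} (hγ : γ ≠ 0) (z : ℂ) :
    sechKernel γ (z + γ * I) = -sechKernel γ z := by
  have hb' : (γ : ℂ) ≠ 0 := by exact_mod_cast hγ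
  have e : π * (z + γ * I) / γ = π * z / γ + π * I := by field_simp
  rw [sechKernel, e, Complex.cosh_add, sechKernel]
  simp [Complex.cosh_mul_I, Complex.sinh_mul_I]

theorem sechKernel_sub_period {γ : ℝ} (hγ : γ ≠ 0) (z : ℂ) :
    sechKernel γ (z - γ * I) = -sechKernel γ z := by
  have := sechKernel_add_period hγ (z - γ * I)
  rw [sub_add_cancel] at this
  rw [this, neg_neg]

theorem differentiableAt_sechKernel {γ : ℝ} (hγ : γ ≠ 0) {z : ℂ} (h : cosh (π * z / γ) ≠ 0) :
    DifferentiableAt ℂ (sechKernel γ) z := by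
  have hb' : (γ : ℂ) ≠ 0 := by exact_mod_cast hγ
  unfold sechKernel
  exact DifferentiableAt.fun_inv (h := fun z : ℂ => 2 * γ * cosh (π * z / γ)) (by fun_prop)
    (by simp [h, hb'])

theorem norm_sechKernel_le {γ : ℝ} (hγ : 0 < γ) {z : ℂ} (h : Real.cos (π * z.im / γ) ≠ 0) :
    ‖sechKernel γ z‖ ≤
      1 / (2 * γ) * |Real.cos (π * z.im / γ)|⁻¹ * (Real.cosh (π / γ * z.re))⁻¹ := by
  have e1 : (π * z / γ : ℂ).re = π / γ * z.re := by
    rw [show (π * z / γ : ℂ) = (π / γ : ℝ) * z by push_cast; ring, re_ofReal_mul]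
  have e2 : (π * z / γ : ℂ).im = π * z.im / γ := by
    rw [show (π * z / γ : ℂ) = (π / γ : ℝ) * z by push_cast; ring, im_ofReal_mul]; ring
  have h1 := cosh_mul_cos_le (π * z / γ)
  rw [e1, e2] at h1
  have hp := Real.cosh_pos (π / γ * z.re)
  have hs := abs_pos.2 h
  rw [sechKernel, norm_inv, norm_mul]
  have e3 : ‖(2 * γ : ℂ)‖ = 2 * γ := by simp [abs_of_pos hγ]
  rw [e3, one_div, ← mul_inv, ← mul_inv]
  refine inv_anti₀ (by positivity) ?_
  nlinarith

theorem norm_sechKernel_le' {γ : ℝ} (hγ : 0 < γ) {z : ℂ} (h : z.re ≠ 0) :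
    ‖sechKernel γ z‖ ≤ 1 / (2 * γ) * (Real.sinh (π / γ * |z.re|))⁻¹ := by
  have e1 : (π * z / γ : ℂ).re = π / γ * z.re := by
    rw [show (π * z / γ : ℂ) = (π / γ : ℝ) * z by push_cast; ring, re_ofReal_mul]
  have hpg : 0 < π / γ := div_pos Real.pi_pos hγ
  have h1 := abs_sinh_le_norm_cosh (π * z / γ)
  rw [e1, Real.abs_sinh, abs_mul, abs_of_pos hpg] at h1
  have hp : 0 < Real.sinh (π / γ * |z.re|) :=
    Real.sinh_pos_iff.2 (mul_pos hpg (abs_pos.2 h))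
  rw [sechKernel, norm_inv, norm_mul]
  have e3 : ‖(2 * γ : ℂ)‖ = 2 * γ := by simp [abs_of_pos hγ]
  rw [e3, one_div, ← mul_inv]
  exact inv_anti₀ (by positivity) (mul_le_mul_of_nonneg_left h1 (by positivity))

theorem continuous_line {f : ℂ → ℂ} {y : ℝ}
    (h : ∀ x : ℝ, ContinuousAt f (x + y * I)) : Continuous (fun x : ℝ => f (x + y * I)) :=
  continuous_iff_continuousAt.2 fun x => (h x).comp (f := fun x : ℝ => (x + y * I : ℂ))
    (by fun_prop)

theorem integrable_sechKernel {γ : ℝ} (hγ : 0 < γ) {y : ℝ} (h : Real.cos (π * y / γ) ≠ 0) :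
    Integrable (fun x : ℝ => sechKernel γ (x + y * I)) := by
  have hpg : 0 < π / γ := div_pos Real.pi_pos hγ
  refine ((integrable_sech_mul hpg).const_mul (1 / (2 * γ) * |Real.cos (π * y / γ)|⁻¹)).mono'
    (continuous_line fun x => (differentiableAt_sechKernel hγ.ne'
      (cosh_ne_zero_of_cos ?_)).continuousAt).aestronglyMeasurable
    (Eventually.of_forall fun x => ?_)
  · rw [show (π * (x + y * I) / γ : ℂ) = (π / γ : ℝ) * (x + y * I) by push_cast; ring,
      im_ofReal_mul]
    convert h using 2
    simp
    ring
  · have := norm_sechKernel_le hγ (z := x + y * I) (by simpa using h)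
    simpa using this

theorem sinh_div_ne_zero_of_sin {b : ℝ} {z : ℂ} (h : Real.sin (z.im / b) ≠ 0) :
    sinh (z / b) ≠ 0 := sinh_ne_zero_of_sin (by simpa using h)

/-- The numerator in `cothKernel_sub` is sinh of a purely imaginary number and has modulus at most
1. Of the two factors 1/cosh in the denominator only one is kept, which suffices for integrability.
-/
theorem norm_stripKernel_le {b θ : ℝ} (hb : 0 < b) {z : ℂ}
    (h1 : Real.sin ((z.im - θ) / b) ≠ 0) (h2 : Real.sin ((z.im + θ) / b) ≠ 0) :
    ‖stripKernel b θ z‖ ≤ 1 / (2 * π * b) *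
      (|Real.sin ((z.im - θ) / b)|⁻¹ * |Real.sin ((z.im + θ) / b)|⁻¹) *
      (Real.cosh (b⁻¹ * z.re))⁻¹ := by
  have i1 : (z - I * θ).im = z.im - θ := by simp
  have i2 : (z + I * θ).im = z.im + θ := by simp
  rw [stripKernel, cothKernel_sub (sinh_div_ne_zero_of_sin (by rwa [i1]))
    (sinh_div_ne_zero_of_sin (by rwa [i2])), norm_mul, norm_mul, norm_mul, norm_inv, norm_inv]
  have e3 : ‖(1 / (2 * π * I * b) : ℂ)‖ = 1 / (2 * π * b) := by
    simp [abs_of_pos hb, abs_of_pos Real.pi_pos]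
  have hc : 1 ≤ Real.cosh (b⁻¹ * z.re) := Real.one_le_cosh _
  have b1 := cosh_mul_sin_le ((z - I * θ) / b)
  have b2 := cosh_mul_sin_le ((z + I * θ) / b)
  have r1 : ((z - I * θ) / b : ℂ).re = b⁻¹ * z.re := by
    rw [Complex.div_ofReal_re, div_eq_inv_mul]; simp
  have r2 : ((z + I * θ) / b : ℂ).re = b⁻¹ * z.re := by
    rw [Complex.div_ofReal_re, div_eq_inv_mul]; simp
  have j1 : ((z - I * θ) / b : ℂ).im = (z.im - θ) / b := by simp
  have j2 : ((z + I * θ) / b : ℂ).im = (z.im + θ) / b := by simp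
  rw [r1, j1] at b1
  rw [r2, j2] at b2
  have b0 := norm_sinh_le ((z + I * θ - (z - I * θ)) / b)
  have r0 : ((z + I * θ - (z - I * θ)) / b : ℂ).re = 0 := by simp
  rw [r0, Real.cosh_zero] at b0
  have s1 := abs_pos.2 h1
  have s2 := abs_pos.2 h2
  have c1 := inv_anti₀ (mul_pos (Real.cosh_pos _) s1) b1
  have c2 := inv_anti₀ (mul_pos (Real.cosh_pos _) s2) b2
  have key : ‖sinh ((z + I * θ - (z - I * θ)) / b)‖ *
      (‖sinh ((z - I * θ) / b)‖⁻¹ * ‖sinh ((z + I * θ) / b)‖⁻¹) ≤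
      (|Real.sin ((z.im - θ) / b)|⁻¹ * |Real.sin ((z.im + θ) / b)|⁻¹) *
      (Real.cosh (b⁻¹ * z.re))⁻¹ := by
    calc _ ≤ 1 * ((Real.cosh (b⁻¹ * z.re) * |Real.sin ((z.im - θ) / b)|)⁻¹ *
        (Real.cosh (b⁻¹ * z.re) * |Real.sin ((z.im + θ) / b)|)⁻¹) :=
        mul_le_mul b0 (mul_le_mul c1 c2 (by positivity) (by positivity)) (by positivity)
          zero_le_one
    _ = (|Real.sin ((z.im - θ) / b)|⁻¹ * |Real.sin ((z.im + θ) / b)|⁻¹) *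
        ((Real.cosh (b⁻¹ * z.re))⁻¹ * (Real.cosh (b⁻¹ * z.re))⁻¹) := by
        rw [mul_inv, mul_inv]; ring
    _ ≤ _ := by
        refine mul_le_mul_of_nonneg_left ?_ (by positivity)
        have := inv_le_one_of_one_le₀ hc
        have hp := Real.cosh_pos (b⁻¹ * z.re)
        exact mul_le_of_le_one_left (by positivity) this
  rw [e3]
  have := mul_le_mul_of_nonneg_left key (by positivity : 0 ≤ 1 / (2 * π * b))
  linarith

/-- A bound that does not depend on the imaginary part, for the vertical sides of contours and for
the limit x → ∞ at arbitrary height. -/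
theorem norm_stripKernel_le' {b θ : ℝ} (hb : 0 < b) {z : ℂ} (h : z.re ≠ 0) :
    ‖stripKernel b θ z‖ ≤ 1 / (2 * π * b) *
      ((Real.sinh (b⁻¹ * |z.re|))⁻¹ * (Real.sinh (b⁻¹ * |z.re|))⁻¹) := by
  have r1 : ((z - I * θ) / b : ℂ).re = b⁻¹ * z.re := by
    rw [Complex.div_ofReal_re, div_eq_inv_mul]; simp
  have r2 : ((z + I * θ) / b : ℂ).re = b⁻¹ * z.re := by
    rw [Complex.div_ofReal_re, div_eq_inv_mul]; simp
  have hz : b⁻¹ * z.re ≠ 0 := mul_ne_zero (inv_ne_zero hb.ne') h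
  rw [stripKernel, cothKernel_sub (sinh_ne_zero_of_re (by rwa [r1]))
    (sinh_ne_zero_of_re (by rwa [r2])), norm_mul, norm_mul, norm_mul, norm_inv, norm_inv]
  have e3 : ‖(1 / (2 * π * I * b) : ℂ)‖ = 1 / (2 * π * b) := by
    simp [abs_of_pos hb, abs_of_pos Real.pi_pos]
  have b1 := abs_sinh_le ((z - I * θ) / b)
  have b2 := abs_sinh_le ((z + I * θ) / b)
  rw [r1, Real.abs_sinh, abs_mul, abs_of_pos (inv_pos.2 hb)] at b1
  rw [r2, Real.abs_sinh, abs_mul, abs_of_pos (inv_pos.2 hb)] at b2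
  have b0 := norm_sinh_le ((z + I * θ - (z - I * θ)) / b)
  have r0 : ((z + I * θ - (z - I * θ)) / b : ℂ).re = 0 := by simp
  rw [r0, Real.cosh_zero] at b0
  have hp : 0 < Real.sinh (b⁻¹ * |z.re|) :=
    Real.sinh_pos_iff.2 (mul_pos (inv_pos.2 hb) (abs_pos.2 h))
  rw [e3, mul_assoc]
  refine mul_le_mul_of_nonneg_left ?_ (by positivity)
  calc _ ≤ 1 * ((Real.sinh (b⁻¹ * |z.re|))⁻¹ * (Real.sinh (b⁻¹ * |z.re|))⁻¹) :=
        mul_le_mul b0 (mul_le_mul (inv_anti₀ hp b1) (inv_anti₀ hp b2) (by positivity)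
          (by positivity)) (by positivity) zero_le_one
    _ = _ := one_mul _

theorem differentiableAt_stripKernel {b θ : ℝ} {z : ℂ}
    (h1 : sinh ((z - I * θ) / b) ≠ 0) (h2 : sinh ((z + I * θ) / b) ≠ 0) :
    DifferentiableAt ℂ (stripKernel b θ) z := by
  unfold stripKernel
  exact (DifferentiableAt.comp (g := cothKernel b) (f := fun z : ℂ => z - I * θ) z
      (differentiableAt_cothKernel h1) (by fun_prop)).sub
    (DifferentiableAt.comp (g := cothKernel b) (f := fun z : ℂ => z + I * θ) z
      (differentiableAt_cothKernel h2) (by fun_prop))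

theorem differentiableAt_stripKernel_of_sin {b θ : ℝ} {z : ℂ}
    (h1 : Real.sin ((z.im - θ) / b) ≠ 0) (h2 : Real.sin ((z.im + θ) / b) ≠ 0) :
    DifferentiableAt ℂ (stripKernel b θ) z :=
  differentiableAt_stripKernel (sinh_div_ne_zero_of_sin (by simpa using h1))
    (sinh_div_ne_zero_of_sin (by simpa using h2))

theorem continuous_stripKernel_line {b θ : ℝ} {y : ℝ}
    (h1 : Real.sin ((y - θ) / b) ≠ 0) (h2 : Real.sin ((y + θ) / b) ≠ 0) :
    Continuous (fun x : ℝ => stripKernel b θ (x + y * I)) :=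
  continuous_line fun x => (differentiableAt_stripKernel_of_sin
      (by simpa using h1) (by simpa using h2)).continuousAt

theorem integrable_stripKernel {b θ : ℝ} (hb : 0 < b) {y : ℝ}
    (h1 : Real.sin ((y - θ) / b) ≠ 0) (h2 : Real.sin ((y + θ) / b) ≠ 0) :
    Integrable (fun x : ℝ => stripKernel b θ (x + y * I)) := by
  refine ((integrable_sech_mul (inv_pos.2 hb)).const_mul (1 / (2 * π * b) *
      (|Real.sin ((y - θ) / b)|⁻¹ * |Real.sin ((y + θ) / b)|⁻¹))).mono'
    (continuous_stripKernel_line h1 h2).aestronglyMeasurable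
    (Eventually.of_forall fun x => ?_)
  have := norm_stripKernel_le hb (θ := θ) (z := x + y * I) (by simpa using h1) (by simpa using h2)
  simpa using this

theorem stripKernel_neg (b θ : ℝ) (z : ℂ) : stripKernel b θ (-z) = stripKernel b θ z := by
  rw [stripKernel, stripKernel, show -z - I * θ = -(z + I * θ) by ring,
    show -z + I * θ = -(z - I * θ) by ring, cothKernel_neg, cothKernel_neg]
  ring

theorem stripKernel_conj (b θ : ℝ) (z : ℂ) :
    stripKernel b θ ((starRingEnd ℂ) z) = (starRingEnd ℂ) (stripKernel b θ z) := by
  rw [stripKernel, stripKernel, map_sub,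
    show (starRingEnd ℂ) z - I * θ = (starRingEnd ℂ) (z + I * θ) by simp [sub_eq_add_neg],
    show (starRingEnd ℂ) z + I * θ = (starRingEnd ℂ) (z - I * θ) by simp [sub_eq_add_neg],
    cothKernel_conj, cothKernel_conj]
  ring

/-- The mass of a difference of two hyperbolic cotangents. -/
theorem integral_cothKernel_sub {b : ℝ} (hb : 0 < b) {c₁ c₂ : ℝ} (h1 : 0 < c₁) (h12 : c₁ ≤ c₂)
    (h2 : c₂ < π * b)
    (hi : Integrable (fun t : ℝ => cothKernel b (t + c₁ * I) - cothKernel b (t + c₂ * I))) :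
    ∫ t : ℝ, (cothKernel b (t + c₁ * I) - cothKernel b (t + c₂ * I)) =
      -((c₂ - c₁) / (π * b) : ℝ) := by
  have hsin : ∀ y ∈ Icc c₁ c₂, Real.sin (y / b) ≠ 0 := fun y hy =>
    (Real.sin_pos_of_pos_of_lt_pi (div_pos (by linarith [hy.1]) hb)
      (by rw [div_lt_iff₀ hb]; linarith [hy.2])).ne'
  rw [integral_line_sub_line (p := 1 / (2 * π * I * b)) (m := -(1 / (2 * π * I * b)))
    (b := fun x => 1 / (2 * π * b) * (Real.sinh (b⁻¹ * (x - 0)))⁻¹) h12 ?_ ?_ ?_ ?_ hi]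
  · have hb' : (b : ℂ) ≠ 0 := by exact_mod_cast hb.ne'
    have := Complex.I_ne_zero
    push_cast
    field_simp
    ring
  · intro z hz
    exact (differentiableAt_cothKernel
      (sinh_div_ne_zero_of_sin (hsin _ hz))).differentiableWithinAt
  · simpa using (tendsto_inv_sinh (inv_pos.2 hb) 0).const_mul (1 / (2 * π * b))
  · filter_upwards [eventually_gt_atTop 0] with x hx y _
    have := norm_cothKernel_sub_le hb (z := x + y * I) (by simpa using hx)
    simpa using this
  · filter_upwards [eventually_gt_atTop 0] with x hx y _
    have := norm_cothKernel_add_le hb (z := ((-x : ℝ) : ℂ) + y * I) (by simpa using hx)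
    simpa using this

theorem abs_eq_half_of_cos_eq_zero {v : ℝ} (h : Real.cos (π * v) = 0) (hv : |v| ≤ 1) :
    v = 1 / 2 ∨ v = -(1 / 2) := by
  obtain ⟨k, hk⟩ := Real.cos_eq_zero_iff.1 h
  have hv' : v = (2 * k + 1) / 2 := by
    have : π * v = π * ((2 * k + 1) / 2) := by rw [hk]; ring
    exact mul_left_cancel₀ Real.pi_ne_zero this
  have h1 := abs_le.1 hv
  rw [hv'] at h1
  have h2 : (-2 : ℤ) < k := by
    have : (-2 : ℝ) < k := by linarith [h1.1]
    exact_mod_cast this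
  have h3 : k < (1 : ℤ) := by
    have : (k : ℝ) < 1 := by linarith [h1.2]
    exact_mod_cast this
  have : k = 0 ∨ k = -1 := by omega
  rcases this with rfl | rfl
  · left; rw [hv']; norm_num
  · right; rw [hv']; norm_num

theorem sub_im_line (z : ℂ) (t c : ℝ) : (z - (t + c * I)).im = z.im - c := by simp

theorem norm_cothKernel_sub_line_le (z : ℂ) (c t : ℝ) (h : Real.sin (z.im - c) ≠ 0) :
    ‖cothKernel 1 (z - (t + c * I))‖ ≤ 1 / (2 * π) * |Real.sin (z.im - c)|⁻¹ := by
  have := norm_cothKernel_le one_pos (z := z - (t + c * I))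
    (by rw [sub_im_line, div_one]; exact h)
  rwa [sub_im_line, div_one, mul_one] at this

theorem continuous_cothKernel_sub_line (z : ℂ) (c : ℝ) (h : Real.sin (z.im - c) ≠ 0) :
    Continuous (fun t : ℝ => cothKernel 1 (z - (t + c * I))) := by
  refine continuous_line (f := fun w => cothKernel 1 (z - w)) fun x => ?_
  exact (differentiableAt_cothKernel (sinh_div_ne_zero_of_sin
    (by rw [sub_im_line, div_one]; exact h))).continuousAt.comp
      (f := fun w : ℂ => z - w) (by fun_prop)

theorem integrable_cothKernel_mul {f : ℝ → ℂ} (hf : Integrable f) (z : ℂ) (c : ℝ)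
    (h : Real.sin (z.im - c) ≠ 0) :
    Integrable (fun t : ℝ => cothKernel 1 (z - (t + c * I)) * f t) :=
  hf.bdd_mul (continuous_cothKernel_sub_line z c h).aestronglyMeasurable
    (Eventually.of_forall fun t => norm_cothKernel_sub_line_le z c t h)

/-- Far away from the point `z`, the kernel is bounded. -/
theorem eventually_norm_cothKernel_le (z : ℂ) : ∀ᶠ x : ℝ in atTop, ∀ w : ℂ, |w.re| = x →
    ‖cothKernel 1 (z - w)‖ ≤ 1 := by
  have h1 := (tendsto_inv_sinh one_pos |z.re|).const_mul (1 / (2 * π))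
  rw [mul_zero] at h1
  have hpi := Real.pi_gt_three
  -- At infinity the modulus tends to 1/(2π) ≤ 1/2, and the error is eventually below 1/2.
  have h2 : 1 / (2 * π) ≤ 1 / 2 := by
    rw [div_le_div_iff₀ (by positivity) two_pos]; linarith
  filter_upwards [eventually_gt_atTop |z.re|, h1.eventually (gt_mem_nhds (half_pos one_pos))]
    with x hx hx2 w hw
  have key : ∀ v : ℂ, x - |z.re| ≤ v.re → ‖cothKernel 1 v‖ ≤ 1 := by
    intro v hv
    have hv0 : 0 < v.re := by linarith
    have := norm_cothKernel_sub_le one_pos hv0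
    have h3 : (Real.sinh (1⁻¹ * (v.re - 0)))⁻¹ ≤ (Real.sinh (1 * (x - |z.re|)))⁻¹ := by
      refine inv_anti₀ (Real.sinh_pos_iff.2 (by linarith)) (Real.sinh_le_sinh.2 (by simpa using hv))
    have h4 : ‖(1 / (2 * π * I * (1 : ℝ)) : ℂ)‖ = 1 / (2 * π) := by
      simp [abs_of_pos Real.pi_pos]
    have h5 := norm_sub_norm_le (cothKernel 1 v) (1 / (2 * π * I * (1 : ℝ)))
    rw [h4] at h5
    have h6 : 1 / (2 * π * 1) * (Real.sinh (1⁻¹ * (v.re - 0)))⁻¹ ≤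
        1 / (2 * π) * (Real.sinh (1 * (x - |z.re|)))⁻¹ := by
      rw [mul_one]
      exact mul_le_mul_of_nonneg_left h3 (by positivity)
    linarith
  rcases abs_cases w.re with ⟨h, _⟩ | ⟨h, _⟩
  · rw [← neg_sub w z, cothKernel_neg, norm_neg]
    refine key _ ?_
    rw [sub_re]
    linarith [le_abs_self z.re]
  · refine key _ ?_
    rw [sub_re]
    linarith [neg_abs_le z.re]

theorem sinh_sub_ne_zero {z s : ℂ} (h : Real.sin (z.im - s.im) = 0 → s ≠ z → z.im - s.im = 0)
    (hs : s ≠ z) : sinh (z - s) ≠ 0 := by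
  intro h0
  obtain ⟨h1, h2⟩ := sinh_eq_zero_iff'.1 h0
  rw [sub_im] at h2
  rw [sub_re] at h1
  exact hs (Complex.ext (by linarith) (by linarith [h h2 hs]))

/-! ### Convolution of the kernel with 1/cosh -/

section Sech

variable {γ : ℝ}

theorem sechKernel_pole_ne (hγ : 0 < γ) {s : ℂ} (hs : s.im ∈ Icc (-γ) γ)
    (h1 : s ≠ I * (γ / 2 : ℝ)) (h2 : s ≠ -(I * (γ / 2 : ℝ))) : cosh (π * s / γ) ≠ 0 := by
  intro h0
  obtain ⟨hr, hi⟩ := cosh_eq_zero_iff'.1 h0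
  rw [show (π * s / γ : ℂ) = (π / γ : ℝ) * s by push_cast; ring] at hr hi
  rw [re_ofReal_mul] at hr
  rw [im_ofReal_mul, show π / γ * s.im = π * (s.im / γ) by ring] at hi
  have hr' : s.re = 0 := by
    rcases mul_eq_zero.1 hr with h | h
    · exact absurd h (div_pos Real.pi_pos hγ).ne'
    · exact h
  rcases abs_eq_half_of_cos_eq_zero hi (by
    rw [abs_div, abs_of_pos hγ, div_le_one hγ]; exact abs_le.2 hs) with h | h
  · apply h1
    rw [div_eq_iff hγ.ne'] at h
    exact Complex.ext (by simp [hr']) (by simp [h]; ring)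
  · apply h2
    rw [div_eq_iff hγ.ne'] at h
    exact Complex.ext (by simp [hr']) (by simp [h]; ring)

theorem tendsto_residue_sechKernel (hγ : 0 < γ) :
    Tendsto (fun w => (w - I * (γ / 2 : ℝ)) * sechKernel γ w) (𝓝[≠] (I * (γ / 2 : ℝ)))
      (𝓝 (1 / (2 * π * I))) := by
  have hγ' : (γ : ℂ) ≠ 0 := by exact_mod_cast hγ.ne'
  have e : (π * (I * (γ / 2 : ℝ)) / γ : ℂ) = π / 2 * I := by push_cast; field_simp
  have hd : HasDerivAt (fun w : ℂ => 2 * γ * cosh (π * w / γ))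
      (2 * γ * (sinh (π * (I * (γ / 2 : ℝ)) / γ) * (π * 1 / γ))) (I * (γ / 2 : ℝ)) :=
    ((((hasDerivAt_id _).const_mul (π : ℂ)).div_const (γ : ℂ)).ccosh).const_mul _
  rw [e, Complex.sinh_mul_I] at hd
  have h := tendsto_sub_mul_inv hd (by rw [e, Complex.cosh_mul_I]; simp) (by simp [hγ'])
  have e2 : (2 * γ * (Complex.sin (π / 2) * I * (π * 1 / γ)) : ℂ)⁻¹ = 1 / (2 * π * I) := by
    rw [Complex.sin_pi_div_two]
    field_simp
  rw [e2] at h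
  exact h

theorem tendsto_residue_sechKernel_neg (hγ : 0 < γ) :
    Tendsto (fun w => (w - -(I * (γ / 2 : ℝ))) * sechKernel γ w) (𝓝[≠] (-(I * (γ / 2 : ℝ))))
      (𝓝 (-(1 / (2 * π * I)))) := by
  have h := (tendsto_residue_sechKernel hγ).neg
  have ht : Tendsto (fun w : ℂ => -w) (𝓝[≠] (-(I * (γ / 2 : ℝ)))) (𝓝[≠] (I * (γ / 2 : ℝ))) := by
    refine tendsto_nhdsWithin_iff.2 ⟨?_, ?_⟩
    · have : ContinuousAt (fun w : ℂ => -w) (-(I * (γ / 2 : ℝ))) := by fun_prop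
      simpa using this.continuousWithinAt (s := {-(I * (γ / 2 : ℝ))}ᶜ) |>.tendsto
    · filter_upwards [self_mem_nhdsWithin] with w hw h0
      exact hw (by rw [mem_singleton_iff] at h0 ⊢; rw [← h0, neg_neg])
  refine (h.comp ht).congr fun w => ?_
  simp only [Function.comp, sechKernel_neg]
  ring

theorem cos_pi_mul_div_self (hγ : 0 < γ) : Real.cos (π * γ / γ) = -1 := by
  rw [mul_div_cancel_right₀ _ hγ.ne', Real.cos_pi]

theorem integrable_sechKernel_period (hγ : 0 < γ) :
    Integrable (fun x : ℝ => sechKernel γ (x + γ * I)) :=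
  integrable_sechKernel hγ (by rw [cos_pi_mul_div_self hγ]; norm_num)

theorem integrable_sechKernel_neg_period (hγ : 0 < γ) :
    Integrable (fun x : ℝ => sechKernel γ (x + ((-γ : ℝ) : ℂ) * I)) :=
  integrable_sechKernel hγ (by
    rw [show π * -γ / γ = -(π * γ / γ) by ring, Real.cos_neg, cos_pi_mul_div_self hγ]; norm_num)

theorem integrable_sechKernel_real (hγ : 0 < γ) :
    Integrable (fun x : ℝ => sechKernel γ x) := by
  simpa using integrable_sechKernel hγ (y := 0) (by simp)

/-- `sechKernel γ` changes sign under a shift by ±iγ, so on the lines Im s = ±γ the function coth(z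
- s) times `sechKernel γ s` restricts to shifted coth kernels times ∓`sechKernel γ t`. The
difference of the two line integrals is the convolution, and the residue theorem evaluates it. The
poles depend on the position of `z` and are left as data. -/
theorem sech_convolution_aux (hγ : 0 < γ) (z : ℂ) (hs1 : Real.sin (z.im - γ) ≠ 0)
    (hs2 : Real.sin (z.im + γ) ≠ 0) (S : Finset ℂ) (r : ℂ → ℂ)
    (hd : ∀ s : ℂ, s.im ∈ Icc (-γ) γ → s ∉ S → cosh (π * s / γ) ≠ 0 ∧ sinh (z - s) ≠ 0)
    (hS : ∀ s ∈ S, s.im ∈ Ioo (-γ) γ)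
    (hr : ∀ s ∈ S, Tendsto (fun w => (w - s) * (cothKernel 1 (z - w) * sechKernel γ w)) (𝓝[≠] s)
      (𝓝 (r s))) :
    ∫ t : ℝ, stripKernel 1 γ (z - t) * sechKernel γ t = 2 * π * I * ∑ s ∈ S, r s := by
  have hγc : γ ≠ 0 := hγ.ne'
  have hpg : 0 < π / γ := div_pos Real.pi_pos hγ
  have hs2' : Real.sin (z.im - -γ) ≠ 0 := by rwa [sub_neg_eq_add]
  have i1 := integrable_cothKernel_mul (integrable_sechKernel_neg_period hγ) z (-γ) hs2'
  have i2 := integrable_cothKernel_mul (integrable_sechKernel_period hγ) z γ hs1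
  rw [← integral_line_sub_line_eq_residues (by linarith : -γ < γ) r S
    (fun s => cothKernel 1 (z - s) * sechKernel γ s)
    (fun x => 1 / (2 * γ) * (Real.sinh (π / γ * (x - 0)))⁻¹) ?_ hS hr
    (by simpa using (tendsto_inv_sinh hpg 0).const_mul (1 / (2 * γ))) ?_ ?_ i1 i2]
  · rw [← integral_sub i1 i2]
    congr 1
    funext t
    have e1 : sechKernel γ (t + ((-γ : ℝ) : ℂ) * I) = -sechKernel γ t := by
      rw [← sechKernel_sub_period hγc]; congr 1; push_cast; ring
    rw [e1, sechKernel_add_period hγc, stripKernel]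
    have e2 : z - (t + ((-γ : ℝ) : ℂ) * I) = z - t + I * γ := by push_cast; ring
    have e3 : z - (t + (γ : ℂ) * I) = z - t - I * γ := by ring
    rw [e2, e3]
    ring
  · intro s hs
    obtain ⟨h1, h2⟩ := hd s hs.1 (by simpa using hs.2)
    exact ((DifferentiableAt.comp (g := cothKernel 1) (f := fun w : ℂ => z - w) s
      (differentiableAt_cothKernel (by simpa using h2)) (by fun_prop)).mul
      (differentiableAt_sechKernel hγc h1)).differentiableWithinAt
  · filter_upwards [eventually_norm_cothKernel_le z, eventually_gt_atTop 0] with x hx hx0 y _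
    have hre : ((x : ℂ) + y * I).re = x := by simp
    rw [norm_mul]
    have h1 := norm_sechKernel_le' hγ (z := x + y * I) (by rw [hre]; exact hx0.ne')
    rw [hre, abs_of_pos hx0] at h1
    rw [sub_zero]
    exact (mul_le_of_le_one_left (norm_nonneg _)
      (hx _ (by rw [hre, abs_of_pos hx0]))).trans h1
  · filter_upwards [eventually_norm_cothKernel_le z, eventually_gt_atTop 0] with x hx hx0 y _
    have hre : (((-x : ℝ) : ℂ) + y * I).re = -x := by simp
    rw [norm_mul]
    have h1 := norm_sechKernel_le' hγ (z := ((-x : ℝ) : ℂ) + y * I)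
      (by rw [hre]; exact (neg_pos.1 (by simpa using hx0)).ne)
    rw [hre, abs_neg, abs_of_pos hx0] at h1
    rw [sub_zero]
    exact (mul_le_of_le_one_left (norm_nonneg _)
      (hx _ (by rw [hre, abs_neg, abs_of_pos hx0]))).trans h1

theorem residue_value : (2 * π * I) * (1 / (2 * π * I)) = 1 := by
  have := Complex.I_ne_zero
  have : (π : ℂ) ≠ 0 := by exact_mod_cast Real.pi_ne_zero
  field_simp

/-- The convolution of the kernel with `sechKernel`, above the strip `|Im z| ≤ γ`. -/
theorem integral_stripKernel_mul_sechKernel_of_lt (hγ : 0 < γ) {z : ℂ}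
    (h1 : γ < z.im) (h2 : z.im < π - γ) :
    ∫ t : ℝ, stripKernel 1 γ (z - t) * sechKernel γ t = stripKernel 1 (γ / 2) z := by
  classical
  have hpos : ∀ v ∈ Icc (-γ) γ, Real.sin (z.im - v) ≠ 0 := fun v hv =>
    (Real.sin_pos_of_pos_of_lt_pi (by linarith [hv.2]) (by linarith [hv.1])).ne'
  have hcd : ∀ s : ℂ, s.im ∈ Icc (-γ) γ → ContinuousAt (fun w => cothKernel 1 (z - w)) s :=
    fun s hs => (differentiableAt_cothKernel (sinh_div_ne_zero_of_sin
      (by simpa using hpos _ hs))).continuousAt.comp (f := fun w : ℂ => z - w) (by fun_prop)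
  have im1 : (I * ((γ / 2 : ℝ) : ℂ)).im = γ / 2 := by rw [mul_comm, im_ofReal_mul]; simp
  have im2 : (-(I * ((γ / 2 : ℝ) : ℂ))).im = -(γ / 2) := by rw [neg_im, im1]
  have hne : (I * ((γ / 2 : ℝ) : ℂ)) ≠ -(I * ((γ / 2 : ℝ) : ℂ)) := fun h => by
    have := congrArg Complex.im h
    rw [im1, im2] at this
    linarith
  have hr1 := tendsto_residue_mul (tendsto_residue_sechKernel hγ)
    (hcd (I * (γ / 2 : ℝ)) (by rw [im1]; constructor <;> linarith))
  have hr2 := tendsto_residue_mul (tendsto_residue_sechKernel_neg hγ)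
    (hcd (-(I * (γ / 2 : ℝ))) (by rw [im2]; constructor <;> linarith))
  rw [sech_convolution_aux hγ z (hpos γ ⟨by linarith, le_rfl⟩)
    (by simpa using hpos (-γ) ⟨le_rfl, by linarith⟩)
    {I * ((γ / 2 : ℝ) : ℂ), -(I * ((γ / 2 : ℝ) : ℂ))}
    -- The residue function is given as a limit, so that one expression serves all poles; its values
    -- were computed above.
    (fun s => limUnder (𝓝[≠] s) (fun w => (w - s) * (cothKernel 1 (z - w) * sechKernel γ w)))]
  · rw [Finset.sum_pair hne, hr1.limUnder_eq, hr2.limUnder_eq, stripKernel, sub_neg_eq_add]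
    linear_combination (cothKernel 1 (z - I * (γ / 2 : ℝ)) - cothKernel 1 (z + I * (γ / 2 : ℝ))) *
      residue_value
  · intro s hs hsS
    simp only [Finset.mem_insert, Finset.mem_singleton, not_or] at hsS
    exact ⟨sechKernel_pole_ne hγ hs hsS.1 hsS.2,
      sinh_ne_zero_of_sin (by simpa using hpos _ hs)⟩
  · intro s hs
    simp only [Finset.mem_insert, Finset.mem_singleton] at hs
    rcases hs with rfl | rfl
    · rw [im1]; constructor <;> linarith
    · rw [im2]; constructor <;> linarith
  · intro s hs
    simp only [Finset.mem_insert, Finset.mem_singleton] at hs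
    rcases hs with rfl | rfl
    · rw [hr1.limUnder_eq]; exact hr1
    · rw [hr2.limUnder_eq]; exact hr2

/-- The convolution of the kernel with `sechKernel`, inside the strip `|Im z| < γ`. -/
theorem integral_stripKernel_mul_sechKernel (hγ : 0 < γ) (hγ' : γ < π / 2) {z : ℂ}
    (h1 : |z.im| < γ) (h2 : |z.im| ≠ γ / 2) :
    ∫ t : ℝ, stripKernel 1 γ (z - t) * sechKernel γ t =
      stripKernel 1 (γ / 2) z - sechKernel γ z := by
  classical
  have hz := abs_lt.1 h1
  have hsin : ∀ v ∈ Icc (-γ) γ, Real.sin (z.im - v) = 0 → z.im - v = 0 := fun v hv h =>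
    (Real.sin_eq_zero_iff_of_lt_of_lt (by linarith [hv.2]) (by linarith [hv.1])).1 h
  have hsinh : ∀ s : ℂ, s.im ∈ Icc (-γ) γ → s ≠ z → sinh (z - s) ≠ 0 := fun s hs hsz =>
    sinh_sub_ne_zero (fun h _ => hsin _ hs h) hsz
  have hcd : ∀ s : ℂ, s.im ∈ Icc (-γ) γ → s ≠ z → ContinuousAt (fun w => cothKernel 1 (z - w)) s :=
    fun s hs hsz => (differentiableAt_cothKernel
      (by simpa using hsinh s hs hsz)).continuousAt.comp (f := fun w : ℂ => z - w) (by fun_prop)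
  have im1 : (I * ((γ / 2 : ℝ) : ℂ)).im = γ / 2 := by rw [mul_comm, im_ofReal_mul]; simp
  have im2 : (-(I * ((γ / 2 : ℝ) : ℂ))).im = -(γ / 2) := by rw [neg_im, im1]
  have hne : (I * ((γ / 2 : ℝ) : ℂ)) ≠ -(I * ((γ / 2 : ℝ) : ℂ)) := fun h => by
    have := congrArg Complex.im h
    rw [im1, im2] at this
    linarith
  have hz1 : I * ((γ / 2 : ℝ) : ℂ) ≠ z := fun h => h2 (by
    rw [← h, im1, abs_of_pos (by linarith)])
  have hz2 : -(I * ((γ / 2 : ℝ) : ℂ)) ≠ z := fun h => h2 (by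
    rw [← h, im2, abs_neg, abs_of_pos (by linarith)])
  have hr1 := tendsto_residue_mul (tendsto_residue_sechKernel hγ)
    (hcd (I * (γ / 2 : ℝ)) (by rw [im1]; constructor <;> linarith) hz1)
  have hr2 := tendsto_residue_mul (tendsto_residue_sechKernel_neg hγ)
    (hcd (-(I * (γ / 2 : ℝ))) (by rw [im2]; constructor <;> linarith) hz2)
  have hr3 : Tendsto (fun w => (w - z) * (cothKernel 1 (z - w) * sechKernel γ w)) (𝓝[≠] z)
      (𝓝 (sechKernel γ z * -(1 / (2 * π * I)))) := by
    refine (tendsto_residue_mul (tendsto_residue_cothKernel_sub z (by simp))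
      (differentiableAt_sechKernel hγ.ne' (sechKernel_pole_ne hγ
        ⟨hz.1.le, hz.2.le⟩ hz1.symm hz2.symm)).continuousAt).congr fun w => ?_
    ring
  rw [sech_convolution_aux hγ z
    (fun h => by have := hsin γ ⟨by linarith, le_rfl⟩ h; linarith)
    (fun h => by
      have := hsin (-γ) ⟨le_rfl, by linarith⟩ (by rwa [sub_neg_eq_add])
      linarith)
    -- For |Im z| < γ the pole s = z of coth(z - s) also lies between the lines. It contributes the
    -- extra term -`sechKernel γ z`.
    {I * ((γ / 2 : ℝ) : ℂ), -(I * ((γ / 2 : ℝ) : ℂ)), z}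
    (fun s => limUnder (𝓝[≠] s) (fun w => (w - s) * (cothKernel 1 (z - w) * sechKernel γ w)))]
  · rw [Finset.sum_insert (by
      simp only [Finset.mem_insert, Finset.mem_singleton, not_or]; exact ⟨hne, hz1⟩), Finset.sum_pair hz2, hr1.limUnder_eq,
      hr2.limUnder_eq, hr3.limUnder_eq, stripKernel, sub_neg_eq_add]
    linear_combination (cothKernel 1 (z - I * (γ / 2 : ℝ)) - cothKernel 1 (z + I * (γ / 2 : ℝ))
      - sechKernel γ z) * residue_value
  · intro s hs hsS
    simp only [Finset.mem_insert, Finset.mem_singleton, not_or] at hsS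
    exact ⟨sechKernel_pole_ne hγ hs hsS.1 hsS.2.1, hsinh s hs hsS.2.2⟩
  · intro s hs
    simp only [Finset.mem_insert, Finset.mem_singleton] at hs
    rcases hs with rfl | rfl | rfl
    · rw [im1]; constructor <;> linarith
    · rw [im2]; constructor <;> linarith
    · exact hz
  · intro s hs
    simp only [Finset.mem_insert, Finset.mem_singleton] at hs
    rcases hs with rfl | rfl | rfl
    · rw [hr1.limUnder_eq]; exact hr1
    · rw [hr2.limUnder_eq]; exact hr2
    · rw [hr3.limUnder_eq]; exact hr3

end Sech

/-! ### Convolution of coth kernels with periods iπ and i(π - γ) -/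

section Strip

variable {γ a : ℝ}

theorem sin_half_div_pos (hγ : 0 < γ) (hγ' : γ < π / 2) (ha : π * a = π - γ) (ha0 : 0 < a) :
    0 < Real.sin (γ / 2 / a) :=
  Real.sin_pos_of_pos_of_lt_pi (by positivity) (by rw [div_lt_iff₀ ha0]; linarith)

theorem integrable_stripKernel_real (hγ : 0 < γ) (hγ' : γ < π / 2) (ha : π * a = π - γ)
    (ha0 : 0 < a) : Integrable (fun x : ℝ => stripKernel a (γ / 2) x) := by
  have h := sin_half_div_pos hγ hγ' ha ha0
  have := integrable_stripKernel ha0 (θ := γ / 2) (y := 0)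
    (by rw [zero_sub, neg_div, Real.sin_neg]; exact (neg_lt_zero.2 h).ne)
    (by rw [zero_add]; exact h.ne')
  simpa using this

theorem stripKernel_eq_sub (b θ : ℝ) (s : ℂ) : stripKernel b (θ / 2) (s + θ / 2 * I) =
    cothKernel b s - cothKernel b (s + θ * I) := by
  rw [stripKernel]
  congr 2 <;> (push_cast; ring)

/-- The lines Im s = γ/2 - π and Im s = -γ/2 are at distance π - γ = πa, one period of the second
factor, which therefore restricts to the same function `stripKernel a (γ / 2)` on both. For the
first factor, of period iπ, the two lines amount to shifts by ∓iγ/2, so the difference of the line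
integrals is the convolution. -/
theorem strip_convolution_aux (hγ : 0 < γ) (hγ' : γ < π / 2) (ha : π * a = π - γ)
    (ha0 : 0 < a) (z : ℂ) (hs1 : Real.sin (z.im - γ / 2) ≠ 0)
    (hs2 : Real.sin (z.im + γ / 2) ≠ 0) (S : Finset ℂ) (r : ℂ → ℂ)
    (hd : ∀ s : ℂ, s.im ∈ Icc (γ / 2 - π) (-(γ / 2)) → s ∉ S →
      sinh (z - s) ≠ 0 ∧ sinh (s / a) ≠ 0 ∧ sinh ((s + γ * I) / a) ≠ 0)
    (hS : ∀ s ∈ S, s.im ∈ Ioo (γ / 2 - π) (-(γ / 2)))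
    (hr : ∀ s ∈ S, Tendsto (fun w => (w - s) * (cothKernel 1 (z - w) *
      (cothKernel a w - cothKernel a (w + γ * I)))) (𝓝[≠] s) (𝓝 (r s))) :
    ∫ t : ℝ, stripKernel 1 (γ / 2) (z - t) * stripKernel a (γ / 2) t =
      2 * π * I * ∑ s ∈ S, r s := by
  have ha' : 0 < a⁻¹ := inv_pos.2 ha0
  have haC : (π * a : ℂ) = π - γ := by exact_mod_cast ha
  have hs1' : Real.sin (z.im - (γ / 2 - π)) ≠ 0 := by
    rw [show z.im - (γ / 2 - π) = z.im - γ / 2 + π by ring, Real.sin_add_pi]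
    exact neg_ne_zero.2 hs1
  have hs2' : Real.sin (z.im - -(γ / 2)) ≠ 0 := by rwa [sub_neg_eq_add]
  have e1 : ∀ t : ℝ, cothKernel a (t + ((γ / 2 - π : ℝ) : ℂ) * I) -
      cothKernel a (t + ((γ / 2 - π : ℝ) : ℂ) * I + γ * I) = stripKernel a (γ / 2) t := by
    intro t
    rw [stripKernel, ← cothKernel_add_period ha0.ne' (t + ((γ / 2 - π : ℝ) : ℂ) * I),
      ← cothKernel_add_period ha0.ne' (t + ((γ / 2 - π : ℝ) : ℂ) * I + γ * I), haC]
    congr 2 <;> (push_cast; ring)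
  have e2 : ∀ t : ℝ, cothKernel a (t + ((-(γ / 2) : ℝ) : ℂ) * I) -
      cothKernel a (t + ((-(γ / 2) : ℝ) : ℂ) * I + γ * I) = stripKernel a (γ / 2) t := by
    intro t
    rw [stripKernel]
    congr 2 <;> (push_cast; ring)
  have hint := integrable_stripKernel_real hγ hγ' ha ha0
  have i1 := integrable_cothKernel_mul hint z (γ / 2 - π) hs1'
  have i2 := integrable_cothKernel_mul hint z (-(γ / 2)) hs2'
  have htail : Tendsto (fun x => 1 / (2 * π * a) * ((Real.sinh (a⁻¹ * (x - 0)))⁻¹ *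
      (Real.sinh (a⁻¹ * (x - 0)))⁻¹)) atTop (𝓝 0) := by
    simpa using (((tendsto_inv_sinh ha' 0).mul (tendsto_inv_sinh ha' 0))).const_mul
      (1 / (2 * π * a))
  rw [← integral_line_sub_line_eq_residues (by linarith : γ / 2 - π < -(γ / 2)) r S
    (fun s => cothKernel 1 (z - s) * (cothKernel a s - cothKernel a (s + γ * I)))
    _ ?_ hS hr htail ?_ ?_ (by simpa only [e1] using i1) (by simpa only [e2] using i2)]
  · simp only [e1, e2]
    rw [← integral_sub i1 i2]
    congr 1
    funext t
    have e4 : z - (t + ((-(γ / 2) : ℝ) : ℂ) * I) = z - t + I * (γ / 2 : ℝ) := by push_cast; ring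
    have e3 : z - (t + ((γ / 2 - π : ℝ) : ℂ) * I) = z - t - I * (γ / 2 : ℝ) + π * (1 : ℝ) * I := by
      push_cast; ring
    rw [e4, e3, cothKernel_add_period one_ne_zero, stripKernel, sub_mul]
  · intro s hs
    obtain ⟨h1, h2, h3⟩ := hd s hs.1 (by simpa using hs.2)
    exact ((DifferentiableAt.comp (g := cothKernel 1) (f := fun w : ℂ => z - w) s
      (differentiableAt_cothKernel (by simpa using h1)) (by fun_prop)).mul
      ((differentiableAt_cothKernel h2).sub (DifferentiableAt.comp (g := cothKernel a)
        (f := fun w : ℂ => w + γ * I) s (differentiableAt_cothKernel h3)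
        (by fun_prop)))).differentiableWithinAt
  · filter_upwards [eventually_norm_cothKernel_le z, eventually_gt_atTop 0] with x hx hx0 y _
    have hre : ((x : ℂ) + y * I).re = x := by simp
    have hre' : ((x : ℂ) + y * I + γ / 2 * I).re = x := by simp
    rw [norm_mul, ← stripKernel_eq_sub]
    have h1 := norm_stripKernel_le' ha0 (θ := γ / 2) (z := x + y * I + γ / 2 * I)
      (by rw [hre']; exact hx0.ne')
    rw [hre', abs_of_pos hx0] at h1
    rw [sub_zero]
    exact (mul_le_of_le_one_left (norm_nonneg _)
      (hx _ (by rw [hre, abs_of_pos hx0]))).trans h1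
  · filter_upwards [eventually_norm_cothKernel_le z, eventually_gt_atTop 0] with x hx hx0 y _
    have hre : (((-x : ℝ) : ℂ) + y * I).re = -x := by simp
    have hre' : (((-x : ℝ) : ℂ) + y * I + γ / 2 * I).re = -x := by simp
    rw [norm_mul, ← stripKernel_eq_sub]
    have h1 := norm_stripKernel_le' ha0 (θ := γ / 2) (z := ((-x : ℝ) : ℂ) + y * I + γ / 2 * I)
      (by rw [hre']; exact (neg_pos.1 (by simpa using hx0)).ne)
    rw [hre', abs_neg, abs_of_pos hx0] at h1
    rw [sub_zero]
    exact (mul_le_of_le_one_left (norm_nonneg _)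
      (hx _ (by rw [hre, abs_neg, abs_of_pos hx0]))).trans h1

/-- The poles of the second factor in `strip_convolution_aux` are at imaginary multiples of the
period π - γ and at these points shifted by -iγ. Only i(γ - π) and -iγ lie in the closed strip. -/
theorem stripKernel_pole_ne (hγ : 0 < γ) (hγ' : γ < π / 2) (ha : π * a = π - γ)
    (ha0 : 0 < a) {s : ℂ} (hs : s.im ∈ Icc (γ / 2 - π) (-(γ / 2)))
    (h1 : s ≠ ((γ - π : ℝ) : ℂ) * I) (h2 : s ≠ ((-γ : ℝ) : ℂ) * I) :
    sinh (s / a) ≠ 0 ∧ sinh ((s + γ * I) / a) ≠ 0 := by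
  refine ⟨fun h => h1 ?_, fun h => h2 ?_⟩
  · obtain ⟨hr, hi⟩ := sinh_eq_zero_iff'.1 h
    rw [div_ofReal_re, div_eq_zero_iff, or_iff_left ha0.ne'] at hr
    rw [div_ofReal_im] at hi
    have h3 : Real.sin (s.im / a + π) = 0 := by rw [Real.sin_add_pi, hi, neg_zero]
    have h4 : s.im / a + π = 0 := (Real.sin_eq_zero_iff_of_lt_of_lt
      (by have : -(2 * π) < s.im / a := by
            rw [lt_div_iff₀ ha0]; nlinarith [hs.1]
          linarith)
      (by have : s.im / a < 0 := div_neg_of_neg_of_pos (by linarith [hs.2]) ha0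
          linarith)).1 h3
    have h5 : s.im = γ - π := by
      have : s.im = (s.im / a) * a := by field_simp
      rw [this, show s.im / a = -π by linarith]
      linarith
    exact Complex.ext (by simp [hr]) (by simp [h5])
  · obtain ⟨hr, hi⟩ := sinh_eq_zero_iff'.1 h
    rw [div_ofReal_re, div_eq_zero_iff, or_iff_left ha0.ne'] at hr
    rw [div_ofReal_im] at hi
    have e : (s + γ * I).im = s.im + γ := by simp
    have e' : (s + γ * I).re = s.re := by simp
    rw [e] at hi
    rw [e'] at hr
    have h4 : (s.im + γ) / a = 0 := (Real.sin_eq_zero_iff_of_lt_of_lt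
      (by rw [lt_div_iff₀ ha0]; nlinarith [hs.1]) (by rw [div_lt_iff₀ ha0]; nlinarith [hs.2])).1 hi
    rw [div_eq_zero_iff, or_iff_left ha0.ne'] at h4
    exact Complex.ext (by simp [hr]) (by simp; linarith)

theorem sinh_neg_pi_mul_I : sinh (-(π * I)) = 0 := by
  rw [Complex.sinh_neg, Complex.sinh_mul_I]; simp

theorem tendsto_residue_stripKernel_left (hγ : 0 < γ) (hγ' : γ < π / 2) (ha : π * a = π - γ)
    (ha0 : 0 < a) {g : ℂ → ℂ} (hg : ContinuousAt g (((γ - π : ℝ) : ℂ) * I)) :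
    Tendsto (fun w => (w - ((γ - π : ℝ) : ℂ) * I) * (g w *
      (cothKernel a w - cothKernel a (w + γ * I)))) (𝓝[≠] (((γ - π : ℝ) : ℂ) * I))
      (𝓝 (g (((γ - π : ℝ) : ℂ) * I) * (1 / (2 * π * I)))) := by
  have haC : (π * a : ℂ) = π - γ := by exact_mod_cast ha
  have ha1 : (a : ℂ) ≠ 0 := by exact_mod_cast ha0.ne'
  have h1 := tendsto_residue_cothKernel ha0.ne' (c := 0) (s := ((γ - π : ℝ) : ℂ) * I) (by
    rw [sub_zero, show ((γ - π : ℝ) : ℂ) * I / a = -(π * I) by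
      rw [div_eq_iff ha1]; push_cast; linear_combination I * haC]
    exact sinh_neg_pi_mul_I)
  simp only [sub_zero] at h1
  have hc : ContinuousAt (fun w => cothKernel a (w + γ * I)) (((γ - π : ℝ) : ℂ) * I) := by
    refine (differentiableAt_cothKernel (sinh_div_ne_zero_of_sin ?_)).continuousAt.comp
      (f := fun w : ℂ => w + γ * I) (by fun_prop)
    have e : (((γ - π : ℝ) : ℂ) * I + γ * I).im = -(π - 2 * γ) := by simp; ring
    rw [e, neg_div, Real.sin_neg]
    refine (neg_lt_zero.2 (Real.sin_pos_of_pos_of_lt_pi (div_pos (by linarith) ha0) ?_)).ne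
    rw [div_lt_iff₀ ha0]
    linarith
  have h2 := h1.sub (tendsto_sub_mul_of_continuousAt hc)
  rw [sub_zero] at h2
  exact tendsto_residue_mul (h2.congr fun w => by ring) hg

theorem tendsto_residue_stripKernel_right (hγ : 0 < γ) (hγ' : γ < π / 2) (ha : π * a = π - γ)
    (ha0 : 0 < a) {g : ℂ → ℂ} (hg : ContinuousAt g (((-γ : ℝ) : ℂ) * I)) :
    Tendsto (fun w => (w - ((-γ : ℝ) : ℂ) * I) * (g w *
      (cothKernel a w - cothKernel a (w + γ * I)))) (𝓝[≠] (((-γ : ℝ) : ℂ) * I))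
      (𝓝 (g (((-γ : ℝ) : ℂ) * I) * -(1 / (2 * π * I)))) := by
  have h1 := tendsto_residue_cothKernel ha0.ne' (c := -(γ * I)) (s := ((-γ : ℝ) : ℂ) * I) (by
    push_cast; simp)
  simp only [sub_neg_eq_add] at h1
  have hc : ContinuousAt (cothKernel a) (((-γ : ℝ) : ℂ) * I) := by
    refine (differentiableAt_cothKernel (sinh_div_ne_zero_of_sin ?_)).continuousAt
    have e : (((-γ : ℝ) : ℂ) * I).im = -γ := by simp
    rw [e, neg_div, Real.sin_neg]
    refine (neg_lt_zero.2 (Real.sin_pos_of_pos_of_lt_pi (div_pos hγ ha0) ?_)).ne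
    rw [div_lt_iff₀ ha0]
    linarith
  have h2 := (tendsto_sub_mul_of_continuousAt hc).sub h1
  rw [zero_sub] at h2
  exact tendsto_residue_mul (h2.congr fun w => by ring) hg

theorem stripKernel_residue_sum (γ : ℝ) (z : ℂ) :
    cothKernel 1 (z - ((γ - π : ℝ) : ℂ) * I) - cothKernel 1 (z - ((-γ : ℝ) : ℂ) * I) =
      stripKernel 1 γ z := by
  have : z - ((γ - π : ℝ) : ℂ) * I = z - I * γ + π * (1 : ℝ) * I := by push_cast; ring
  rw [this, cothKernel_add_period one_ne_zero, stripKernel]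
  congr 2
  push_cast; ring

theorem continuousAt_cothKernel_sub {z s : ℂ} (h : sinh (z - s) ≠ 0) :
    ContinuousAt (fun w => cothKernel 1 (z - w)) s :=
  (differentiableAt_cothKernel (by simpa using h)).continuousAt.comp (f := fun w : ℂ => z - w)
    (by fun_prop)

/-- The semigroup property of the strip kernels. -/
theorem integral_stripKernel_mul_stripKernel (hγ : 0 < γ) (hγ' : γ < π / 2) (ha : π * a = π - γ)
    (ha0 : 0 < a) {z : ℂ} (hz : |z.im| < γ / 2) :
    ∫ t : ℝ, stripKernel 1 (γ / 2) (z - t) * stripKernel a (γ / 2) t = stripKernel 1 γ z := by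
  classical
  have hz' := abs_lt.1 hz
  have hpos : ∀ v ∈ Icc (γ / 2 - π) (-(γ / 2)), Real.sin (z.im - v) ≠ 0 := fun v hv =>
    (Real.sin_pos_of_pos_of_lt_pi (by linarith [hv.2]) (by linarith [hv.1])).ne'
  have hsinh : ∀ s : ℂ, s.im ∈ Icc (γ / 2 - π) (-(γ / 2)) → sinh (z - s) ≠ 0 := fun s hs =>
    sinh_ne_zero_of_sin (by simpa using hpos _ hs)
  have im1 : (((γ - π : ℝ) : ℂ) * I).im = γ - π := by rw [im_ofReal_mul]; simp
  have im2 : (((-γ : ℝ) : ℂ) * I).im = -γ := by rw [im_ofReal_mul]; simp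
  have hne : ((γ - π : ℝ) : ℂ) * I ≠ ((-γ : ℝ) : ℂ) * I := fun h => by
    have := congrArg Complex.im h
    rw [im1, im2] at this
    linarith
  have hr1 := tendsto_residue_stripKernel_left hγ hγ' ha ha0 (continuousAt_cothKernel_sub
    (hsinh (((γ - π : ℝ) : ℂ) * I) (by rw [im1]; constructor <;> linarith)))
  have hr2 := tendsto_residue_stripKernel_right hγ hγ' ha ha0 (continuousAt_cothKernel_sub
    (hsinh (((-γ : ℝ) : ℂ) * I) (by rw [im2]; constructor <;> linarith)))
  rw [strip_convolution_aux hγ hγ' ha ha0 z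
    (fun h => by
      refine hpos (γ / 2 - π) ⟨le_rfl, by linarith⟩ ?_
      rw [show z.im - (γ / 2 - π) = z.im - γ / 2 + π by ring, Real.sin_add_pi, h, neg_zero])
    (by simpa using hpos (-(γ / 2)) ⟨by linarith, le_rfl⟩)
    {((γ - π : ℝ) : ℂ) * I, ((-γ : ℝ) : ℂ) * I}
    (fun s => limUnder (𝓝[≠] s) (fun w => (w - s) * (cothKernel 1 (z - w) *
      (cothKernel a w - cothKernel a (w + γ * I)))))]
  · rw [Finset.sum_pair hne, hr1.limUnder_eq, hr2.limUnder_eq, ← stripKernel_residue_sum γ]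
    linear_combination (cothKernel 1 (z - ((γ - π : ℝ) : ℂ) * I) -
      cothKernel 1 (z - ((-γ : ℝ) : ℂ) * I)) * residue_value
  · intro s hs hsS
    simp only [Finset.mem_insert, Finset.mem_singleton, not_or] at hsS
    exact ⟨hsinh s hs, stripKernel_pole_ne hγ hγ' ha ha0 hs hsS.1 hsS.2⟩
  · intro s hs
    simp only [Finset.mem_insert, Finset.mem_singleton] at hs
    rcases hs with rfl | rfl
    · rw [im1]; constructor <;> linarith
    · rw [im2]; constructor <;> linarith
  · intro s hs
    simp only [Finset.mem_insert, Finset.mem_singleton] at hs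
    rcases hs with rfl | rfl
    · rw [hr1.limUnder_eq]; exact hr1
    · rw [hr2.limUnder_eq]; exact hr2

/-- The continuation of the semigroup property across the line `Im z = γ / 2`. -/
theorem integral_stripKernel_mul_stripKernel_of_lt (hγ : 0 < γ) (hγ' : γ < π / 2)
    (ha : π * a = π - γ) (ha0 : 0 < a) {z : ℂ} (hz1 : γ / 2 < z.im) (hz2 : z.im < π - γ)
    (hz3 : z.im ≠ γ) :
    ∫ t : ℝ, stripKernel 1 (γ / 2) (z - t) * stripKernel a (γ / 2) t =
      stripKernel 1 γ z - stripKernel a (γ / 2) (z - γ / 2 * I) := by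
  classical
  have hsin : ∀ v ∈ Icc (γ / 2 - π) (-(γ / 2)), Real.sin (z.im - v) = 0 → v = z.im - π := by
    intro v hv h
    have h1 : Real.sin (z.im - v - π) = 0 := by rw [Real.sin_sub_pi, h, neg_zero]
    have := (Real.sin_eq_zero_iff_of_lt_of_lt (by linarith [hv.2]) (by linarith [hv.1])).1 h1
    linarith
  have hsinh : ∀ s : ℂ, s.im ∈ Icc (γ / 2 - π) (-(γ / 2)) → s ≠ z - π * I → sinh (z - s) ≠ 0 := by
    intro s hs hsz h0
    obtain ⟨h1, h2⟩ := sinh_eq_zero_iff'.1 h0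
    rw [sub_im] at h2
    rw [sub_re] at h1
    have := hsin _ hs h2
    exact hsz (Complex.ext (by simp; linarith) (by simp; linarith))
  have im1 : (((γ - π : ℝ) : ℂ) * I).im = γ - π := by rw [im_ofReal_mul]; simp
  have im2 : (((-γ : ℝ) : ℂ) * I).im = -γ := by rw [im_ofReal_mul]; simp
  have im3 : (z - π * I).im = z.im - π := by simp
  have hne : ((γ - π : ℝ) : ℂ) * I ≠ ((-γ : ℝ) : ℂ) * I := fun h => by
    have := congrArg Complex.im h
    rw [im1, im2] at this
    linarith
  have hne1 : ((γ - π : ℝ) : ℂ) * I ≠ z - π * I := fun h => by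
    have := congrArg Complex.im h
    rw [im1, im3] at this
    exact hz3 (by linarith)
  have hne2 : ((-γ : ℝ) : ℂ) * I ≠ z - π * I := fun h => by
    have := congrArg Complex.im h
    rw [im2, im3] at this
    linarith
  have hr1 := tendsto_residue_stripKernel_left hγ hγ' ha ha0 (continuousAt_cothKernel_sub
    (hsinh (((γ - π : ℝ) : ℂ) * I) (by rw [im1]; constructor <;> linarith) hne1))
  have hr2 := tendsto_residue_stripKernel_right hγ hγ' ha ha0 (continuousAt_cothKernel_sub
    (hsinh (((-γ : ℝ) : ℂ) * I) (by rw [im2]; constructor <;> linarith) hne2))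
  obtain ⟨p1, p2⟩ := stripKernel_pole_ne hγ hγ' ha ha0 (s := z - π * I)
    (by rw [im3]; constructor <;> linarith) hne1.symm hne2.symm
  have hr3 : Tendsto (fun w => (w - (z - π * I)) * (cothKernel 1 (z - w) *
      (cothKernel a w - cothKernel a (w + γ * I)))) (𝓝[≠] (z - π * I))
      (𝓝 ((cothKernel a (z - π * I) - cothKernel a (z - π * I + γ * I)) *
        -(1 / (2 * π * I)))) := by
    refine (tendsto_residue_mul (g := fun w => cothKernel a w - cothKernel a (w + γ * I))
      (tendsto_residue_cothKernel_sub z (s := z - π * I) (by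
        rw [sub_sub_cancel, Complex.sinh_mul_I]; simp)) ?_).congr fun w => by ring
    exact (differentiableAt_cothKernel p1).continuousAt.sub
      ((differentiableAt_cothKernel p2).continuousAt.comp (f := fun w : ℂ => w + γ * I)
        (by fun_prop))
  have hval : cothKernel a (z - π * I) - cothKernel a (z - π * I + γ * I) =
      stripKernel a (γ / 2) (z - γ / 2 * I) := by
    have haC : (π * a : ℂ) = π - γ := by exact_mod_cast ha
    rw [stripKernel, ← cothKernel_add_period ha0.ne' (z - π * I),
      ← cothKernel_add_period ha0.ne' (z - π * I + γ * I), haC]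
    congr 2 <;> (push_cast; ring)
  rw [strip_convolution_aux hγ hγ' ha ha0 z
    (fun h => by
      have := hsin (γ / 2 - π) ⟨le_rfl, by linarith⟩ (by
        rw [show z.im - (γ / 2 - π) = z.im - γ / 2 + π by ring, Real.sin_add_pi, h, neg_zero])
      linarith)
    (fun h => by
      have := hsin (-(γ / 2)) ⟨by linarith, le_rfl⟩ (by rwa [sub_neg_eq_add])
      linarith)
    -- For Im z > γ/2 the pole z - iπ of coth(z - s) has entered the strip through its lower edge.
    -- Its residue gives the correction term. The hypothesis Im z ≠ γ keeps it distinct from the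
    -- pole i(γ - π).
    {((γ - π : ℝ) : ℂ) * I, ((-γ : ℝ) : ℂ) * I, z - π * I}
    (fun s => limUnder (𝓝[≠] s) (fun w => (w - s) * (cothKernel 1 (z - w) *
      (cothKernel a w - cothKernel a (w + γ * I)))))]
  · rw [Finset.sum_insert (by
      simp only [Finset.mem_insert, Finset.mem_singleton, not_or]; exact ⟨hne, hne1⟩),
      Finset.sum_pair hne2, hr1.limUnder_eq, hr2.limUnder_eq, hr3.limUnder_eq, hval,
      ← stripKernel_residue_sum γ]
    linear_combination (cothKernel 1 (z - ((γ - π : ℝ) : ℂ) * I) -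
      cothKernel 1 (z - ((-γ : ℝ) : ℂ) * I) - stripKernel a (γ / 2) (z - γ / 2 * I)) *
      residue_value
  · intro s hs hsS
    simp only [Finset.mem_insert, Finset.mem_singleton, not_or] at hsS
    exact ⟨hsinh s hs hsS.2.2, stripKernel_pole_ne hγ hγ' ha ha0 hs hsS.1 hsS.2.1⟩
  · intro s hs
    simp only [Finset.mem_insert, Finset.mem_singleton] at hs
    rcases hs with rfl | rfl | rfl
    · rw [im1]; constructor <;> linarith
    · rw [im2]; constructor <;> linarith
    · rw [im3]; constructor <;> linarith
  · intro s hs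
    simp only [Finset.mem_insert, Finset.mem_singleton] at hs
    rcases hs with rfl | rfl | rfl
    · rw [hr1.limUnder_eq]; exact hr1
    · rw [hr2.limUnder_eq]; exact hr2
    · rw [hr3.limUnder_eq]; exact hr3

end Strip

/-! ### Masses of the coth kernels and their form on the real axis -/

theorem integral_cothKernel_sub' {b : ℝ} (hb : 0 < b) {c₁ c₂ : ℝ} (h1 : 0 < c₁) (h1' : c₁ < π * b)
    (h2 : 0 < c₂) (h2' : c₂ < π * b)
    (hi : Integrable (fun t : ℝ => cothKernel b (t + c₁ * I) - cothKernel b (t + c₂ * I))) :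
    ∫ t : ℝ, (cothKernel b (t + c₁ * I) - cothKernel b (t + c₂ * I)) =
      ((c₁ - c₂) / (π * b) : ℝ) := by
  rcases le_total c₁ c₂ with h | h
  · rw [integral_cothKernel_sub hb h1 h h2' hi, ← ofReal_neg]
    congr 1
    ring
  · have hi' : Integrable (fun t : ℝ => cothKernel b (t + c₂ * I) - cothKernel b (t + c₁ * I)) := by
      refine hi.neg.congr (Eventually.of_forall fun t => ?_)
      simp
    have := integral_cothKernel_sub hb h2 h h1' hi'
    rw [← neg_inj, ← this, ← integral_neg]
    simp

/-- One of the two coth terms lies below the real axis. A shift by the period iπb brings both into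
the pole-free strip 0 < Im < πb, where the integral of their difference is proportional to the
difference in height. -/
theorem integral_stripKernel_of_abs_lt {b θ y : ℝ} (hb : 0 < b) (hy : |y| < θ)
    (hθ : |y| + θ < π * b) :
    ∫ t : ℝ, stripKernel b θ (t + y * I) = (1 - 2 * θ / (π * b) : ℝ) := by
  have hy' := abs_lt.1 hy
  have ha := abs_le.1 (le_refl |y|)
  have hsin1 : Real.sin ((y - θ) / b) ≠ 0 := by
    refine (Real.sin_neg_of_neg_of_neg_pi_lt (div_neg_of_neg_of_pos (by linarith) hb) ?_).ne
    rw [lt_div_iff₀ hb]; linarith [neg_abs_le y]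
  have hsin2 : Real.sin ((y + θ) / b) ≠ 0 := by
    refine (Real.sin_pos_of_pos_of_lt_pi (div_pos (by linarith) hb) ?_).ne'
    rw [div_lt_iff₀ hb]; linarith [le_abs_self y]
  have e : ∀ t : ℝ, stripKernel b θ (t + y * I) =
      cothKernel b (t + (y - θ + π * b : ℝ) * I) - cothKernel b (t + (y + θ : ℝ) * I) := by
    intro t
    rw [stripKernel, ← cothKernel_add_period hb.ne']
    congr 2 <;> (push_cast; ring)
  have hi := integrable_stripKernel hb hsin1 hsin2
  simp only [e] at hi ⊢
  rw [integral_cothKernel_sub' hb (by linarith [neg_abs_le y]) (by linarith) (by linarith)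
    (by linarith [le_abs_self y]) hi]
  congr 1
  have : π * b ≠ 0 := by positivity
  field_simp
  ring

/-- Above the line Im z = θ both coth terms already lie in one period strip, so no shift occurs and
the mass is smaller by 1, the effect of the crossed pole. -/
theorem integral_stripKernel_of_lt {b θ y : ℝ} (hb : 0 < b) (hθ : 0 < θ) (hy : θ < y)
    (hy' : y + θ < π * b) :
    ∫ t : ℝ, stripKernel b θ (t + y * I) = (-(2 * θ / (π * b)) : ℝ) := by
  have hsin1 : Real.sin ((y - θ) / b) ≠ 0 := by
    refine (Real.sin_pos_of_pos_of_lt_pi (div_pos (by linarith) hb) ?_).ne'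
    rw [div_lt_iff₀ hb]; linarith
  have hsin2 : Real.sin ((y + θ) / b) ≠ 0 := by
    refine (Real.sin_pos_of_pos_of_lt_pi (div_pos (by linarith) hb) ?_).ne'
    rw [div_lt_iff₀ hb]; linarith
  have e : ∀ t : ℝ, stripKernel b θ (t + y * I) =
      cothKernel b (t + (y - θ : ℝ) * I) - cothKernel b (t + (y + θ : ℝ) * I) := by
    intro t
    rw [stripKernel]
    congr 2 <;> (push_cast; ring)
  have hi := integrable_stripKernel hb hsin1 hsin2
  simp only [e] at hi ⊢
  rw [integral_cothKernel_sub' hb (by linarith) (by linarith) (by linarith)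
    (by linarith) hi]
  congr 1
  ring

/-- The product sinh(u - v) sinh(u + v) is half a difference of two hyperbolic cosines. In this
closed form positivity and unimodality on the real axis are visible, as is the sign of the real part
off the axis. -/
theorem stripKernel_eq {b θ : ℝ} {z : ℂ} (h1 : sinh ((z - I * θ) / b) ≠ 0)
    (h2 : sinh ((z + I * θ) / b) ≠ 0) :
    stripKernel b θ z = (Real.sin (2 * θ / b) / (π * b) : ℝ) *
      (cosh (2 * z / b) - Real.cos (2 * θ / b))⁻¹ := by
  rw [stripKernel, cothKernel_sub h1 h2, ← mul_inv]
  have e1 : (z + I * θ - (z - I * θ)) / b = ((2 * θ / b : ℝ) : ℂ) * I := by push_cast; ring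
  have e2 : sinh ((z - I * θ) / b) * sinh ((z + I * θ) / b) =
      (cosh (2 * z / b) - Real.cos (2 * θ / b)) / 2 := by
    have e3 : 2 * z / b = (z - I * θ) / b + (z + I * θ) / b := by ring
    have e4 : ((Real.cos (2 * θ / b) : ℝ) : ℂ) = cosh ((z - I * θ) / b - (z + I * θ) / b) := by
      rw [show (z - I * θ) / b - (z + I * θ) / b = -(((2 * θ / b : ℝ) : ℂ) * I) by push_cast; ring,
        Complex.cosh_neg, Complex.cosh_mul_I, ofReal_cos]
    rw [e4, e3, Complex.cosh_add, Complex.cosh_sub]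
    ring
  have e5 : sinh ((z + I * θ - (z - I * θ)) / b) = (Real.sin (2 * θ / b) : ℂ) * I := by
    rw [e1, Complex.sinh_mul_I, ofReal_sin]
  rw [e5, e2]
  push_cast
  have := Complex.I_ne_zero
  rw [inv_div, div_eq_mul_inv (2 : ℂ)]
  generalize (cosh (2 * z / b) - Complex.cos (2 * θ / b))⁻¹ = u
  by_cases hb : (b : ℂ) = 0
  · simp [hb]
  · have : (π : ℂ) ≠ 0 := by exact_mod_cast Real.pi_ne_zero
    field_simp

/-- The restriction of `stripKernel b θ` to the real line. -/
noncomputable def realKernel (b θ x : ℝ) : ℝ :=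
  Real.sin (2 * θ / b) / (π * b) * (Real.cosh (2 * x / b) - Real.cos (2 * θ / b))⁻¹

theorem stripKernel_ofReal {b θ : ℝ} (h : Real.sin (θ / b) ≠ 0) (x : ℝ) :
    stripKernel b θ x = realKernel b θ x := by
  rw [stripKernel_eq, realKernel]
  · push_cast; rfl
  · refine sinh_div_ne_zero_of_sin ?_
    rw [show ((x : ℂ) - I * θ).im = -θ by simp, neg_div, Real.sin_neg]
    exact neg_ne_zero.2 h
  · refine sinh_div_ne_zero_of_sin ?_
    rw [show ((x : ℂ) + I * θ).im = θ by simp]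
    exact h

theorem cos_lt_cosh {b θ : ℝ} (h1 : 0 < 2 * θ / b) (h2 : 2 * θ / b < π) (x : ℝ) :
    0 < Real.cosh x - Real.cos (2 * θ / b) := by
  have h3 : Real.cos (2 * θ / b) < 1 := by
    rw [← Real.cos_zero]
    exact Real.cos_lt_cos_of_nonneg_of_le_pi le_rfl h2.le h1
  linarith [Real.one_le_cosh x]

theorem realKernel_pos {b θ : ℝ} (hb : 0 < b) (h1 : 0 < 2 * θ / b) (h2 : 2 * θ / b < π) (x : ℝ) :
    0 < realKernel b θ x :=
  mul_pos (div_pos (Real.sin_pos_of_pos_of_lt_pi h1 h2) (by positivity))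
    (inv_pos.2 (cos_lt_cosh h1 h2 _))

theorem realKernel_anti {b θ : ℝ} (hb : 0 < b) (h1 : 0 < 2 * θ / b) (h2 : 2 * θ / b < π)
    {x y : ℝ} (h : |x| ≤ |y|) : realKernel b θ y ≤ realKernel b θ x := by
  refine mul_le_mul_of_nonneg_left (inv_anti₀ (cos_lt_cosh h1 h2 _) ?_)
    (div_pos (Real.sin_pos_of_pos_of_lt_pi h1 h2) (by positivity)).le
  have : Real.cosh (2 * x / b) ≤ Real.cosh (2 * y / b) := by
    rw [Real.cosh_le_cosh, abs_div, abs_div, abs_mul, abs_mul]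
    gcongr
  linarith

theorem realKernel_neg (b θ x : ℝ) : realKernel b θ (-x) = realKernel b θ x := by
  rw [realKernel, realKernel, mul_neg, neg_div, Real.cosh_neg]

/-! ### Uniqueness for contractions and associativity of convolution -/

section Contraction

/-- Only the passage from a sup bound B to mB is used, so no function space, continuity or
measurability enters. It serves both on the interval [-Q, Q] and on the whole line. -/
theorem eq_zero_of_contraction {α : Type*} {d : α → ℂ} {m B₀ : ℝ} (hm0 : 0 ≤ m) (hm1 : m < 1)
    (hB₀ : 0 ≤ B₀) (h0 : ∀ t, ‖d t‖ ≤ B₀)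
    (h : ∀ B, 0 ≤ B → (∀ t, ‖d t‖ ≤ B) → ∀ t, ‖d t‖ ≤ m * B) (t : α) : d t = 0 := by
  have key : ∀ n : ℕ, ∀ t, ‖d t‖ ≤ m ^ n * B₀ := by
    intro n
    induction n with
    | zero => simpa using h0
    | succ n ih =>
      intro t
      rw [pow_succ', mul_assoc]
      exact h _ (by positivity) ih t
  have hl := (tendsto_pow_atTop_nhds_zero_of_lt_one hm0 hm1).mul_const B₀
  rw [zero_mul] at hl
  exact norm_le_zero_iff.1 (ge_of_tendsto' hl fun n => key n t)

end Contraction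

section Convolution

theorem measurable_convolution {f₂ f₃ : ℝ → ℂ} (h2 : Continuous f₂) (h3 : Measurable f₃) :
    Measurable (fun l : ℝ => ∫ t : ℝ, f₂ (l - t) * f₃ t) := by
  have : StronglyMeasurable (fun p : ℝ × ℝ => f₂ (p.1 - p.2) * f₃ p.2) :=
    ((h2.comp (continuous_fst.sub continuous_snd)).measurable.mul
      (h3.comp measurable_snd)).stronglyMeasurable
  exact (StronglyMeasurable.integral_prod_right this).measurable

theorem norm_convolution_le {f₂ f₃ : ℝ → ℂ} (h2 : Integrable f₂) {M : ℝ}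
    (h3 : ∀ t, ‖f₃ t‖ ≤ M) (l : ℝ) : ‖∫ t : ℝ, f₂ (l - t) * f₃ t‖ ≤ (∫ t : ℝ, ‖f₂ t‖) * M := by
  have := norm_integral_le_of_norm_le ((h2.comp_sub_left l).norm.mul_const M)
    (Eventually.of_forall fun t => by
      rw [norm_mul]
      exact mul_le_mul_of_nonneg_left (h3 t) (norm_nonneg _) :
        ∀ᵐ t : ℝ, ‖f₂ (l - t) * f₃ t‖ ≤ ‖f₂ (l - t)‖ * M)
  rwa [integral_mul_const, integral_sub_left_eq_self (fun t => ‖f₂ t‖)] at this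

/-- Fubini. The third factor is merely bounded and measurable, because the dressed energy and its
outer part do not decay. -/
theorem convolution_assoc' {f₁ f₂ f₃ : ℝ → ℂ} (h1 : Integrable f₁) (h2 : Integrable f₂) {M : ℝ}
    (h3m : Measurable f₃) (h3 : ∀ t, ‖f₃ t‖ ≤ M) (x : ℝ) :
    ∫ l : ℝ, f₁ (x - l) * ∫ t : ℝ, f₂ (l - t) * f₃ t =
      ∫ t : ℝ, (∫ s : ℝ, f₁ (x - t - s) * f₂ s) * f₃ t := by
  have hint : Integrable (fun p : ℝ × ℝ => f₃ p.1 * (f₁ (x - p.2) * f₂ (-(p.1 - p.2))))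
      (volume.prod volume) := by
    -- `f₂` is reflected to bring the integrand into the form f(l) g(t - l) of a convolution; `f₃`
    -- enters as a bounded factor.
    have := Integrable.convolution_integrand (ContinuousLinearMap.mul ℂ ℂ) (h1.comp_sub_left x)
      (h2.comp_neg)
    refine (Integrable.bdd_mul (c := M) this
      (h3m.comp measurable_fst).aestronglyMeasurable (Eventually.of_forall fun p => h3 p.1))
  have e1 : ∀ l : ℝ, f₁ (x - l) * ∫ t : ℝ, f₂ (l - t) * f₃ t =
      ∫ t : ℝ, f₃ t * (f₁ (x - l) * f₂ (-(t - l))) := by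
    intro l
    rw [← integral_const_mul]
    congr 1
    funext t
    rw [neg_sub]
    ring
  simp only [e1]
  rw [integral_integral_swap (f := fun l t => f₃ t * (f₁ (x - l) * f₂ (-(t - l)))) hint.swap]
  congr 1
  funext t
  rw [integral_const_mul, mul_comm]
  congr 1
  rw [← integral_add_right_eq_self (fun l => f₁ (x - l) * f₂ (-(t - l))) t]
  congr 1
  funext s
  rw [show x - (s + t) = x - t - s by ring, show -(t - (s + t)) = s by ring]

end Convolution

/-! ### The cut domain and the poles -/

section Domain

variable {γ Q : ℝ} {z : ℂ}

theorem mem_domainUpsilon_of_im (hγ : 0 < γ) (hγ' : γ < π / 2) (h1 : |z.im| ≤ π / 2)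
    (h2 : |z.im| ≠ γ) : z ∈ domainUpsilon γ Q := by
  have h3 := abs_le.1 h1
  have hn : ∀ n : ℤ, (n : ℝ) ≤ -1 ∨ n = 0 ∨ (1 : ℝ) ≤ n := by
    intro n
    rcases lt_trichotomy n 0 with h | h | h
    · left; exact_mod_cast (by omega : n ≤ -1)
    · right; left; exact h
    · right; right; exact_mod_cast h
  intro t _ n
  constructor
  · intro h
    have him : z.im = γ + π * n := by rw [h]; simp
    rcases hn n with h4 | h4 | h4
    · nlinarith [Real.pi_pos]
    · apply h2; rw [him, h4]; simp [abs_of_pos hγ]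
    · nlinarith [Real.pi_pos]
  · intro h
    have him : z.im = -γ + π * n := by rw [h]; simp
    rcases hn n with h4 | h4 | h4
    · nlinarith [Real.pi_pos]
    · apply h2; rw [him, h4]; simp [abs_of_pos hγ]
    · nlinarith [Real.pi_pos]

theorem mem_domainUpsilon_of_re (h : Q < |z.re|) : z ∈ domainUpsilon γ Q := by
  intro t ht n
  have := abs_le.2 ht
  constructor
  · intro h'
    have him : z.re = t := by rw [h']; simp
    rw [him] at h; linarith
  · intro h'
    have him : z.re = t := by rw [h']; simp
    rw [him] at h; linarith

theorem not_mem_barePoles_of_re (h : z.re ≠ 0) : z ∉ barePoles γ := by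
  rintro ⟨n, h' | h'⟩
  · exact h (by rw [h']; simp)
  · exact h (by rw [h']; simp)

theorem not_mem_barePoles_of_im (hγ : 0 < γ) (hγ' : γ < π / 2) (h1 : |z.im| ≤ π / 2)
    (h2 : |z.im| ≠ γ / 2) : z ∉ barePoles γ := by
  have h3 := abs_le.1 h1
  have hn : ∀ n : ℤ, (n : ℝ) ≤ -1 ∨ n = 0 ∨ (1 : ℝ) ≤ n := by
    intro n
    rcases lt_trichotomy n 0 with h | h | h
    · left; exact_mod_cast (by omega : n ≤ -1)
    · right; left; exact h
    · right; right; exact_mod_cast h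
  rintro ⟨n, h | h⟩
  · have him : z.im = γ / 2 + π * n := by rw [h]; simp
    rcases hn n with h4 | h4 | h4
    · nlinarith [Real.pi_pos]
    · apply h2; rw [him, h4]; simp; linarith
    · nlinarith [Real.pi_pos]
  · have him : z.im = -(γ / 2) + π * n := by rw [h]; simp
    rcases hn n with h4 | h4 | h4
    · nlinarith [Real.pi_pos]
    · apply h2; rw [him, h4]; simp; linarith
    · nlinarith [Real.pi_pos]

theorem neg_mem_domainUpsilon (h : z ∈ domainUpsilon γ Q) : -z ∈ domainUpsilon γ Q := by
  intro t ht n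
  obtain ⟨h1, h2⟩ := h (-t) ⟨by linarith [ht.2], by linarith [ht.1]⟩ (-n)
  constructor
  · intro h'
    apply h2
    push_cast
    linear_combination -h'
  · intro h'
    apply h1
    push_cast
    linear_combination -h'

theorem conj_mem_domainUpsilon (h : z ∈ domainUpsilon γ Q) :
    (starRingEnd ℂ) z ∈ domainUpsilon γ Q := by
  intro t ht n
  obtain ⟨h1, h2⟩ := h t ht (-n)
  constructor
  · intro h'
    apply h2
    have := congrArg (starRingEnd ℂ) h'
    simp only [RingHomCompTriple.comp_apply, RingHom.id_apply, map_add, map_mul, conj_ofReal,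
      conj_I, map_intCast] at this
    push_cast
    linear_combination this
  · intro h'
    apply h1
    have := congrArg (starRingEnd ℂ) h'
    simp only [RingHomCompTriple.comp_apply, RingHom.id_apply, map_add, map_sub, map_mul,
      conj_ofReal, conj_I, map_intCast] at this
    push_cast
    linear_combination this

theorem neg_not_mem_barePoles (h : z ∉ barePoles γ) : -z ∉ barePoles γ := by
  rintro ⟨n, h' | h'⟩
  · exact h ⟨-n, Or.inr (by push_cast; push_cast at h'; linear_combination -h')⟩
  · exact h ⟨-n, Or.inl (by push_cast; push_cast at h'; linear_combination -h')⟩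

theorem conj_not_mem_barePoles (h : z ∉ barePoles γ) : (starRingEnd ℂ) z ∉ barePoles γ := by
  rintro ⟨n, h' | h'⟩
  · refine h ⟨-n, Or.inr ?_⟩
    have := congrArg (starRingEnd ℂ) h'
    simp only [RingHomCompTriple.comp_apply, RingHom.id_apply, map_add, map_mul, conj_ofReal,
      conj_I, map_intCast] at this
    push_cast at this ⊢
    linear_combination this
  · refine h ⟨-n, Or.inl ?_⟩
    have := congrArg (starRingEnd ℂ) h'
    simp only [RingHomCompTriple.comp_apply, RingHom.id_apply, map_add, map_mul, conj_ofReal,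
      conj_I, map_intCast, map_neg] at this
    push_cast at this ⊢
    linear_combination this

end Domain

/-! ### Differentiation under the integral sign -/

section Parametric

/-- The compact set z₀ - [-Q, Q] has a closed neighbourhood inside `N` on which F' is bounded; that
bound dominates the differentiated integrands for all z near z₀. -/
theorem hasDerivAt_integral_sub {N : Set ℂ} (hN : IsOpen N) {F : ℂ → ℂ}
    (hF : DifferentiableOn ℂ F N) {φ : ℝ → ℂ} {Q : ℝ} (hQ : 0 ≤ Q)
    (hφ : ContinuousOn φ (Icc (-Q) Q)) {z₀ : ℂ} (hz : ∀ μ ∈ Icc (-Q) Q, z₀ - μ ∈ N) :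
    HasDerivAt (fun z : ℂ => ∫ μ in (-Q)..Q, F (z - μ) * φ μ)
      (∫ μ in (-Q)..Q, deriv F (z₀ - μ) * φ μ) z₀ := by
  have hle : -Q ≤ Q := by linarith
  set Z : Set ℂ := (fun μ : ℝ => z₀ - μ) '' Icc (-Q) Q with hZ
  have hZc : IsCompact Z := isCompact_Icc.image (by fun_prop)
  obtain ⟨δ, hδ, hδN⟩ := hZc.exists_cthickening_subset_open hN (by
    rintro _ ⟨μ, hμ, rfl⟩; exact hz μ hμ)
  have hF' : DifferentiableOn ℂ (deriv F) N := hF.deriv hN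
  obtain ⟨C, hC⟩ := (hZc.cthickening (r := δ)).exists_bound_of_continuousOn
    (hF'.continuousOn.mono hδN)
  have hmem : ∀ z ∈ Metric.ball z₀ δ, ∀ μ ∈ Icc (-Q) Q, z - μ ∈ Metric.cthickening δ Z := by
    intro z hz' μ hμ
    refine Metric.mem_cthickening_of_dist_le _ (z₀ - μ) _ _ ⟨μ, hμ, rfl⟩ ?_
    rw [dist_sub_right]
    exact (Metric.mem_ball.1 hz').le
  have hFc : ∀ z ∈ Metric.ball z₀ δ, ContinuousOn (fun μ : ℝ => F (z - μ) * φ μ) (Icc (-Q) Q) :=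
    fun z hz' => (hF.continuousOn.comp (by fun_prop) fun μ hμ => hδN (hmem z hz' μ hμ)).mul hφ
  have hFc' : ContinuousOn (fun μ : ℝ => deriv F (z₀ - μ) * φ μ) (Icc (-Q) Q) :=
    (hF'.continuousOn.comp (by fun_prop) fun μ hμ => hz μ hμ).mul hφ
  have hball := Metric.ball_mem_nhds z₀ hδ
  have hsub : uIoc (-Q) Q ⊆ Icc (-Q) Q := by rw [uIoc_of_le hle]; exact Ioc_subset_Icc_self
  refine (intervalIntegral.hasDerivAt_integral_of_dominated_loc_of_deriv_le
    (bound := fun μ => C * ‖φ μ‖) (F := fun z μ => F (z - μ) * φ μ)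
    (F' := fun z μ => deriv F (z - μ) * φ μ) hball ?_ ?_ ?_ ?_ ?_ ?_).2
  · filter_upwards [hball] with z hz'
    exact ((hFc z hz').mono hsub).aestronglyMeasurable measurableSet_uIoc
  · exact ContinuousOn.intervalIntegrable (by
      rw [uIcc_of_le hle]; exact hFc z₀ (Metric.mem_ball_self hδ))
  · exact (hFc'.mono hsub).aestronglyMeasurable measurableSet_uIoc
  · refine Eventually.of_forall fun μ hμ z hz' => ?_
    rw [norm_mul]
    exact mul_le_mul_of_nonneg_right (hC _ (hmem z hz' μ (hsub hμ))) (norm_nonneg _)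
  · exact ContinuousOn.intervalIntegrable (by
      rw [uIcc_of_le hle]; exact hφ.norm.const_smul C)
  · refine Eventually.of_forall fun μ hμ z hz' => ?_
    have h1 : DifferentiableAt ℂ F (z - μ) :=
      hF.differentiableAt (hN.mem_nhds (hδN (hmem z hz' μ (hsub hμ))))
    exact (h1.hasDerivAt.comp_sub_const z (μ : ℂ)).mul_const _

/-- The points at which `stripKernel b θ` is regular. -/
def regularSet (b θ : ℝ) : Set ℂ :=
  {z | sinh ((z - I * θ) / b) ≠ 0 ∧ sinh ((z + I * θ) / b) ≠ 0}

theorem isOpen_regularSet (b θ : ℝ) : IsOpen (regularSet b θ) :=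
  (isOpen_ne.preimage (by fun_prop : Continuous fun z : ℂ => sinh ((z - I * θ) / b))).inter
    (isOpen_ne.preimage (by fun_prop : Continuous fun z : ℂ => sinh ((z + I * θ) / b)))

theorem differentiableOn_stripKernel (b θ : ℝ) :
    DifferentiableOn ℂ (stripKernel b θ) (regularSet b θ) := fun _ hz =>
  (differentiableAt_stripKernel hz.1 hz.2).differentiableWithinAt

theorem mem_regularSet_of_sin {b θ : ℝ} {z : ℂ} (h1 : Real.sin ((z.im - θ) / b) ≠ 0)
    (h2 : Real.sin ((z.im + θ) / b) ≠ 0) : z ∈ regularSet b θ :=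
  ⟨sinh_div_ne_zero_of_sin (by simpa using h1), sinh_div_ne_zero_of_sin (by simpa using h2)⟩

theorem mem_regularSet_of_re {b θ : ℝ} (hb : b ≠ 0) {z : ℂ} (h : z.re ≠ 0) :
    z ∈ regularSet b θ :=
  ⟨sinh_ne_zero_of_re (by rw [div_ofReal_re]; simp [h, hb]),
    sinh_ne_zero_of_re (by rw [div_ofReal_re]; simp [h, hb])⟩

theorem exists_bound_stripKernel {b θ y : ℝ} (hb : 0 < b) (h1 : Real.sin ((y - θ) / b) ≠ 0)
    (h2 : Real.sin ((y + θ) / b) ≠ 0) :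
    ∃ C, 0 ≤ C ∧ ∀ x : ℝ, ‖stripKernel b θ (x + y * I)‖ ≤ C := by
  refine ⟨1 / (2 * π * b) *
      (|Real.sin ((y - θ) / b)|⁻¹ * |Real.sin ((y + θ) / b)|⁻¹), by positivity, fun x => ?_⟩
  have := norm_stripKernel_le hb (θ := θ) (z := x + y * I) (by simpa using h1) (by simpa using h2)
  have e1 : ((x : ℂ) + y * I).im = y := by simp
  rw [e1] at this
  exact this.trans (mul_le_of_le_one_right (by positivity)
    (inv_le_one_of_one_le₀ (Real.one_le_cosh _)))

end Parametric

/-! ### Symmetries and analyticity of the dressed energy -/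

section Dressed

variable {γ J h Q : ℝ} {ε : ℂ → ℂ}

theorem dressed_equation (H : IsDressedEnergyAt γ J h Q ε) {z : ℂ} (h1 : z ∈ domainUpsilon γ Q)
    (h2 : z ∉ barePoles γ) : ε z = h - ((4 * π * J * Real.sin γ : ℝ) : ℂ) * stripKernel 1 (γ / 2) z
      - ∫ μ in (-Q)..Q, stripKernel 1 γ (z - μ) * ε μ := by
  rw [H.equation z h1 h2, bareEnergy]
  simp only [kernelK_eq]

theorem ofReal_mem_domain (hγ : 0 < γ) (hγ' : γ < π / 2) (x : ℝ) :
    (x : ℂ) ∈ domainUpsilon γ Q ∧ (x : ℂ) ∉ barePoles γ :=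
  ⟨mem_domainUpsilon_of_im hγ hγ' (by simp; positivity) (by simpa using hγ.ne),
    not_mem_barePoles_of_im hγ hγ' (by simp; positivity) (by simpa using (half_pos hγ).ne)⟩

theorem dressed_equation_real (hγ : 0 < γ) (hγ' : γ < π / 2) (H : IsDressedEnergyAt γ J h Q ε)
    (x : ℝ) : ε x = h - ((4 * π * J * Real.sin γ : ℝ) : ℂ) * stripKernel 1 (γ / 2) x
      - ∫ μ in (-Q)..Q, stripKernel 1 γ ((x : ℂ) - μ) * ε μ :=
  dressed_equation H (ofReal_mem_domain (Q := Q) hγ hγ' x).1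
    (ofReal_mem_domain (Q := Q) hγ hγ' x).2

theorem sin_ne_zero_of_Ioo {x : ℝ} (h1 : 0 < x) (h2 : x < π) : Real.sin x ≠ 0 :=
  (Real.sin_pos_of_pos_of_lt_pi h1 h2).ne'

theorem sin_sub_add_ne_zero (hγ' : γ < π / 2) {y : ℝ} (hy : |y| < γ) :
    Real.sin ((y - γ) / 1) ≠ 0 ∧ Real.sin ((y + γ) / 1) ≠ 0 := by
  have hy' := abs_lt.1 hy
  rw [div_one, div_one]
  exact ⟨(Real.sin_neg_of_neg_of_neg_pi_lt (by linarith) (by linarith)).ne,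
    sin_ne_zero_of_Ioo (by linarith) (by linarith)⟩

theorem stripKernel_real_one (hγ : 0 < γ) (hγ' : γ < π / 2) (x : ℝ) :
    stripKernel 1 γ x = realKernel 1 γ x :=
  stripKernel_ofReal (by rw [div_one]; exact sin_ne_zero_of_Ioo hγ (by linarith)) x

theorem integrable_realKernel_one (hγ : 0 < γ) (hγ' : γ < π / 2) :
    Integrable (realKernel 1 γ) := by
  have h := sin_sub_add_ne_zero hγ' (y := 0) (by simpa using hγ)
  have := integrable_stripKernel one_pos h.1 h.2
  simp only [ofReal_zero, zero_mul, add_zero, stripKernel_real_one hγ hγ'] at this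
  have h2 := this.re
  simpa using h2

theorem integral_realKernel_one (hγ : 0 < γ) (hγ' : γ < π / 2) :
    ∫ x : ℝ, realKernel 1 γ x = 1 - 2 * γ / π := by
  have := integral_stripKernel_of_abs_lt (b := 1) (θ := γ) (y := 0) one_pos (by simpa using hγ)
    (by simp; linarith)
  simp only [ofReal_zero, zero_mul, add_zero, stripKernel_real_one hγ hγ', mul_one,
    integral_complex_ofReal] at this
  exact_mod_cast this

theorem realKernel_one_pos (hγ : 0 < γ) (hγ' : γ < π / 2) (x : ℝ) : 0 < realKernel 1 γ x :=
  realKernel_pos one_pos (by linarith) (by linarith) x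

/-- The integral operator on `[-Q, Q]` is a contraction. -/
theorem eq_zero_of_integral_equation (hγ : 0 < γ) (hγ' : γ < π / 2) (hQ : 0 ≤ Q) {d : ℝ → ℂ}
    (hd : ContinuousOn d (Icc (-Q) Q))
    (h : ∀ t ∈ Icc (-Q) Q, d t = -∫ μ in (-Q)..Q, stripKernel 1 γ ((t : ℂ) - μ) * d μ) :
    ∀ t ∈ Icc (-Q) Q, d t = 0 := by
  obtain ⟨B₀, hB₀⟩ := isCompact_Icc.exists_bound_of_continuousOn hd
  -- The contraction constant is the mass of the positive kernel over the whole line.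
  have hm : 0 ≤ 1 - 2 * γ / π ∧ 1 - 2 * γ / π < 1 := by
    have h1 : 2 * γ / π < 1 := by rw [div_lt_one Real.pi_pos]; linarith
    have h2 : 0 < 2 * γ / π := by positivity
    constructor <;> linarith
  intro t ht
  refine eq_zero_of_contraction (α := Icc (-Q) Q) (d := fun t => d t) hm.1 hm.2
    (B₀ := max B₀ 0) (le_max_right _ _) (fun t => (hB₀ t t.2).trans (le_max_left _ _)) ?_ ⟨t, ht⟩
  intro B hB0 hB s
  rw [h s s.2, norm_neg, intervalIntegral.integral_of_le (by linarith)]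
  have hi := (integrable_realKernel_one hγ hγ').comp_sub_left (s : ℝ)
  have h1 : ‖∫ μ in Ioc (-Q) Q, stripKernel 1 γ (((s : ℝ) : ℂ) - μ) * d μ‖ ≤
      ∫ μ in Ioc (-Q) Q, realKernel 1 γ (s - μ) * B := by
    refine norm_integral_le_of_norm_le (hi.mul_const B).integrableOn ?_
    refine (ae_restrict_iff' measurableSet_Ioc).2 (Eventually.of_forall fun μ hμ => ?_)
    rw [norm_mul, ← ofReal_sub, stripKernel_real_one hγ hγ', norm_real,
      Real.norm_of_nonneg (realKernel_one_pos hγ hγ' _).le]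
    exact mul_le_mul_of_nonneg_left (hB ⟨μ, Ioc_subset_Icc_self hμ⟩)
      (realKernel_one_pos hγ hγ' _).le
  refine h1.trans ?_
  rw [integral_mul_const]
  refine mul_le_mul_of_nonneg_right ?_ hB0
  refine (setIntegral_le_integral hi (Eventually.of_forall fun μ =>
    (realKernel_one_pos hγ hγ' _).le)).trans ?_
  rw [integral_sub_left_eq_self (fun μ => realKernel 1 γ μ), integral_realKernel_one hγ hγ']

theorem intervalIntegral_conj (f : ℝ → ℂ) (a b : ℝ) :
    ∫ x in a..b, (starRingEnd ℂ) (f x) = (starRingEnd ℂ) (∫ x in a..b, f x) := by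
  rw [intervalIntegral.intervalIntegral_eq_integral_uIoc,
    intervalIntegral.intervalIntegral_eq_integral_uIoc, integral_conj]
  split_ifs <;> simp

theorem continuousOn_conj_comp {f : ℝ → ℂ} {s : Set ℝ} (h : ContinuousOn f s) :
    ContinuousOn (fun t => (starRingEnd ℂ) (f t)) s :=
  Complex.continuous_conj.comp_continuousOn h

theorem intervalIntegrable_kernel (hγ : 0 < γ) (hγ' : γ < π / 2) (hQ : 0 ≤ Q) {d : ℝ → ℂ}
    (hd : ContinuousOn d (Icc (-Q) Q)) (t : ℝ) :
    IntervalIntegrable (fun μ : ℝ => stripKernel 1 γ ((t : ℂ) - μ) * d μ) volume (-Q) Q := by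
  refine ContinuousOn.intervalIntegrable ?_
  rw [uIcc_of_le (by linarith)]
  refine ContinuousOn.mul ?_ hd
  have h := sin_sub_add_ne_zero hγ' (y := 0) (by simpa using hγ)
  have := continuous_stripKernel_line h.1 h.2
  simp only [ofReal_zero, zero_mul, add_zero] at this
  refine Continuous.continuousOn ?_
  have h2 := this.comp (by fun_prop : Continuous fun μ : ℝ => t - μ)
  refine h2.congr fun μ => ?_
  simp

/-- Kernel and driving term are real on the real axis, so the difference of ε and its conjugate
solves the homogeneous equation, which has only the zero solution. Evenness below follows in the
same way; both extend off the axis through the right-hand side of the equation. -/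
theorem dressed_conj_real (hγ : 0 < γ) (hγ' : γ < π / 2) (hQ : 0 ≤ Q)
    (H : IsDressedEnergyAt γ J h Q ε) : ∀ t ∈ Icc (-Q) Q, (starRingEnd ℂ) (ε t) = ε t := by
  have key := eq_zero_of_integral_equation hγ hγ' hQ (d := fun t => (starRingEnd ℂ) (ε t) - ε t)
    ((continuousOn_conj_comp H.continuousOn).sub H.continuousOn) ?_
  · intro t ht
    exact sub_eq_zero.1 (key t ht)
  intro t _
  have h1 := dressed_equation_real hγ hγ' H t
  have h2 := congrArg (starRingEnd ℂ) h1
  rw [map_sub, map_sub, map_mul, conj_ofReal, conj_ofReal, ← intervalIntegral_conj,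
    ← stripKernel_conj, conj_ofReal] at h2
  simp only [map_mul, ← stripKernel_conj, map_sub, conj_ofReal] at h2
  simp only [mul_sub]
  rw [intervalIntegral.integral_sub
    (intervalIntegrable_kernel hγ hγ' hQ (continuousOn_conj_comp H.continuousOn) t)
    (intervalIntegrable_kernel hγ hγ' hQ H.continuousOn t)]
  linear_combination h2 - h1

theorem dressed_neg_real (hγ : 0 < γ) (hγ' : γ < π / 2) (hQ : 0 ≤ Q)
    (H : IsDressedEnergyAt γ J h Q ε) : ∀ t ∈ Icc (-Q) Q, ε ((-t : ℝ) : ℂ) = ε t := by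
  have hc : ContinuousOn (fun t : ℝ => ε ((-t : ℝ) : ℂ)) (Icc (-Q) Q) :=
    H.continuousOn.comp (f := fun t : ℝ => -t) (by fun_prop)
      fun t ht => ⟨by linarith [ht.2], by linarith [ht.1]⟩
  have key := eq_zero_of_integral_equation hγ hγ' hQ (d := fun t => ε ((-t : ℝ) : ℂ) - ε t)
    (hc.sub H.continuousOn) ?_
  · intro t ht
    exact sub_eq_zero.1 (key t ht)
  intro t _
  have h1 := dressed_equation_real hγ hγ' H t
  have h2 := dressed_equation_real hγ hγ' H (-t)
  have h3 := intervalIntegral.integral_comp_neg (a := -Q) (b := Q)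
    (fun μ : ℝ => stripKernel 1 γ (((-t : ℝ) : ℂ) - μ) * ε μ)
  rw [neg_neg] at h3
  have h4 : ∀ μ : ℝ, stripKernel 1 γ (((-t : ℝ) : ℂ) - ((-μ : ℝ) : ℂ)) =
      stripKernel 1 γ ((t : ℂ) - μ) := fun μ => by
    rw [← stripKernel_neg]; congr 1; push_cast; ring
  simp only [h4] at h3
  rw [← h3, show ((-t : ℝ) : ℂ) = -(t : ℂ) by push_cast; rfl, stripKernel_neg] at h2
  simp only [mul_sub]
  rw [intervalIntegral.integral_sub (intervalIntegrable_kernel hγ hγ' hQ hc t)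
    (intervalIntegrable_kernel hγ hγ' hQ H.continuousOn t)]
  rw [show ((-t : ℝ) : ℂ) = -(t : ℂ) by push_cast; rfl]
  linear_combination h2 - h1

theorem dressed_conj (hγ : 0 < γ) (hγ' : γ < π / 2) (hQ : 0 ≤ Q)
    (H : IsDressedEnergyAt γ J h Q ε) {z : ℂ} (h1 : z ∈ domainUpsilon γ Q) (h2 : z ∉ barePoles γ) :
    ε ((starRingEnd ℂ) z) = (starRingEnd ℂ) (ε z) := by
  rw [dressed_equation H h1 h2, dressed_equation H (conj_mem_domainUpsilon h1)
    (conj_not_mem_barePoles h2), map_sub, map_sub, map_mul, conj_ofReal, conj_ofReal,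
    stripKernel_conj, ← intervalIntegral_conj]
  congr 1
  refine intervalIntegral.integral_congr fun μ hμ => ?_
  rw [uIcc_of_le (by linarith)] at hμ
  simp only [map_mul, ← stripKernel_conj, map_sub, conj_ofReal, dressed_conj_real hγ hγ' hQ H μ hμ]

theorem dressed_neg (hγ : 0 < γ) (hγ' : γ < π / 2) (hQ : 0 ≤ Q)
    (H : IsDressedEnergyAt γ J h Q ε) {z : ℂ} (h1 : z ∈ domainUpsilon γ Q) (h2 : z ∉ barePoles γ) :
    ε (-z) = ε z := by
  rw [dressed_equation H h1 h2, dressed_equation H (neg_mem_domainUpsilon h1)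
    (neg_not_mem_barePoles h2), stripKernel_neg]
  congr 1
  have h3 := intervalIntegral.integral_comp_neg (a := -Q) (b := Q)
    (fun μ : ℝ => stripKernel 1 γ (-z - μ) * ε μ)
  rw [neg_neg] at h3
  rw [← h3]
  refine intervalIntegral.integral_congr fun μ hμ => ?_
  rw [uIcc_of_le (by linarith)] at hμ
  rw [dressed_neg_real hγ hγ' hQ H μ hμ, ← stripKernel_neg]
  congr 2
  push_cast; ring

theorem differentiableAt_dressed_integral (hQ : 0 ≤ Q)
    (H : IsDressedEnergyAt γ J h Q ε) {z : ℂ}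
    (hz : ∀ μ ∈ Icc (-Q) Q, z - (μ : ℂ) ∈ regularSet 1 γ) :
    DifferentiableAt ℂ (fun z : ℂ => ∫ μ in (-Q)..Q, stripKernel 1 γ (z - μ) * ε μ) z :=
  (hasDerivAt_integral_sub (isOpen_regularSet 1 γ) (differentiableOn_stripKernel 1 γ) hQ
    H.continuousOn hz).differentiableAt

theorem sub_mem_regularSet_of_im (hγ' : γ < π / 2) {z : ℂ} (hz : |z.im| < γ)
    (μ : ℝ) : z - (μ : ℂ) ∈ regularSet 1 γ := by
  have := sin_sub_add_ne_zero hγ' hz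
  exact mem_regularSet_of_sin (by simpa using this.1) (by simpa using this.2)

end Dressed

/-! ### Convolutions evaluated along horizontal lines -/

theorem sub_ofReal_eq (z : ℂ) (l : ℝ) : z - (l : ℂ) = ((z.re - l : ℝ) : ℂ) + z.im * I := by
  apply Complex.ext <;> simp

theorem integrable_line {F : ℂ → ℂ} {z : ℂ} (h : Integrable (fun u : ℝ => F (u + z.im * I))) :
    Integrable (fun l : ℝ => F (z - l)) := by
  simp only [sub_ofReal_eq]
  exact h.comp_sub_left z.re

theorem integral_line {F : ℂ → ℂ} (z : ℂ) :
    ∫ l : ℝ, F (z - l) = ∫ u : ℝ, F (u + z.im * I) := by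
  simp only [sub_ofReal_eq]
  exact integral_sub_left_eq_self (fun u : ℝ => F (u + z.im * I)) volume z.re

theorem integrable_line_mul {F : ℂ → ℂ} {z : ℂ} (h : Integrable (fun u : ℝ => F (u + z.im * I)))
    {g : ℝ → ℂ} {M : ℝ} (hg : Measurable g) (hM : ∀ t, ‖g t‖ ≤ M) :
    Integrable (fun l : ℝ => F (z - l) * g l) :=
  (integrable_line h).mul_bdd hg.aestronglyMeasurable (Eventually.of_forall hM)

theorem convolution_assoc_line {F : ℂ → ℂ} {z : ℂ}
    (h1 : Integrable (fun u : ℝ => F (u + z.im * I))) {f₂ f₃ : ℝ → ℂ} (h2 : Integrable f₂) {M : ℝ}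
    (h3m : Measurable f₃) (h3 : ∀ t, ‖f₃ t‖ ≤ M) :
    ∫ l : ℝ, F (z - l) * ∫ t : ℝ, f₂ (l - t) * f₃ t =
      ∫ t : ℝ, (∫ s : ℝ, F (z - t - s) * f₂ s) * f₃ t := by
  have := convolution_assoc' h1 h2 h3m h3 z.re
  simp only [← sub_ofReal_eq] at this
  rw [this]
  congr 1
  funext t
  congr 2
  funext s
  congr 2
  apply Complex.ext <;> simp

/-! ### The integral equation on the whole line -/

section Dressed

variable {γ J h Q : ℝ} {ε : ℂ → ℂ}

theorem differentiableAt_dressed (hγ : 0 < γ) (hγ' : γ < π / 2) (hQ : 0 ≤ Q)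
    (H : IsDressedEnergyAt γ J h Q ε) {z : ℂ} (hz : |z.im| < γ / 2) :
    DifferentiableAt ℂ ε z := by
  have hz' := abs_lt.1 hz
  have hopen : {w : ℂ | |w.im| < γ / 2} ∈ 𝓝 z :=
    (isOpen_lt (by fun_prop) continuous_const).mem_nhds hz
  have e : ε =ᶠ[𝓝 z] fun z => h - ((4 * π * J * Real.sin γ : ℝ) : ℂ) * stripKernel 1 (γ / 2) z
      - ∫ μ in (-Q)..Q, stripKernel 1 γ (z - μ) * ε μ := by
    filter_upwards [hopen] with w hw
    have hw : |w.im| < γ / 2 := hw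
    exact dressed_equation H (mem_domainUpsilon_of_im hγ hγ' (by linarith) (by linarith))
      (not_mem_barePoles_of_im hγ hγ' (by linarith) hw.ne)
  refine DifferentiableAt.congr_of_eventuallyEq ?_ e
  refine ((differentiableAt_const _).sub ((differentiableAt_stripKernel_of_sin ?_ ?_).const_mul _)).sub
    (differentiableAt_dressed_integral hQ H fun μ _ =>
      sub_mem_regularSet_of_im hγ' (by linarith) μ)
  · rw [div_one]
    exact (Real.sin_neg_of_neg_of_neg_pi_lt (by linarith) (by linarith)).ne
  · rw [div_one]
    exact sin_ne_zero_of_Ioo (by linarith) (by linarith)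

theorem continuous_dressed_real (hγ : 0 < γ) (hγ' : γ < π / 2) (hQ : 0 ≤ Q)
    (H : IsDressedEnergyAt γ J h Q ε) : Continuous (fun x : ℝ => ε x) := by
  have := continuous_line (f := ε) (y := 0) fun x =>
    (differentiableAt_dressed hγ hγ' hQ H (by simpa using hγ)).continuousAt
  simpa using this

theorem exists_bound_dressed_real (hγ : 0 < γ) (hγ' : γ < π / 2) (hQ : 0 ≤ Q)
    (H : IsDressedEnergyAt γ J h Q ε) : ∃ M, ∀ x : ℝ, ‖ε x‖ ≤ M := by
  obtain ⟨B, hB⟩ := isCompact_Icc.exists_bound_of_continuousOn H.continuousOn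
  have hs := sin_sub_add_ne_zero hγ' (y := 0) (by simpa using hγ)
  obtain ⟨C₁, hC₁0, hC₁⟩ := exists_bound_stripKernel one_pos hs.1 hs.2
  obtain ⟨C₂, hC₂0, hC₂⟩ := exists_bound_stripKernel (b := 1) (θ := γ / 2) (y := 0) one_pos
    (by rw [zero_sub, div_one, Real.sin_neg]
        exact neg_ne_zero.2 (sin_ne_zero_of_Ioo (by linarith) (by linarith)))
    (by rw [zero_add, div_one]; exact sin_ne_zero_of_Ioo (by linarith) (by linarith))
  simp only [ofReal_zero, zero_mul, add_zero] at hC₁ hC₂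
  refine ⟨‖(h : ℂ)‖ + ‖((4 * π * J * Real.sin γ : ℝ) : ℂ)‖ * C₂ + C₁ * B * |Q - -Q|, fun x => ?_⟩
  rw [dressed_equation_real hγ hγ' H x]
  refine (norm_sub_le _ _).trans (add_le_add ((norm_sub_le _ _).trans (add_le_add le_rfl ?_)) ?_)
  · rw [norm_mul]
    exact mul_le_mul_of_nonneg_left (hC₂ x) (norm_nonneg _)
  · refine intervalIntegral.norm_integral_le_of_norm_le_const fun μ hμ => ?_
    rw [uIoc_of_le (by linarith)] at hμ
    rw [norm_mul, ← ofReal_sub]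
    exact mul_le_mul (hC₁ _) (hB μ (Ioc_subset_Icc_self hμ)) (norm_nonneg _) hC₁0

/-- The part of the dressed energy that lives outside the Fermi zone. -/
noncomputable def outer (Q : ℝ) (f : ℝ → ℂ) : ℝ → ℂ := indicator (Icc (-Q) Q)ᶜ f

theorem measurable_outer {f : ℝ → ℂ} (hf : Measurable f) : Measurable (outer Q f) :=
  hf.indicator measurableSet_Icc.compl

theorem norm_outer_le {f : ℝ → ℂ} {M : ℝ} (hf : ∀ x, ‖f x‖ ≤ M) (x : ℝ) : ‖outer Q f x‖ ≤ M :=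
  (norm_indicator_le_norm_self f x).trans (hf x)

/-- The convolution of the outer part with the strip kernel of period `π - γ`. -/
noncomputable def outerPotential (γ Q : ℝ) (f : ℝ → ℂ) (w : ℂ) : ℂ :=
  ∫ μ : ℝ, stripKernel (1 - γ / π) (γ / 2) (w - μ) * outer Q f μ

/-- This trades the integral over the Fermi zone for one over the whole line, where explicit
convolution identities are available. -/
theorem integral_kernel_inner {z : ℂ} {f : ℝ → ℂ} (hQ : 0 ≤ Q)
    (hK : Integrable (fun u : ℝ => stripKernel 1 γ (u + z.im * I))) (hf : Measurable f) {M : ℝ}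
    (hM : ∀ x, ‖f x‖ ≤ M) :
    ∫ μ in (-Q)..Q, stripKernel 1 γ (z - μ) * f μ =
      (∫ μ : ℝ, stripKernel 1 γ (z - μ) * f μ) -
        ∫ μ : ℝ, stripKernel 1 γ (z - μ) * outer Q f μ := by
  have hi := integrable_line_mul hK hf hM
  rw [intervalIntegral.integral_of_le (by linarith), ← integral_Icc_eq_integral_Ioc,
    eq_sub_iff_add_eq]
  have : (fun μ : ℝ => stripKernel 1 γ (z - μ) * outer Q f μ) =
      indicator (Icc (-Q) Q)ᶜ (fun μ : ℝ => stripKernel 1 γ (z - μ) * f μ) := by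
    funext μ
    by_cases hμ : μ ∈ (Icc (-Q) Q)ᶜ
    · simp only [outer, indicator_of_mem hμ]
    · simp only [outer, indicator_of_notMem hμ, mul_zero]
  rw [this, integral_indicator measurableSet_Icc.compl]
  exact integral_add_compl measurableSet_Icc hi

/-- The right-hand side of the inverted integral equation on the real line. -/
noncomputable def dressedSource (γ J h Q : ℝ) (f : ℝ → ℂ) (z : ℂ) : ℂ :=
  h / (2 * (1 - γ / π)) - ((4 * π * J * Real.sin γ : ℝ) : ℂ) * sechKernel γ z +
    ∫ t : ℝ, sechKernel γ (z - t) * outerPotential γ Q f t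

theorem pi_mul_one_sub (γ : ℝ) : π * (1 - γ / π) = π - γ := by
  have := Real.pi_ne_zero
  field_simp

theorem one_sub_div_pi_pos (hγ' : γ < π / 2) : 0 < 1 - γ / π := by
  have := Real.pi_pos
  rw [sub_pos, div_lt_one this]
  linarith

theorem continuous_stripKernel_outer (hγ : 0 < γ) (hγ' : γ < π / 2) :
    Continuous (fun u : ℝ => stripKernel (1 - γ / π) (γ / 2) u) := by
  have h := sin_half_div_pos hγ hγ' (pi_mul_one_sub γ) (one_sub_div_pi_pos hγ')
  have := continuous_stripKernel_line (b := 1 - γ / π) (θ := γ / 2) (y := 0)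
    (by rw [zero_sub, neg_div, Real.sin_neg]; exact (neg_lt_zero.2 h).ne)
    (by rw [zero_add]; exact h.ne')
  simpa using this

theorem measurable_outerPotential (hγ : 0 < γ) (hγ' : γ < π / 2) {f : ℝ → ℂ} (hf : Measurable f) :
    Measurable (fun t : ℝ => outerPotential γ Q f t) := by
  have := measurable_convolution (continuous_stripKernel_outer hγ hγ') (measurable_outer (Q := Q) hf)
  simpa only [outerPotential, ofReal_sub] using this

theorem exists_bound_outerPotential (hγ : 0 < γ) (hγ' : γ < π / 2) {f : ℝ → ℂ} {M : ℝ}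
    (hM : ∀ x, ‖f x‖ ≤ M) : ∃ B, ∀ t : ℝ, ‖outerPotential γ Q f t‖ ≤ B := by
  refine ⟨(∫ t : ℝ, ‖stripKernel (1 - γ / π) (γ / 2) t‖) * M, fun t => ?_⟩
  have := norm_convolution_le (integrable_stripKernel_real hγ hγ' (pi_mul_one_sub γ)
    (one_sub_div_pi_pos hγ')) (norm_outer_le (Q := Q) hM) t
  simpa only [outerPotential, ofReal_sub] using this

theorem continuous_sechKernel_real (hγ : 0 < γ) : Continuous (fun x : ℝ => sechKernel γ x) := by
  have := continuous_line (f := sechKernel γ) (y := 0) fun x =>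
    (differentiableAt_sechKernel hγ.ne' (z := x + (0 : ℝ) * I) (cosh_ne_zero_of_cos (by
      rw [show (π * (x + (0 : ℝ) * I) / γ : ℂ) = ((π * x / γ : ℝ) : ℂ) by push_cast; ring]
      simp [-ofReal_div, -ofReal_mul]))).continuousAt
  simpa using this

theorem exists_bound_sechKernel_real (hγ : 0 < γ) : ∃ B, ∀ x : ℝ, ‖sechKernel γ x‖ ≤ B := by
  refine ⟨1 / (2 * γ), fun x => ?_⟩
  have := norm_sechKernel_le hγ (z := x) (by simp)
  simp only [ofReal_im, mul_zero, zero_div, Real.cos_zero, abs_one, inv_one, mul_one,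
    ofReal_re] at this
  exact this.trans (mul_le_of_le_one_right (by positivity)
    (inv_le_one_of_one_le₀ (Real.one_le_cosh _)))

theorem measurable_sech_convolution (hγ : 0 < γ) {g : ℝ → ℂ} (hg : Measurable g) :
    Measurable (fun x : ℝ => ∫ t : ℝ, sechKernel γ (x - t) * g t) := by
  have := measurable_convolution (continuous_sechKernel_real hγ) hg
  simpa only [ofReal_sub] using this

theorem exists_bound_sech_convolution (hγ : 0 < γ) {g : ℝ → ℂ} {M : ℝ} (hM : ∀ x, ‖g x‖ ≤ M) :
    ∃ B, ∀ x : ℝ, ‖∫ t : ℝ, sechKernel γ (x - t) * g t‖ ≤ B := by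
  refine ⟨(∫ t : ℝ, ‖sechKernel γ t‖) * M, fun x => ?_⟩
  have := norm_convolution_le (integrable_sechKernel_real hγ) hM x
  simpa only [ofReal_sub] using this

theorem measurable_dressedSource (hγ : 0 < γ) (hγ' : γ < π / 2) {f : ℝ → ℂ} (hf : Measurable f) :
    Measurable (fun x : ℝ => dressedSource γ J h Q f x) := by
  unfold dressedSource
  exact ((measurable_const.sub ((continuous_sechKernel_real hγ).measurable.const_mul _))).add
    (measurable_sech_convolution hγ (measurable_outerPotential hγ hγ' hf))

theorem exists_bound_dressedSource (hγ : 0 < γ) (hγ' : γ < π / 2) {f : ℝ → ℂ} {M : ℝ}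
    (hM : ∀ x, ‖f x‖ ≤ M) : ∃ B, ∀ x : ℝ, ‖dressedSource γ J h Q f x‖ ≤ B := by
  obtain ⟨B₁, h1⟩ := exists_bound_outerPotential (Q := Q) hγ hγ' hM
  obtain ⟨B₂, h2⟩ := exists_bound_sech_convolution hγ h1
  obtain ⟨B₃, h3⟩ := exists_bound_sechKernel_real hγ
  refine ⟨‖(h / (2 * (1 - γ / π)) : ℂ)‖ + ‖((4 * π * J * Real.sin γ : ℝ) : ℂ)‖ * B₃ + B₂,
    fun x => ?_⟩
  refine (norm_add_le _ _).trans (add_le_add ((norm_sub_le _ _).trans (add_le_add le_rfl ?_)) (h2 x))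
  rw [norm_mul]
  exact mul_le_mul_of_nonneg_left (h3 x) (norm_nonneg _)

/-- Associativity moves the kernel onto 1/cosh in the last term. The inner convolutions are left
unevaluated, since their values differ between the strips |Im z| < γ/2, γ/2 < Im z < γ and Im z > γ.
-/
theorem integral_kernel_dressedSource (hγ : 0 < γ) (hγ' : γ < π / 2) {f : ℝ → ℂ}
    (hf : Measurable f) {M : ℝ} (hM : ∀ x, ‖f x‖ ≤ M) {z : ℂ}
    (hK : Integrable (fun u : ℝ => stripKernel 1 γ (u + z.im * I))) :
    ∫ μ : ℝ, stripKernel 1 γ (z - μ) * dressedSource γ J h Q f μ =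
      h / (2 * (1 - γ / π)) * (∫ u : ℝ, stripKernel 1 γ (u + z.im * I)) -
        ((4 * π * J * Real.sin γ : ℝ) : ℂ) *
          (∫ t : ℝ, stripKernel 1 γ (z - t) * sechKernel γ t) +
        ∫ t : ℝ, (∫ s : ℝ, stripKernel 1 γ (z - t - s) * sechKernel γ s) *
          outerPotential γ Q f t := by
  obtain ⟨B₁, hB₁⟩ := exists_bound_outerPotential (Q := Q) hγ hγ' hM
  obtain ⟨B₂, hB₂⟩ := exists_bound_sech_convolution hγ hB₁
  obtain ⟨B₃, hB₃⟩ := exists_bound_sechKernel_real hγ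
  have hpm := measurable_outerPotential (Q := Q) hγ hγ' hf
  have i1 := integrable_line hK
  have i2 := integrable_line_mul hK (continuous_sechKernel_real hγ).measurable hB₃
  have i3 := integrable_line_mul hK (measurable_sech_convolution hγ hpm) hB₂
  have e : ∀ μ : ℝ, stripKernel 1 γ (z - μ) * dressedSource γ J h Q f μ =
      h / (2 * (1 - γ / π)) * stripKernel 1 γ (z - μ) -
        ((4 * π * J * Real.sin γ : ℝ) : ℂ) * (stripKernel 1 γ (z - μ) * sechKernel γ μ) +
        stripKernel 1 γ (z - μ) * ∫ t : ℝ, sechKernel γ (μ - t) * outerPotential γ Q f t := by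
    intro μ
    rw [dressedSource]
    ring
  have assoc := convolution_assoc_line hK (integrable_sechKernel_real hγ) hpm hB₁
  simp only [ofReal_sub] at assoc
  have i12 : Integrable (fun μ : ℝ => h / (2 * (1 - γ / π)) * stripKernel 1 γ (z - μ) -
      ((4 * π * J * Real.sin γ : ℝ) : ℂ) * (stripKernel 1 γ (z - μ) * sechKernel γ μ)) :=
    (i1.const_mul _).sub (i2.const_mul _)
  simp only [e]
  rw [integral_add i12 i3, integral_sub (i1.const_mul _) (i2.const_mul _), integral_const_mul, integral_const_mul,
    assoc, integral_line z]

theorem integral_kernel_half_outerPotential (hγ : 0 < γ) (hγ' : γ < π / 2) {f : ℝ → ℂ}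
    (hf : Measurable f) {M : ℝ} (hM : ∀ x, ‖f x‖ ≤ M) {z : ℂ}
    (hk : Integrable (fun u : ℝ => stripKernel 1 (γ / 2) (u + z.im * I))) :
    ∫ t : ℝ, stripKernel 1 (γ / 2) (z - t) * outerPotential γ Q f t =
      ∫ μ : ℝ, (∫ s : ℝ, stripKernel 1 (γ / 2) (z - μ - s) *
        stripKernel (1 - γ / π) (γ / 2) s) * outer Q f μ := by
  have := convolution_assoc_line hk (integrable_stripKernel_real hγ hγ' (pi_mul_one_sub γ)
    (one_sub_div_pi_pos hγ')) (measurable_outer (Q := Q) hf) (norm_outer_le (Q := Q) hM)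
  simpa only [outerPotential, ofReal_sub] using this

end Dressed

/-! ### The inverted equation and its continuation beyond the pole and the cut -/

section Dressed

variable {γ J h Q : ℝ} {ε : ℂ → ℂ}

theorem integrable_stripKernel_one {θ y : ℝ} (h1 : Real.sin (y - θ) ≠ 0)
    (h2 : Real.sin (y + θ) ≠ 0) : Integrable (fun u : ℝ => stripKernel 1 θ (u + y * I)) :=
  integrable_stripKernel one_pos (by rwa [div_one]) (by rwa [div_one])

theorem sin_ne_zero_of_neg {x : ℝ} (h1 : x < 0) (h2 : -π < x) : Real.sin x ≠ 0 :=
  (Real.sin_neg_of_neg_of_neg_pi_lt h1 h2).ne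

theorem integrable_kernel_of_abs_lt (hγ' : γ < π / 2) {y : ℝ} (hy : |y| < γ) :
    Integrable (fun u : ℝ => stripKernel 1 γ (u + y * I)) := by
  have := abs_lt.1 hy
  exact integrable_stripKernel_one (sin_ne_zero_of_neg (by linarith) (by linarith))
    (sin_ne_zero_of_Ioo (by linarith) (by linarith))

theorem integrable_half_kernel_of_abs_lt (hγ' : γ < π / 2) {y : ℝ} (hy : |y| < γ / 2) :
    Integrable (fun u : ℝ => stripKernel 1 (γ / 2) (u + y * I)) :=
  integrable_kernel_of_abs_lt (by have := abs_nonneg y; linarith) hy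

theorem integrable_half_kernel_of_lt (hγ : 0 < γ) {y : ℝ} (hy : γ / 2 < y)
    (hy' : y < π - γ) : Integrable (fun u : ℝ => stripKernel 1 (γ / 2) (u + y * I)) :=
  integrable_stripKernel_one (sin_ne_zero_of_Ioo (by linarith) (by linarith))
    (sin_ne_zero_of_Ioo (by linarith) (by linarith))

theorem integrable_sechKernel_of_abs_lt (hγ : 0 < γ) {y : ℝ} (hy : |y| < γ / 2) :
    Integrable (fun u : ℝ => sechKernel γ (u + y * I)) := by
  have := abs_lt.1 hy
  refine integrable_sechKernel hγ (Real.cos_pos_of_mem_Ioo ⟨?_, ?_⟩).ne'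
  · rw [lt_div_iff₀ hγ]; nlinarith [Real.pi_pos]
  · rw [div_lt_iff₀ hγ]; nlinarith [Real.pi_pos]

theorem integrable_sechKernel_of_lt (hγ : 0 < γ) {y : ℝ} (hy : γ / 2 < y) (hy' : y < γ) :
    Integrable (fun u : ℝ => sechKernel γ (u + y * I)) := by
  refine integrable_sechKernel hγ (ne_of_lt (Real.cos_neg_of_pi_div_two_lt_of_lt ?_ ?_))
  · rw [lt_div_iff₀ hγ]; nlinarith [Real.pi_pos]
  · rw [div_lt_iff₀ hγ]; nlinarith [Real.pi_pos]

theorem half_outerPotential_of_abs_lt (hγ : 0 < γ) (hγ' : γ < π / 2) {f : ℝ → ℂ}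
    (hf : Measurable f) {M : ℝ} (hM : ∀ x, ‖f x‖ ≤ M) {z : ℂ} (hz : |z.im| < γ / 2) :
    ∫ t : ℝ, stripKernel 1 (γ / 2) (z - t) * outerPotential γ Q f t =
      ∫ μ : ℝ, stripKernel 1 γ (z - μ) * outer Q f μ := by
  rw [integral_kernel_half_outerPotential hγ hγ' hf hM (integrable_half_kernel_of_abs_lt hγ' hz)]
  congr 1
  funext μ
  rw [integral_stripKernel_mul_stripKernel hγ hγ' (pi_mul_one_sub γ) (one_sub_div_pi_pos hγ')
    (by simpa using hz)]

/-- The residue term of the continued semigroup property, integrated against the outer energy, is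
the potential shifted by -iγ/2. It is what remains in the formulas for ε above the line Im z = γ/2.
-/
theorem half_outerPotential_of_lt (hγ : 0 < γ) (hγ' : γ < π / 2) {f : ℝ → ℂ}
    (hf : Measurable f) {M : ℝ} (hM : ∀ x, ‖f x‖ ≤ M) {z : ℂ} (hz : γ / 2 < z.im)
    (hz' : z.im < π - γ) (hz3 : z.im ≠ γ) :
    ∫ t : ℝ, stripKernel 1 (γ / 2) (z - t) * outerPotential γ Q f t =
      (∫ μ : ℝ, stripKernel 1 γ (z - μ) * outer Q f μ) -
        outerPotential γ Q f (z - γ / 2 * I) := by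
  have ha := pi_mul_one_sub γ
  have ha0 := one_sub_div_pi_pos hγ'
  rw [integral_kernel_half_outerPotential hγ hγ' hf hM (integrable_half_kernel_of_lt hγ hz hz')]
  have e : ∀ μ : ℝ, (∫ s : ℝ, stripKernel 1 (γ / 2) (z - μ - s) *
        stripKernel (1 - γ / π) (γ / 2) s) * outer Q f μ = stripKernel 1 γ (z - μ) * outer Q f μ -
        stripKernel (1 - γ / π) (γ / 2) (z - γ / 2 * I - μ) * outer Q f μ := by
    intro μ
    rw [integral_stripKernel_mul_stripKernel_of_lt hγ hγ' ha ha0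
      (by simpa using hz) (by simpa using hz') (by simpa using hz3), ← sub_mul, sub_right_comm z]
  simp only [e]
  have him : (z - γ / 2 * I).im = z.im - γ / 2 := by simp
  rw [integral_sub, outerPotential]
  · refine integrable_line_mul (integrable_stripKernel_one ?_ ?_) (measurable_outer hf)
      (norm_outer_le hM)
    · rcases lt_or_gt_of_ne hz3 with h3 | h3
      · exact sin_ne_zero_of_neg (by linarith) (by linarith)
      · exact sin_ne_zero_of_Ioo (by linarith) (by linarith)
    · exact sin_ne_zero_of_Ioo (by linarith) (by linarith)
  · refine integrable_line_mul (z := z - γ / 2 * I) (integrable_stripKernel ha0 ?_ ?_)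
      (measurable_outer hf) (norm_outer_le hM)
    · rw [him]
      rcases lt_or_gt_of_ne hz3 with h3 | h3
      · refine sin_ne_zero_of_neg (div_neg_of_neg_of_pos (by linarith) ha0) ?_
        rw [lt_div_iff₀ ha0]; linarith
      · refine sin_ne_zero_of_Ioo (div_pos (by linarith) ha0) ?_
        rw [div_lt_iff₀ ha0]; linarith
    · rw [him]
      refine sin_ne_zero_of_Ioo (div_pos (by linarith) ha0) ?_
      rw [div_lt_iff₀ ha0]; linarith

/-- The action of the kernel on the inverted right-hand side, close to the real axis. -/
theorem integral_kernel_dressedSource_of_abs_lt (hγ : 0 < γ) (hγ' : γ < π / 2) {f : ℝ → ℂ}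
    (hf : Measurable f) {M : ℝ} (hM : ∀ x, ‖f x‖ ≤ M) {z : ℂ} (hz : |z.im| < γ / 2) :
    (∫ μ : ℝ, stripKernel 1 γ (z - μ) * dressedSource γ J h Q f μ) =
      h - ((4 * π * J * Real.sin γ : ℝ) : ℂ) * stripKernel 1 (γ / 2) z +
        (∫ μ : ℝ, stripKernel 1 γ (z - μ) * outer Q f μ) - dressedSource γ J h Q f z := by
  obtain ⟨B₁, hB₁⟩ := exists_bound_outerPotential (Q := Q) hγ hγ' hM
  have hpm := measurable_outerPotential (Q := Q) hγ hγ' hf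
  have hzγ : |z.im| < γ := by linarith
  have hconv : ∀ t : ℝ, (∫ s : ℝ, stripKernel 1 γ (z - t - s) * sechKernel γ s) *
      outerPotential γ Q f t = stripKernel 1 (γ / 2) (z - t) * outerPotential γ Q f t -
        sechKernel γ (z - t) * outerPotential γ Q f t := by
    intro t
    rw [integral_stripKernel_mul_sechKernel hγ hγ' (by simpa using hzγ) (by simpa using hz.ne)]
    ring
  rw [integral_kernel_dressedSource hγ hγ' hf hM (integrable_kernel_of_abs_lt hγ' hzγ),
    integral_stripKernel_mul_sechKernel hγ hγ' hzγ hz.ne,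
    integral_stripKernel_of_abs_lt one_pos hzγ (by linarith)]
  simp only [hconv]
  rw [integral_sub (integrable_line_mul (integrable_half_kernel_of_abs_lt hγ' hz) hpm hB₁)
    (integrable_line_mul (integrable_sechKernel_of_abs_lt hγ hz) hpm hB₁),
    half_outerPotential_of_abs_lt hγ hγ' hf hM hz, dressedSource]
  have h1 : (1 - γ / π : ℂ) ≠ 0 := by exact_mod_cast (one_sub_div_pi_pos hγ').ne'
  -- The constant h/(2(1 - γ/π)) solves C + (1 - 2γ/π) C = h, with 1 - 2γ/π the mass of the kernel.
  have h2 : (h : ℂ) / (2 * (1 - γ / π)) * ((1 - 2 * γ / (π * 1) : ℝ) : ℂ) =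
      h - h / (2 * (1 - γ / π)) := by
    have : (2 * (1 - γ / π) : ℂ) ≠ 0 := mul_ne_zero two_ne_zero h1
    rw [div_mul_eq_mul_div, div_eq_iff this, sub_mul, div_mul_cancel₀ _ this]
    push_cast
    ring
  rw [h2]
  ring

/-- The inverted integral equation on the real line. -/
theorem dressed_eq_dressedSource_real (hγ : 0 < γ) (hγ' : γ < π / 2) (hQ : 0 ≤ Q)
    (H : IsDressedEnergyAt γ J h Q ε) (x : ℝ) :
    ε x = dressedSource γ J h Q (fun t : ℝ => ε t) x := by
  have hf : Measurable (fun t : ℝ => ε t) := (continuous_dressed_real hγ hγ' hQ H).measurable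
  obtain ⟨M, hM⟩ := exists_bound_dressed_real hγ hγ' hQ H
  obtain ⟨B, hB⟩ := exists_bound_dressedSource (J := J) (h := h) (Q := Q) hγ hγ' hM
  have hsm := measurable_dressedSource (J := J) (h := h) (Q := Q) hγ hγ' hf
  have him : ∀ t : ℝ, |(t : ℂ).im| < γ / 2 := fun t => by simpa using hγ
  have hK : ∀ t : ℝ, Integrable (fun u : ℝ => stripKernel 1 γ (u + (t : ℂ).im * I)) := fun t =>
    integrable_kernel_of_abs_lt hγ' (by simpa using hγ)
  -- ε and the source satisfy the same whole-line equation with the same outer term. Their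
  -- difference solves the homogeneous equation, and the mass 1 - 2γ/π < 1 forces it to vanish.
  have hd : ∀ t : ℝ, ε t - dressedSource γ J h Q (fun t : ℝ => ε t) t =
      -∫ μ : ℝ, stripKernel 1 γ ((t : ℂ) - μ) *
        (ε μ - dressedSource γ J h Q (fun t : ℝ => ε t) μ) := by
    intro t
    simp only [mul_sub]
    rw [integral_sub (integrable_line_mul (hK t) hf hM) (integrable_line_mul (hK t) hsm hB),
      integral_kernel_dressedSource_of_abs_lt hγ hγ' hf hM (him t)]
    have h1 := dressed_equation_real hγ hγ' H t
    rw [integral_kernel_inner hQ (hK t) hf hM] at h1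
    linear_combination h1
  have hm : 0 ≤ 1 - 2 * γ / π ∧ 1 - 2 * γ / π < 1 := by
    have h1 : 2 * γ / π < 1 := by rw [div_lt_one Real.pi_pos]; linarith
    have h2 : 0 < 2 * γ / π := by positivity
    constructor <;> linarith
  refine sub_eq_zero.1 (eq_zero_of_contraction (d := fun t : ℝ => ε t -
    dressedSource γ J h Q (fun t : ℝ => ε t) t) hm.1 hm.2 (B₀ := max (M + B) 0) (le_max_right _ _)
    (fun t => ((norm_sub_le _ _).trans (add_le_add (hM t) (hB t))).trans (le_max_left _ _)) ?_ x)
  intro B' _ hB' t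
  simp only [hd t, norm_neg]
  have hi := (integrable_realKernel_one hγ hγ').comp_sub_left t
  refine (norm_integral_le_of_norm_le (hi.mul_const B') (Eventually.of_forall fun μ => ?_)).trans ?_
  · rw [norm_mul, ← ofReal_sub, stripKernel_real_one hγ hγ', norm_real,
      Real.norm_of_nonneg (realKernel_one_pos hγ hγ' _).le]
    exact mul_le_mul_of_nonneg_left (hB' μ) (realKernel_one_pos hγ hγ' _).le
  · rw [integral_mul_const, integral_sub_left_eq_self (fun μ => realKernel 1 γ μ),
      integral_realKernel_one hγ hγ']

/-- The values of ε on the real line under the full integral are replaced by the explicit source, so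
that ε off the axis is expressed by convolutions that can be evaluated in each strip separately. -/
theorem dressed_equation_outer (hγ : 0 < γ) (hγ' : γ < π / 2) (hQ : 0 ≤ Q)
    (H : IsDressedEnergyAt γ J h Q ε) {z : ℂ} (h1 : z ∈ domainUpsilon γ Q) (h2 : z ∉ barePoles γ)
    (hK : Integrable (fun u : ℝ => stripKernel 1 γ (u + z.im * I))) :
    ε z = h - ((4 * π * J * Real.sin γ : ℝ) : ℂ) * stripKernel 1 (γ / 2) z -
      ((∫ μ : ℝ, stripKernel 1 γ (z - μ) * dressedSource γ J h Q (fun t : ℝ => ε t) μ) -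
        ∫ μ : ℝ, stripKernel 1 γ (z - μ) * outer Q (fun t : ℝ => ε t) μ) := by
  obtain ⟨M, hM⟩ := exists_bound_dressed_real hγ hγ' hQ H
  rw [dressed_equation H h1 h2, integral_kernel_inner hQ hK
    (continuous_dressed_real hγ hγ' hQ H).measurable hM]
  simp only [← dressed_eq_dressedSource_real hγ hγ' hQ H]

/-- The inverted integral equation in the strip `|Im z| < γ / 2`. -/
theorem dressed_eq_dressedSource (hγ : 0 < γ) (hγ' : γ < π / 2) (hQ : 0 ≤ Q)
    (H : IsDressedEnergyAt γ J h Q ε) {z : ℂ} (hz : |z.im| < γ / 2) :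
    ε z = dressedSource γ J h Q (fun t : ℝ => ε t) z := by
  obtain ⟨M, hM⟩ := exists_bound_dressed_real hγ hγ' hQ H
  rw [dressed_equation_outer hγ hγ' hQ H
    (mem_domainUpsilon_of_im hγ hγ' (by linarith) (by linarith))
    (not_mem_barePoles_of_im hγ hγ' (by linarith) hz.ne)
    (integrable_kernel_of_abs_lt hγ' (by linarith)),
    integral_kernel_dressedSource_of_abs_lt hγ hγ'
      (continuous_dressed_real hγ hγ' hQ H).measurable hM hz]
  ring

/-- The dressed energy above the cut. -/
theorem dressed_eq_of_gt (hγ : 0 < γ) (hγ' : γ < π / 2) (hQ : 0 ≤ Q)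
    (H : IsDressedEnergyAt γ J h Q ε) {z : ℂ} (hz1 : γ < z.im) (hz2 : z.im ≤ π / 2) :
    ε z = h / (1 - γ / π) + outerPotential γ Q (fun t : ℝ => ε t) (z - γ / 2 * I) := by
  obtain ⟨M, hM⟩ := exists_bound_dressed_real hγ hγ' hQ H
  have hf : Measurable (fun t : ℝ => ε t) := (continuous_dressed_real hγ hγ' hQ H).measurable
  have habs : |z.im| = z.im := abs_of_pos (by linarith)
  have hK : Integrable (fun u : ℝ => stripKernel 1 γ (u + z.im * I)) :=
    integrable_stripKernel_one (sin_ne_zero_of_Ioo (by linarith) (by linarith))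
      (sin_ne_zero_of_Ioo (by linarith) (by linarith))
  have hconv : ∀ t : ℝ, (∫ s : ℝ, stripKernel 1 γ (z - t - s) * sechKernel γ s) *
      outerPotential γ Q (fun t : ℝ => ε t) t =
        stripKernel 1 (γ / 2) (z - t) * outerPotential γ Q (fun t : ℝ => ε t) t := by
    intro t
    rw [integral_stripKernel_mul_sechKernel_of_lt hγ (by simpa using hz1)
      (by simp; linarith)]
  rw [dressed_equation_outer hγ hγ' hQ H
    (mem_domainUpsilon_of_im hγ hγ' (by linarith) (by linarith))
    (not_mem_barePoles_of_im hγ hγ' (by linarith) (by linarith)) hK,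
    integral_kernel_dressedSource hγ hγ' hf hM hK,
    integral_stripKernel_mul_sechKernel_of_lt hγ hz1 (by linarith),
    integral_stripKernel_of_lt one_pos hγ hz1 (by linarith)]
  simp only [hconv]
  rw [half_outerPotential_of_lt hγ hγ' hf hM (by linarith) (by linarith) hz1.ne']
  have h1 : (1 - γ / π : ℂ) ≠ 0 := by exact_mod_cast (one_sub_div_pi_pos hγ').ne'
  have h2 : (h : ℂ) / (2 * (1 - γ / π)) * ((-(2 * γ / (π * 1)) : ℝ) : ℂ) =
      h - h / (1 - γ / π) := by
    have : (2 * (1 - γ / π) : ℂ) ≠ 0 := mul_ne_zero two_ne_zero h1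
    have h3 : (h : ℂ) / (1 - γ / π) * (2 * (1 - γ / π)) = 2 * h := by
      rw [mul_comm (2 : ℂ), ← mul_assoc, div_mul_cancel₀ _ h1, mul_comm]
    rw [div_mul_eq_mul_div, div_eq_iff this, sub_mul, h3]
    push_cast
    ring
  rw [h2]
  ring

/-- The dressed energy between its pole and the cut. -/
theorem dressed_add_dressed_eq (hγ : 0 < γ) (hγ' : γ < π / 2) (hQ : 0 ≤ Q)
    (H : IsDressedEnergyAt γ J h Q ε) {z : ℂ} (hz1 : γ / 2 < z.im) (hz2 : z.im < γ) :
    ε z + ε (z - γ * I) =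
      h / (1 - γ / π) + outerPotential γ Q (fun t : ℝ => ε t) (z - γ / 2 * I) := by
  obtain ⟨M, hM⟩ := exists_bound_dressed_real hγ hγ' hQ H
  have hf : Measurable (fun t : ℝ => ε t) := (continuous_dressed_real hγ hγ' hQ H).measurable
  obtain ⟨B₁, hB₁⟩ := exists_bound_outerPotential (Q := Q) hγ hγ' hM
  have hpm := measurable_outerPotential (Q := Q) hγ hγ' hf
  have habs : |z.im| = z.im := abs_of_pos (by linarith)
  have hK := integrable_kernel_of_abs_lt hγ' (y := z.im) (by linarith)
  have hconv : ∀ t : ℝ, (∫ s : ℝ, stripKernel 1 γ (z - t - s) * sechKernel γ s) *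
      outerPotential γ Q (fun t : ℝ => ε t) t =
        stripKernel 1 (γ / 2) (z - t) * outerPotential γ Q (fun t : ℝ => ε t) t -
        sechKernel γ (z - t) * outerPotential γ Q (fun t : ℝ => ε t) t := by
    intro t
    rw [integral_stripKernel_mul_sechKernel hγ hγ' (by simp; linarith)
      (by simp only [sub_im, ofReal_im, sub_zero]; linarith)]
    ring
  -- Since 1/cosh changes sign under the shift by iγ, the terms with `sechKernel` in ε(z - iγ) are
  -- opposite to those in ε(z) and disappear from the sum.
  have hlow : ε (z - γ * I) = h / (2 * (1 - γ / π)) +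
      ((4 * π * J * Real.sin γ : ℝ) : ℂ) * sechKernel γ z -
      ∫ t : ℝ, sechKernel γ (z - t) * outerPotential γ Q (fun t : ℝ => ε t) t := by
    have him : (z - γ * I).im = z.im - γ := by simp
    rw [dressed_eq_dressedSource hγ hγ' hQ H (z := z - γ * I)
      (by rw [him, abs_lt]; constructor <;> linarith), dressedSource,
      sechKernel_sub_period hγ.ne']
    have e : ∀ t : ℝ, sechKernel γ (z - γ * I - t) * outerPotential γ Q (fun t : ℝ => ε t) t =
        -(sechKernel γ (z - t) * outerPotential γ Q (fun t : ℝ => ε t) t) := by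
      intro t
      rw [sub_right_comm, sechKernel_sub_period hγ.ne', neg_mul]
    simp only [e]
    rw [integral_neg]
    ring
  rw [hlow, dressed_equation_outer hγ hγ' hQ H
    (mem_domainUpsilon_of_im hγ hγ' (by linarith) (by linarith))
    (not_mem_barePoles_of_im hγ hγ' (by linarith) (by linarith)) hK,
    integral_kernel_dressedSource hγ hγ' hf hM hK,
    integral_stripKernel_mul_sechKernel hγ hγ' (by linarith) (by linarith),
    integral_stripKernel_of_abs_lt one_pos (by linarith) (by linarith)]
  simp only [hconv]
  rw [integral_sub (integrable_line_mul (integrable_half_kernel_of_lt hγ hz1 (by linarith)) hpm hB₁)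
    (integrable_line_mul (integrable_sechKernel_of_lt hγ hz1 hz2) hpm hB₁),
    half_outerPotential_of_lt hγ hγ' hf hM hz1 (by linarith) hz2.ne]
  have h1 : (1 - γ / π : ℂ) ≠ 0 := by exact_mod_cast (one_sub_div_pi_pos hγ').ne'
  have h2 : (h : ℂ) / (2 * (1 - γ / π)) * ((1 - 2 * γ / (π * 1) : ℝ) : ℂ) =
      h - h / (2 * (1 - γ / π)) := by
    have : (2 * (1 - γ / π) : ℂ) ≠ 0 := mul_ne_zero two_ne_zero h1
    rw [div_mul_eq_mul_div, div_eq_iff this, sub_mul, div_mul_cancel₀ _ this]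
    push_cast
    ring
  have h3 : (h : ℂ) / (1 - γ / π) = h / (2 * (1 - γ / π)) + h / (2 * (1 - γ / π)) := by
    field_simp
    ring
  rw [h2, h3]
  ring

end Dressed

/-! ### Even functions with slope bounded below, and convolution -/

/-- An even function whose slope on the positive half-line is at least `-S`. -/
def EvenSlope (S : ℝ) (φ : ℝ → ℝ) : Prop :=
  (∀ x, φ (-x) = φ x) ∧ ∀ x y, 0 ≤ x → x ≤ y → -(S * (y - x)) ≤ φ y - φ x

theorem EvenSlope.apply_abs {S : ℝ} {φ : ℝ → ℝ} (h : EvenSlope S φ) (x : ℝ) : φ |x| = φ x := by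
  rcases abs_choice x with h' | h' <;> rw [h']
  exact h.1 x

theorem EvenSlope.le_of_abs_le {φ : ℝ → ℝ} (h : EvenSlope 0 φ) {x y : ℝ} (hxy : |x| ≤ |y|) :
    φ x ≤ φ y := by
  have := h.2 |x| |y| (abs_nonneg x) hxy
  rw [h.apply_abs, h.apply_abs] at this
  linarith

theorem EvenSlope.mono {S T : ℝ} {φ : ℝ → ℝ} (h : EvenSlope S φ) (hST : S ≤ T) : EvenSlope T φ :=
  ⟨h.1, fun x y hx hxy => le_trans
    (neg_le_neg (mul_le_mul_of_nonneg_right hST (sub_nonneg.2 hxy))) (h.2 x y hx hxy)⟩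

theorem EvenSlope.zero_of_pow {S : ℝ} {φ : ℝ → ℝ} (h : ∀ n : ℕ, EvenSlope (S * (1 / 2) ^ n) φ) :
    EvenSlope 0 φ := by
  refine ⟨(h 0).1, fun x y hx hxy => ?_⟩
  have hl : Tendsto (fun n : ℕ => -(S * (1 / 2 : ℝ) ^ n * (y - x))) atTop
      (𝓝 (-(S * 0 * (y - x)))) :=
    (((tendsto_pow_atTop_nhds_zero_of_lt_one (by norm_num) (by norm_num)).const_mul S).mul_const
      (y - x)).neg
  have := le_of_tendsto hl (Eventually.of_forall fun n => (h n).2 x y hx hxy)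
  simpa using this

/-- Convolution with an even unimodal kernel. -/
theorem EvenSlope.convolution {S M : ℝ} {k φ : ℝ → ℝ} (hk : Integrable k) (hk0 : ∀ x, 0 ≤ k x)
    (hka : ∀ x y, |x| ≤ |y| → k y ≤ k x) (hS : 0 ≤ S) (hm : Measurable φ)
    (hM : ∀ x, |φ x| ≤ M) (hφ : EvenSlope S φ) :
    EvenSlope (S * ∫ x, k x) (fun x => ∫ t, k (x - t) * φ t) := by
  have hke : ∀ x, k (-x) = k x := fun x =>
    le_antisymm (hka _ _ (abs_neg x).ge) (hka _ _ (abs_neg x).le)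
  have hflip : ∀ x, ∫ t, k (x - t) * φ t = ∫ s, k s * φ (x - s) := by
    intro x
    rw [← integral_sub_left_eq_self (fun s => k s * φ (x - s)) volume x]
    simp only [sub_sub_cancel]
  refine ⟨fun x => ?_, fun x y hx hxy => ?_⟩
  · simp only [hflip]
    rw [← integral_neg_eq_self]
    congr 1
    funext s
    rw [hke, show -x - -s = -(x - s) by ring, hφ.1]
  · set m := (x + y) / 2 with hmd
    set d := (y - x) / 2 with hd
    -- With midpoint m and half-distance d, the increment of the convolution from x to y is ∫ k(m +
    -- u) D(u) du, where D is odd because φ is even.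
    have hd0 : 0 ≤ d := by rw [hd]; linarith
    have hm0 : 0 ≤ m := by rw [hmd]; linarith
    set D : ℝ → ℝ := fun u => φ (d - u) - φ (-d - u) with hD
    have hDm : Measurable D := (hm.comp (measurable_const.sub measurable_id)).sub
      (hm.comp (measurable_const.sub measurable_id))
    have hDb : ∀ u, ‖D u‖ ≤ M + M := fun u =>
      (norm_sub_le _ _).trans (add_le_add (hM _) (hM _))
    have hDodd : ∀ u, D (-u) = -D u := by
      intro u
      simp only [hD]
      rw [← hφ.1 (d - u), ← hφ.1 (-d - u)]
      ring_nf
    have hi : ∀ x, Integrable (fun s => k s * φ (x - s)) := fun x =>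
      hk.mul_bdd (c := M) (hm.comp (measurable_const.sub measurable_id)).aestronglyMeasurable
        (Eventually.of_forall fun s => hM _)
    have hi1 : Integrable (fun u => k (m + u) * D u) :=
      (hk.comp_add_left m).mul_bdd hDm.aestronglyMeasurable (Eventually.of_forall hDb)
    have hi2 : Integrable (fun u => k (m - u) * D u) :=
      (hk.comp_sub_left m).mul_bdd hDm.aestronglyMeasurable (Eventually.of_forall hDb)
    have e1 : (∫ t, k (y - t) * φ t) - ∫ t, k (x - t) * φ t = ∫ u, k (m + u) * D u := by
      rw [hflip, hflip, ← integral_sub (hi y) (hi x),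
        ← integral_add_left_eq_self (fun s => k s * φ (y - s) - k s * φ (x - s)) m]
      congr 1
      funext u
      simp only [hD]
      rw [show y - (m + u) = d - u by rw [hmd, hd]; ring,
        show x - (m + u) = -d - u by rw [hmd, hd]; ring]
      ring
    have e2 : ∫ u, k (m + u) * D u = -∫ u, k (m - u) * D u := by
      rw [← integral_neg_eq_self, ← integral_neg]
      congr 1
      funext u
      rw [hDodd, ← sub_eq_add_neg]
      ring
    -- For u ≥ 0, |d - u| and d + u differ by at most 2d, so D(u) ≤ 2dS. It is multiplied by the
    -- nonpositive number k(m + u) - k(m - u), whose modulus is at most k(m + u) + k(m - u).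
    have key : ∀ u, 0 ≤ u →
        -((k (m + u) + k (m - u)) * (S * (2 * d))) ≤ (k (m + u) - k (m - u)) * D u := by
      intro u hu
      have h1 : k (m + u) ≤ k (m - u) := hka _ _ (by
        rw [abs_of_nonneg (by linarith : 0 ≤ m + u)]
        exact abs_le.2 ⟨by linarith, by linarith⟩)
      have h2 : D u ≤ S * (2 * d) := by
        have h3 : |d - u| ≤ d + u := abs_le.2 ⟨by linarith, by linarith⟩
        have h4 := hφ.2 _ _ (abs_nonneg _) h3
        rw [hφ.apply_abs] at h4
        have h5 : φ (-d - u) = φ (d + u) := by rw [← hφ.1]; ring_nf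
        have h6 : d + u - |d - u| ≤ 2 * d := by
          have := neg_abs_le (d - u)
          have := le_abs_self (u - d)
          rw [abs_sub_comm] at this
          linarith
        simp only [hD, h5]
        nlinarith [mul_le_mul_of_nonneg_left h6 hS]
      have h3 : 0 ≤ S * (2 * d) := by positivity
      nlinarith [hk0 (m + u), hk0 (m - u), mul_nonneg (hk0 (m + u)) h3,
        mul_nonneg (sub_nonneg.2 h1) (sub_nonneg.2 h2)]
    have key' : ∀ u,
        -((k (m + u) + k (m - u)) * (S * (2 * d))) ≤ (k (m + u) - k (m - u)) * D u := by
      intro u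
      rcases le_total 0 u with hu | hu
      · exact key u hu
      · have := key (-u) (by linarith)
        rw [hDodd, sub_neg_eq_add, ← sub_eq_add_neg] at this
        linarith
    -- Symmetrisation in u using that D is odd; integrating the pointwise bound then yields the
    -- factor ∫ k.
    have e3 : 2 * ∫ u, k (m + u) * D u = ∫ u, (k (m + u) - k (m - u)) * D u := by
      simp only [sub_mul]
      rw [integral_sub hi1 hi2, two_mul]
      nth_rewrite 2 [e2]
      ring
    have e4 : ∫ u, -((k (m + u) + k (m - u)) * (S * (2 * d))) =
        -(2 * (∫ u, k u) * (S * (2 * d))) := by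
      rw [integral_neg, integral_mul_const, integral_add (hk.comp_add_left m) (hk.comp_sub_left m),
        integral_add_left_eq_self, integral_sub_left_eq_self]
      ring
    have h5 := integral_mono (((hk.comp_add_left m).add (hk.comp_sub_left m)).mul_const _).neg
      (by simp only [sub_mul]; exact hi1.sub hi2 :
        Integrable (fun u => (k (m + u) - k (m - u)) * D u)) key'
    have h6 : -(2 * (∫ u, k u) * (S * (2 * d))) ≤ 2 * ∫ u, k (m + u) * D u := by
      rw [e3, ← e4]; exact h5
    show -(S * (∫ x, k x) * (y - x)) ≤ (∫ t, k (y - t) * φ t) - ∫ t, k (x - t) * φ t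
    rw [e1]
    have h7 : y - x = 2 * d := by rw [hd]; ring
    rw [h7]
    linarith

/-! ### Real and imaginary part of 1/cosh on horizontal lines -/

section Sech

variable {γ : ℝ}

theorem sechKernel_re_im (γ : ℝ) (z : ℂ) : sechKernel γ z =
    ((2 * γ)⁻¹ * (Real.cosh (π / γ * z.re) * Real.cos (π / γ * z.im) /
      (Real.cosh (π / γ * z.re) ^ 2 - Real.sin (π / γ * z.im) ^ 2)) : ℝ) +
    (-((2 * γ)⁻¹ * (Real.sinh (π / γ * z.re) * Real.sin (π / γ * z.im) /
      (Real.cosh (π / γ * z.re) ^ 2 - Real.sin (π / γ * z.im) ^ 2))) : ℝ) * I := by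
  have e1 : (π * z / γ : ℂ).re = π / γ * z.re := by
    rw [show (π * z / γ : ℂ) = (π / γ : ℝ) * z by push_cast; ring, re_ofReal_mul]
  have e2 : (π * z / γ : ℂ).im = π / γ * z.im := by
    rw [show (π * z / γ : ℂ) = (π / γ : ℝ) * z by push_cast; ring, im_ofReal_mul]
  have e3 : sechKernel γ z = ((2 * γ)⁻¹ : ℝ) * (cosh (π * z / γ))⁻¹ := by
    rw [sechKernel, mul_inv]; push_cast; rfl
  rw [e3]
  apply Complex.ext
  · rw [re_ofReal_mul, inv_re, Complex.normSq_eq_norm_sq, normSq_cosh, XXZ.cosh_re, e1, e2]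
    simp [-ofReal_mul, -ofReal_div, -ofReal_neg]
  · rw [im_ofReal_mul, inv_im, Complex.normSq_eq_norm_sq, normSq_cosh, XXZ.cosh_im, e1, e2]
    simp [-ofReal_mul, -ofReal_div, -ofReal_neg, neg_div]

/-- The real part of the kernel `1 / (2γ cosh (πz / γ))` on a horizontal line. -/
noncomputable def sechRe (γ y x : ℝ) : ℝ := (sechKernel γ (x + y * I)).re

/-- The imaginary part of the kernel `1 / (2γ cosh (πz / γ))` on a horizontal line. -/
noncomputable def sechIm (γ y x : ℝ) : ℝ := (sechKernel γ (x + y * I)).im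

theorem sechRe_eq (γ y x : ℝ) : sechRe γ y x =
    (2 * γ)⁻¹ * (Real.cosh (π / γ * x) * Real.cos (π / γ * y) /
      (Real.cosh (π / γ * x) ^ 2 - Real.sin (π / γ * y) ^ 2)) := by
  rw [sechRe, sechKernel_re_im]
  simp [-ofReal_mul, -ofReal_div, -ofReal_neg]

theorem sechIm_eq (γ y x : ℝ) : sechIm γ y x =
    -((2 * γ)⁻¹ * (Real.sinh (π / γ * x) * Real.sin (π / γ * y) /
      (Real.cosh (π / γ * x) ^ 2 - Real.sin (π / γ * y) ^ 2))) := by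
  rw [sechIm, sechKernel_re_im]
  simp [-ofReal_mul, -ofReal_div, -ofReal_neg]

theorem cos_pi_div_pos (hγ : 0 < γ) {y : ℝ} (hy : |y| < γ / 2) : 0 < Real.cos (π / γ * y) := by
  have h := abs_lt.1 hy
  have hp := Real.pi_pos
  refine Real.cos_pos_of_mem_Ioo ⟨?_, ?_⟩
  · rw [div_mul_eq_mul_div, lt_div_iff₀ hγ]; nlinarith
  · rw [div_mul_eq_mul_div, div_lt_iff₀ hγ]; nlinarith

theorem cosh_sq_sub_pos {x y : ℝ} (hy : 0 < Real.cos y) :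
    0 < Real.cosh x ^ 2 - Real.sin y ^ 2 := by
  nlinarith [Real.one_le_cosh x, Real.sin_sq_add_cos_sq y, pow_pos hy 2]

theorem sechRe_pos (hγ : 0 < γ) {y : ℝ} (hy : |y| < γ / 2) (x : ℝ) : 0 < sechRe γ y x := by
  rw [sechRe_eq]
  have h1 := cos_pi_div_pos hγ hy
  exact mul_pos (by positivity) (div_pos (mul_pos (Real.cosh_pos _) h1) (cosh_sq_sub_pos h1))

theorem sechRe_neg (γ y x : ℝ) : sechRe γ y (-x) = sechRe γ y x := by
  rw [sechRe_eq, sechRe_eq, mul_neg, Real.cosh_neg]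

theorem sechIm_neg (γ y x : ℝ) : sechIm γ y (-x) = -sechIm γ y x := by
  rw [sechIm_eq, sechIm_eq, mul_neg, Real.sinh_neg, Real.cosh_neg]
  ring

theorem sechIm_nonpos (hγ : 0 < γ) {y : ℝ} (hy0 : 0 ≤ y) (hy : y < γ / 2) {x : ℝ} (hx : 0 ≤ x) :
    sechIm γ y x ≤ 0 := by
  rw [sechIm_eq, neg_nonpos]
  have hy' : |y| < γ / 2 := by rwa [abs_of_nonneg hy0]
  have hs : 0 ≤ Real.sin (π / γ * y) := by
    refine Real.sin_nonneg_of_nonneg_of_le_pi (by positivity) ?_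
    rw [div_mul_eq_mul_div, div_le_iff₀ hγ]
    nlinarith [Real.pi_pos]
  have hd := (cosh_sq_sub_pos (x := π / γ * x) (cos_pi_div_pos hγ hy')).le
  have h2 : 0 ≤ Real.sinh (π / γ * x) := Real.sinh_nonneg_iff.2 (by positivity)
  positivity

theorem sechRe_lt (hγ : 0 < γ) {y : ℝ} (hy : |y| < γ / 2) {x₁ x₂ : ℝ} (h : |x₁| < |x₂|) :
    sechRe γ y x₂ < sechRe γ y x₁ := by
  rw [sechRe_eq, sechRe_eq]
  have h1 := cos_pi_div_pos hγ hy
  refine mul_lt_mul_of_pos_left ?_ (by positivity)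
  rw [div_lt_div_iff₀ (cosh_sq_sub_pos h1) (cosh_sq_sub_pos h1)]
  have h2 : Real.cosh (π / γ * x₁) < Real.cosh (π / γ * x₂) := by
    rw [Real.cosh_lt_cosh, abs_mul, abs_mul]
    have : 0 < |π / γ| := abs_pos.2 (div_pos Real.pi_pos hγ).ne'
    gcongr
  have h3 := Real.cosh_pos (π / γ * x₁)
  -- With c = cosh and s = sin, the function c/(c² - s²) decreases in c: cross-multiplication leaves
  -- (c₂ - c₁)(c₁c₂ + s²) > 0.
  have h4 : 0 < (Real.cosh (π / γ * x₂) - Real.cosh (π / γ * x₁)) *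
      (Real.cosh (π / γ * x₁) * Real.cosh (π / γ * x₂) + Real.sin (π / γ * y) ^ 2) *
      Real.cos (π / γ * y) :=
    mul_pos (mul_pos (by linarith) (by positivity)) h1
  nlinarith

theorem sechRe_le (hγ : 0 < γ) {y : ℝ} (hy : |y| < γ / 2) {x₁ x₂ : ℝ} (h : |x₁| ≤ |x₂|) :
    sechRe γ y x₂ ≤ sechRe γ y x₁ := by
  rcases h.lt_or_eq with h | h
  · exact (sechRe_lt hγ hy h).le
  · rcases abs_eq_abs.1 h with h | h <;> rw [h]
    rw [sechRe_neg]

theorem integrable_sechRe (hγ : 0 < γ) {y : ℝ} (hy : |y| < γ / 2) : Integrable (sechRe γ y) :=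
  (integrable_sechKernel_of_abs_lt hγ hy).re

theorem integrable_sechIm (hγ : 0 < γ) {y : ℝ} (hy : |y| < γ / 2) : Integrable (sechIm γ y) :=
  (integrable_sechKernel_of_abs_lt hγ hy).im

theorem integral_sechKernel_real (hγ : 0 < γ) : ∫ x : ℝ, sechKernel γ x = (1 / 2 : ℝ) := by
  have e : ∀ x : ℝ, sechKernel γ x = (((2 * γ)⁻¹ * (Real.cosh (π / γ * x))⁻¹ : ℝ) : ℂ) := by
    intro x
    rw [sechKernel, mul_inv, show (π * x / γ : ℂ) = ((π / γ * x : ℝ) : ℂ) by push_cast; ring]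
    push_cast
    rfl
  simp only [e]
  rw [integral_complex_ofReal, integral_const_mul,
    Measure.integral_comp_mul_left (fun x => (Real.cosh x)⁻¹), integral_sech]
  congr 1
  have hp := Real.pi_pos
  rw [abs_of_pos (by positivity)]
  field_simp
  simp

/-- The nearest poles are at ±iγ/2, so the mass 1/2 is unchanged when the line moves up to any
height below γ/2. -/
theorem integral_sechKernel_of_nonneg (hγ : 0 < γ) {y : ℝ} (hy0 : 0 ≤ y) (hy : y < γ / 2) :
    ∫ x : ℝ, sechKernel γ (x + y * I) = (1 / 2 : ℝ) := by
  have hy' : |y| < γ / 2 := by rwa [abs_of_nonneg hy0]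
  have hpg : 0 < π / γ := div_pos Real.pi_pos hγ
  have hb : Tendsto (fun x : ℝ => 1 / (2 * γ) * (Real.sinh (π / γ * x))⁻¹) atTop (𝓝 0) := by
    have := (tendsto_inv_sinh hpg 0).const_mul (1 / (2 * γ))
    simpa using this
  have i0 : Integrable (fun x : ℝ => sechKernel γ (x + (0 : ℝ) * I)) :=
    integrable_sechKernel_of_abs_lt hγ (y := 0) (by simpa using hγ)
  have i1 := integrable_sechKernel_of_abs_lt hγ hy'
  have key := integral_line_sub_line (H := sechKernel γ) (c₁ := 0) (c₂ := y) (p := 0) (m := 0)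
    hy0 (fun s hs => ?_) hb ?_ ?_ (i0.sub i1)
  · rw [integral_sub i0 i1, sub_zero, mul_zero, sub_eq_zero] at key
    rw [← key, ← integral_sechKernel_real hγ]
    simp
  · have hs : 0 ≤ s.im ∧ s.im ≤ y := hs
    refine (differentiableAt_sechKernel hγ.ne' (cosh_ne_zero_of_cos ?_)).differentiableWithinAt
    rw [show (π * s / γ : ℂ) = (π / γ : ℝ) * s by push_cast; ring, im_ofReal_mul]
    exact (cos_pi_div_pos hγ (by rw [abs_of_nonneg hs.1]; linarith)).ne'
  · filter_upwards [eventually_gt_atTop 0] with x hx t _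
    have := norm_sechKernel_le' hγ (z := x + t * I) (by simpa using hx.ne')
    simpa [abs_of_pos hx] using this
  · filter_upwards [eventually_gt_atTop 0] with x hx t _
    have := norm_sechKernel_le' hγ (z := ((-x : ℝ) : ℂ) + t * I) (by simpa using hx.ne')
    simpa [abs_of_pos hx] using this

theorem integral_sechRe (hγ : 0 < γ) {y : ℝ} (hy : |y| < γ / 2) :
    ∫ x, sechRe γ y x = 1 / 2 := by
  have h1 : ∫ x, sechRe γ |y| x = 1 / 2 := by
    have := integral_sechKernel_of_nonneg hγ (abs_nonneg y) hy
    have h2 := integral_re (integrable_sechKernel_of_abs_lt hγ (y := |y|) (by rwa [abs_abs]))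
    simp only [RCLike.re_to_complex] at h2
    rw [this, ofReal_re] at h2
    exact h2
  rw [← h1]
  congr 1
  funext x
  rcases abs_choice y with h | h <;> rw [h]
  simp only [sechRe_eq, mul_neg, Real.cos_neg, Real.sin_neg, neg_sq]

theorem sechRe_antitone_deriv (hγ : 0 < γ) {y : ℝ} (hy : |y| < γ / 2) {x : ℝ} (hx : 0 < x) :
    ∃ d, d < 0 ∧ HasDerivAt (sechRe γ y) d x := by
  have h1 := cos_pi_div_pos hγ hy
  have h2 := cosh_sq_sub_pos (x := π / γ * x) h1
  have hpg : 0 < π / γ := div_pos Real.pi_pos hγ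
  have hs : 0 < Real.sinh (π / γ * x) := Real.sinh_pos_iff.2 (by positivity)
  have hc : HasDerivAt (fun x => Real.cosh (π / γ * x)) (Real.sinh (π / γ * x) * (π / γ)) x := by
    have := (hasDerivAt_id x).const_mul (π / γ)
    simpa using this.cosh
  have hd := (((hc.mul_const (Real.cos (π / γ * y))).div
    ((hc.pow 2).sub_const (Real.sin (π / γ * y) ^ 2)) h2.ne').const_mul (2 * γ)⁻¹)
  have hf : sechRe γ y = fun x => (2 * γ)⁻¹ * (Real.cosh (π / γ * x) * Real.cos (π / γ * y) /
      (Real.cosh (π / γ * x) ^ 2 - Real.sin (π / γ * y) ^ 2)) := funext fun x => sechRe_eq γ y x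
  rw [hf]
  refine ⟨_, ?_, hd⟩
  refine mul_neg_of_pos_of_neg (by positivity) (div_neg_of_neg_of_pos ?_ (by positivity))
  have h3 : 0 < Real.sinh (π / γ * x) * (π / γ) * Real.cos (π / γ * y) *
      (Real.cosh (π / γ * x) ^ 2 + Real.sin (π / γ * y) ^ 2) :=
    mul_pos (by positivity) (add_pos_of_pos_of_nonneg (pow_pos (Real.cosh_pos _) 2) (sq_nonneg _))
  simp only [Nat.cast_ofNat, Nat.add_one_sub_one, pow_one, Pi.pow_apply]
  nlinarith [h3]

end Sech

/-! ### Monotonicity of the dressed energy on the real axis -/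

section Dressed

variable {γ J h Q : ℝ} {ε : ℂ → ℂ}

theorem two_mul_half_div_mem (hγ : 0 < γ) (hγ' : γ < π / 2) :
    0 < 2 * (γ / 2) / (1 - γ / π) ∧ 2 * (γ / 2) / (1 - γ / π) < π := by
  have ha0 := one_sub_div_pi_pos hγ'
  refine ⟨by positivity, ?_⟩
  rw [div_lt_iff₀ ha0, pi_mul_one_sub]
  linarith

theorem stripKernel_real_outer (hγ : 0 < γ) (hγ' : γ < π / 2) (x : ℝ) :
    stripKernel (1 - γ / π) (γ / 2) x = realKernel (1 - γ / π) (γ / 2) x :=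
  stripKernel_ofReal
    (sin_half_div_pos hγ hγ' (pi_mul_one_sub γ) (one_sub_div_pi_pos hγ')).ne' x

theorem realKernel_outer_pos (hγ : 0 < γ) (hγ' : γ < π / 2) (x : ℝ) :
    0 < realKernel (1 - γ / π) (γ / 2) x :=
  realKernel_pos (one_sub_div_pi_pos hγ') (two_mul_half_div_mem hγ hγ').1
    (two_mul_half_div_mem hγ hγ').2 x

theorem integrable_realKernel_outer (hγ : 0 < γ) (hγ' : γ < π / 2) :
    Integrable (realKernel (1 - γ / π) (γ / 2)) := by
  have := integrable_stripKernel_real hγ hγ' (pi_mul_one_sub γ) (one_sub_div_pi_pos hγ')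
  simp only [stripKernel_real_outer hγ hγ'] at this
  simpa using this.re

theorem integral_realKernel_outer (hγ : 0 < γ) (hγ' : γ < π / 2) :
    ∫ x : ℝ, realKernel (1 - γ / π) (γ / 2) x = 1 - γ / (π - γ) := by
  have := integral_stripKernel_of_abs_lt (b := 1 - γ / π) (θ := γ / 2) (y := 0)
    (one_sub_div_pi_pos hγ') (by simpa using hγ) (by rw [pi_mul_one_sub]; simp; linarith)
  simp only [ofReal_zero, zero_mul, add_zero, stripKernel_real_outer hγ hγ',
    integral_complex_ofReal, pi_mul_one_sub] at this
  rw [show 2 * (γ / 2) = γ by ring] at this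
  exact_mod_cast this

theorem dressed_ofReal (hγ : 0 < γ) (hγ' : γ < π / 2) (hQ : 0 ≤ Q)
    (H : IsDressedEnergyAt γ J h Q ε) (x : ℝ) : ε x = ((ε x).re : ℂ) := by
  have hx := ofReal_mem_domain (Q := Q) hγ hγ' x
  have := dressed_conj hγ hγ' hQ H hx.1 hx.2
  rw [conj_ofReal] at this
  exact (conj_eq_iff_re.1 this.symm).symm

theorem dressed_re_neg (hγ : 0 < γ) (hγ' : γ < π / 2) (hQ : 0 ≤ Q)
    (H : IsDressedEnergyAt γ J h Q ε) (x : ℝ) :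
    (ε ((-x : ℝ) : ℂ)).re = (ε x).re := by
  have hx := ofReal_mem_domain (Q := Q) hγ hγ' x
  rw [ofReal_neg, dressed_neg hγ hγ' hQ H hx.1 hx.2]

/-- The real dressed energy outside the Fermi zone. -/
noncomputable def outerRe (Q : ℝ) (e : ℝ → ℝ) : ℝ → ℝ := indicator (Icc (-Q) Q)ᶜ e

/-- The convolution of the outer part of `e` with the kernel of period `π - γ`. -/
noncomputable def potential (γ Q : ℝ) (e : ℝ → ℝ) (t : ℝ) : ℝ :=
  ∫ μ : ℝ, realKernel (1 - γ / π) (γ / 2) (t - μ) * outerRe Q e μ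

theorem outer_ofReal (Q : ℝ) (e : ℝ → ℝ) (μ : ℝ) :
    outer Q (fun t => (e t : ℂ)) μ = (outerRe Q e μ : ℂ) := by
  by_cases hμ : μ ∈ (Icc (-Q) Q)ᶜ
  · rw [outer, outerRe, indicator_of_mem hμ, indicator_of_mem hμ]
  · rw [outer, outerRe, indicator_of_notMem hμ, indicator_of_notMem hμ, ofReal_zero]

theorem outerPotential_ofReal (hγ : 0 < γ) (hγ' : γ < π / 2) (e : ℝ → ℝ) (t : ℝ) :
    outerPotential γ Q (fun t => (e t : ℂ)) t = (potential γ Q e t : ℂ) := by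
  rw [outerPotential, potential, ← integral_complex_ofReal]
  congr 1
  funext μ
  rw [outer_ofReal, ← ofReal_sub, stripKernel_real_outer hγ hγ', ofReal_mul]

theorem outerPotential_dressed (hγ : 0 < γ) (hγ' : γ < π / 2) (hQ : 0 ≤ Q)
    (H : IsDressedEnergyAt γ J h Q ε) (t : ℝ) :
    outerPotential γ Q (fun t : ℝ => ε t) t = (potential γ Q (fun t : ℝ => (ε t).re) t : ℂ) := by
  rw [← outerPotential_ofReal hγ hγ']
  congr 1
  funext x
  exact dressed_ofReal hγ hγ' hQ H x

theorem measurable_outerRe {e : ℝ → ℝ} (he : Measurable e) : Measurable (outerRe Q e) :=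
  he.indicator measurableSet_Icc.compl

theorem abs_outerRe_le {e : ℝ → ℝ} {M : ℝ} (hM : ∀ x, |e x| ≤ M) (x : ℝ) : |outerRe Q e x| ≤ M :=
  (norm_indicator_le_norm_self e x).trans (hM x)

theorem continuous_dressed_re (hγ : 0 < γ) (hγ' : γ < π / 2) (hQ : 0 ≤ Q)
    (H : IsDressedEnergyAt γ J h Q ε) : Continuous (fun x : ℝ => (ε x).re) :=
  continuous_re.comp (continuous_dressed_real hγ hγ' hQ H)

theorem exists_bound_dressed_re (hγ : 0 < γ) (hγ' : γ < π / 2) (hQ : 0 ≤ Q)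
    (H : IsDressedEnergyAt γ J h Q ε) : ∃ M, ∀ x : ℝ, |(ε x).re| ≤ M := by
  obtain ⟨M, hM⟩ := exists_bound_dressed_real hγ hγ' hQ H
  exact ⟨M, fun x => (abs_re_le_norm _).trans (hM x)⟩

theorem measurable_potential (hγ : 0 < γ) (hγ' : γ < π / 2) {e : ℝ → ℝ} (he : Measurable e) :
    Measurable (potential γ Q e) := by
  have := measurable_outerPotential (Q := Q) hγ hγ' (f := fun t => (e t : ℂ))
    (measurable_ofReal.comp he)
  simp only [outerPotential_ofReal hγ hγ'] at this
  have h2 := measurable_re.comp this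
  exact h2

theorem exists_bound_potential (hγ : 0 < γ) (hγ' : γ < π / 2) {e : ℝ → ℝ} {M : ℝ}
    (hM : ∀ x, |e x| ≤ M) : ∃ B, ∀ t, |potential γ Q e t| ≤ B := by
  obtain ⟨B, hB⟩ := exists_bound_outerPotential (Q := Q) hγ hγ' (f := fun t => (e t : ℂ)) (M := M)
    (fun x => by simpa using hM x)
  refine ⟨B, fun t => ?_⟩
  have := hB t
  rwa [outerPotential_ofReal hγ hγ', norm_real] at this

theorem dressed_line (hγ : 0 < γ) (hγ' : γ < π / 2) (hQ : 0 ≤ Q)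
    (H : IsDressedEnergyAt γ J h Q ε) {y : ℝ} (hy : |y| < γ / 2) (x : ℝ) :
    (ε (x + y * I)).re = h / (2 * (1 - γ / π)) - 4 * π * J * Real.sin γ * sechRe γ y x +
      ∫ t, sechRe γ y (x - t) * potential γ Q (fun t : ℝ => (ε t).re) t ∧
    (ε (x + y * I)).im = -(4 * π * J * Real.sin γ * sechIm γ y x) +
      ∫ t, sechIm γ y (x - t) * potential γ Q (fun t : ℝ => (ε t).re) t := by
  obtain ⟨M, hM⟩ := exists_bound_dressed_real hγ hγ' hQ H
  obtain ⟨B, hB⟩ := exists_bound_outerPotential (Q := Q) hγ hγ' hM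
  have hpm := measurable_outerPotential (Q := Q) hγ hγ'
    (continuous_dressed_real hγ hγ' hQ H).measurable
  have hi := integrable_line_mul (F := sechKernel γ) (z := x + y * I)
    (by simpa using integrable_sechKernel_of_abs_lt hγ hy) hpm hB
  rw [dressed_eq_dressedSource hγ hγ' hQ H (by simpa using hy), dressedSource]
  have hre := integral_re hi
  have him := integral_im hi
  simp only [RCLike.re_to_complex, RCLike.im_to_complex] at hre him
  have e1 : ∀ t : ℝ, (x + y * I - t : ℂ) = ((x - t : ℝ) : ℂ) + y * I := fun t => by
    push_cast; ring
  have e2 : (h / (2 * (1 - γ / π)) : ℂ) = ((h / (2 * (1 - γ / π)) : ℝ) : ℂ) := by push_cast; rfl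
  rw [add_re, add_im, sub_re, sub_im, re_ofReal_mul, im_ofReal_mul, ← hre, ← him, e2]
  simp only [outerPotential_dressed hγ hγ' hQ H, e1, re_mul_ofReal, im_mul_ofReal, ofReal_re,
    ofReal_im]
  refine ⟨rfl, ?_⟩
  rw [zero_sub]
  rfl

theorem hasDerivAt_realKernel {b θ : ℝ} (h1 : 0 < 2 * θ / b) (h2 : 2 * θ / b < π) (x : ℝ) :
    HasDerivAt (realKernel b θ) (Real.sin (2 * θ / b) / (π * b) *
      (-(Real.sinh (2 * x / b) * (2 / b)) /
        (Real.cosh (2 * x / b) - Real.cos (2 * θ / b)) ^ 2)) x := by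
  have hc : HasDerivAt (fun x => Real.cosh (2 * x / b)) (Real.sinh (2 * x / b) * (2 / b)) x := by
    have := ((hasDerivAt_id x).const_mul 2).div_const b
    simpa using this.cosh
  have := ((hc.sub_const (Real.cos (2 * θ / b))).fun_inv (cos_lt_cosh h1 h2 _).ne').const_mul
    (Real.sin (2 * θ / b) / (π * b))
  exact this

theorem exists_lipschitz_realKernel {b θ : ℝ} (hb : 0 < b) (h1 : 0 < 2 * θ / b)
    (h2 : 2 * θ / b < π) :
    ∃ L, 0 ≤ L ∧ ∀ x y, |realKernel b θ y - realKernel b θ x| ≤ L * |y - x| := by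
  have hs := Real.sin_pos_of_pos_of_lt_pi h1 h2
  set p := 1 - Real.cos (2 * θ / b) with hp
  have hp0 : 0 < p := by have := cos_lt_cosh h1 h2 0; rwa [Real.cosh_zero] at this
  have hpi := Real.pi_pos
  refine ⟨Real.sin (2 * θ / b) / (π * b) * ((2 / b) * ((1 + p⁻¹) * p⁻¹)), by positivity,
    fun x y => ?_⟩
  refine Convex.norm_image_sub_le_of_norm_hasDerivWithin_le (s := univ)
    (fun x _ => (hasDerivAt_realKernel h1 h2 x).hasDerivWithinAt) (fun x _ => ?_) convex_univ
    (mem_univ _) (mem_univ _)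
  have hc := cos_lt_cosh h1 h2 (2 * x / b)
  rw [norm_mul, Real.norm_of_nonneg (by positivity)]
  refine mul_le_mul_of_nonneg_left ?_ (by positivity)
  rw [norm_div, norm_neg, norm_mul, Real.norm_of_nonneg (by positivity : 0 ≤ 2 / b),
    Real.norm_of_nonneg (by positivity : 0 ≤ (Real.cosh (2 * x / b) - Real.cos (2 * θ / b)) ^ 2),
    div_le_iff₀ (by positivity), Real.norm_eq_abs, mul_comm, mul_assoc]
  refine mul_le_mul_of_nonneg_left ?_ (by positivity)
  set w := Real.cosh (2 * x / b) - 1 with hw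
  have hw0 : 0 ≤ w := by have := Real.one_le_cosh (2 * x / b); linarith
  have e : Real.cosh (2 * x / b) - Real.cos (2 * θ / b) = w + p := by rw [hw, hp]; ring
  rw [e]
  have h3 : |Real.sinh (2 * x / b)| ≤ w + 1 := by
    rw [hw, sub_add_cancel, Real.abs_sinh, ← Real.cosh_abs (2 * x / b)]
    exact (Real.sinh_lt_cosh _).le
  refine h3.trans ?_
  -- The constant is crude and chosen so that the difference of the two sides is a sum of
  -- nonnegative terms in w ≥ 0 and p > 0; only its finiteness matters.
  have h4 : (1 + p⁻¹) * p⁻¹ * (w + p) ^ 2 - (w + 1) =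
      p⁻¹ * w ^ 2 + w + p + p⁻¹ ^ 2 * w ^ 2 + 2 * p⁻¹ * w := by
    field_simp
    ring
  have h5 : 0 ≤ p⁻¹ * w ^ 2 + w + p + p⁻¹ ^ 2 * w ^ 2 + 2 * p⁻¹ * w := by positivity
  linarith

/-- A first crude lower bound for the slope of the dressed energy. -/
theorem exists_evenSlope_dressed (hγ : 0 < γ) (hγ' : γ < π / 2) (hJ : 0 < J) (hQ : 0 ≤ Q)
    (H : IsDressedEnergyAt γ J h Q ε) :
    ∃ S, 0 ≤ S ∧ EvenSlope S (fun x : ℝ => (ε x).re) := by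
  obtain ⟨M, hM⟩ := exists_bound_dressed_re hγ hγ' hQ H
  have hM0 : 0 ≤ M := (abs_nonneg _).trans (hM 0)
  obtain ⟨L, hL0, hL⟩ := exists_lipschitz_realKernel (b := 1) (θ := γ) one_pos (by linarith)
    (by linarith)
  have hcont := continuous_dressed_re hγ hγ' hQ H
  have hKc : Continuous (realKernel 1 γ) := continuous_iff_continuousAt.2 fun x =>
    (hasDerivAt_realKernel (by linarith) (by linarith) x).continuousAt
  refine ⟨L * M * (2 * Q), by positivity, dressed_re_neg hγ hγ' hQ H, fun x y hx hxy => ?_⟩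
  have hsin : 0 < Real.sin γ := Real.sin_pos_of_pos_of_lt_pi hγ (by linarith)
  have e : ∀ x : ℝ, (ε x).re = h - 4 * π * J * Real.sin γ * realKernel 1 (γ / 2) x -
      ∫ μ in (-Q)..Q, realKernel 1 γ (x - μ) * (ε μ).re := by
    intro x
    have e1 : (∫ μ in (-Q)..Q, stripKernel 1 γ ((x : ℂ) - μ) * ε μ) =
        ((∫ μ in (-Q)..Q, realKernel 1 γ (x - μ) * (ε μ).re : ℝ) : ℂ) := by
      rw [← intervalIntegral.integral_ofReal]
      congr 1
      funext μ
      rw [dressed_ofReal hγ hγ' hQ H μ, ← ofReal_sub, stripKernel_real_one hγ hγ', ofReal_mul,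
        ofReal_re]
    have := dressed_equation_real hγ hγ' H x
    have hs : Real.sin (γ / 2 / 1) ≠ 0 := by
      rw [div_one]
      exact sin_ne_zero_of_Ioo (by linarith) (by linarith)
    rw [e1, stripKernel_ofReal hs, ← ofReal_mul, ← ofReal_sub, ← ofReal_sub] at this
    rw [this, ofReal_re]
  have hi : ∀ x : ℝ, IntervalIntegrable (fun μ => realKernel 1 γ (x - μ) * (ε μ).re) volume
      (-Q) Q := fun x =>
    ((hKc.comp (continuous_const.sub continuous_id)).mul hcont).intervalIntegrable _ _
  have h1 : realKernel 1 (γ / 2) y ≤ realKernel 1 (γ / 2) x :=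
    realKernel_anti one_pos (by linarith) (by linarith)
      (by rwa [abs_of_nonneg hx, abs_of_nonneg (hx.trans hxy)])
  have h2 : |(∫ μ in (-Q)..Q, realKernel 1 γ (y - μ) * (ε μ).re) -
      ∫ μ in (-Q)..Q, realKernel 1 γ (x - μ) * (ε μ).re| ≤ L * (y - x) * M * |Q - -Q| := by
    rw [← intervalIntegral.integral_sub (hi y) (hi x)]
    rw [← Real.norm_eq_abs]
    refine intervalIntegral.norm_integral_le_of_norm_le_const fun μ _ => ?_
    rw [← sub_mul, norm_mul]
    refine mul_le_mul ?_ (hM μ) (norm_nonneg _) (mul_nonneg hL0 (by linarith))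
    have := hL (x - μ) (y - μ)
    rwa [sub_sub_sub_cancel_right, abs_of_nonneg (by linarith : 0 ≤ y - x)] at this
  rw [abs_of_nonneg (by linarith : 0 ≤ Q - -Q)] at h2
  have h3 := (abs_le.1 h2).2
  have h4 : 0 ≤ 4 * π * J * Real.sin γ * (realKernel 1 (γ / 2) x - realKernel 1 (γ / 2) y) :=
    mul_nonneg (by have := Real.pi_pos; positivity) (by linarith)
  have ex := e x
  have ey := e y
  beta_reduce
  nlinarith

/-- A cut-off at ±Q would in general create a jump. The Fermi condition e(Q) = 0 excludes it, and on
the removed interval the function is replaced by the constant 0. -/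
theorem EvenSlope.outerRe {S : ℝ} {e : ℝ → ℝ} (hQ : 0 ≤ Q) (hS : 0 ≤ S) (h : EvenSlope S e)
    (h0 : e Q = 0) : EvenSlope S (outerRe Q e) := by
  have hin : ∀ x, 0 ≤ x → x ≤ Q → XXZ.outerRe Q e x = 0 := fun x hx hxQ =>
    indicator_of_notMem (by simpa using ⟨by linarith, hxQ⟩) e
  have hout : ∀ x, Q ≤ x → XXZ.outerRe Q e x = e x := by
    intro x hx
    rcases hx.eq_or_lt with rfl | hx
    · rw [hin _ hQ le_rfl, h0]
    · exact indicator_of_mem (by simp [hx]) e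
  refine ⟨fun x => ?_, fun x y hx hxy => ?_⟩
  · by_cases hx : x ∈ (Icc (-Q) Q)ᶜ
    · have hx' : -x ∈ (Icc (-Q) Q)ᶜ := fun h' => hx ⟨by linarith [h'.2], by linarith [h'.1]⟩
      rw [XXZ.outerRe, indicator_of_mem hx, indicator_of_mem hx', h.1]
    · have hx' : -x ∉ (Icc (-Q) Q)ᶜ := by
        rw [notMem_compl_iff] at hx ⊢
        exact ⟨by linarith [hx.2], by linarith [hx.1]⟩
      rw [XXZ.outerRe, indicator_of_notMem hx, indicator_of_notMem hx']
  · rcases le_total y Q with hy | hy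
    · rw [hin y (hx.trans hxy) hy, hin x hx (hxy.trans hy)]
      nlinarith
    · rcases le_total x Q with hx' | hx'
      · rw [hin x hx hx', hout y hy]
        have := h.2 Q y hQ hy
        rw [h0] at this
        nlinarith
      · rw [hout y hy, hout x hx']
        exact h.2 x y hx hxy

/-- The kernel has mass 1 - γ/(π - γ) ≤ 1, so nothing is lost in the slope bound. -/
theorem EvenSlope.potential {S M : ℝ} {e : ℝ → ℝ} (hγ : 0 < γ) (hγ' : γ < π / 2) (hQ : 0 ≤ Q)
    (hS : 0 ≤ S) (he : Measurable e) (hM : ∀ x, |e x| ≤ M) (h : EvenSlope S e) (h0 : e Q = 0) :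
    EvenSlope S (potential γ Q e) := by
  have h2 := two_mul_half_div_mem hγ hγ'
  have := (h.outerRe hQ hS h0).convolution (integrable_realKernel_outer hγ hγ')
    (fun x => (realKernel_outer_pos hγ hγ' x).le)
    (fun x y => realKernel_anti (one_sub_div_pi_pos hγ') h2.1 h2.2) hS (measurable_outerRe he)
    (abs_outerRe_le hM)
  rw [integral_realKernel_outer hγ hγ'] at this
  refine EvenSlope.mono this (mul_le_of_le_one_right hS ?_)
  have : 0 < γ / (π - γ) := div_pos hγ (by linarith)
  linarith

/-- The mass 1/2 halves the possible negative slope; this is the gain in the bootstrap. -/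
theorem EvenSlope.sech_convolution {S M y : ℝ} {g : ℝ → ℝ} (hγ : 0 < γ) (hy : |y| < γ / 2)
    (hS : 0 ≤ S) (hg : Measurable g) (hM : ∀ x, |g x| ≤ M) (h : EvenSlope S g) :
    EvenSlope (S * (1 / 2)) (fun x => ∫ t, sechRe γ y (x - t) * g t) := by
  rw [← integral_sechRe hγ hy]
  exact h.convolution (integrable_sechRe hγ hy) (fun x => (sechRe_pos hγ hy x).le)
    (fun x y' => sechRe_le hγ hy) hS hg hM

/-- The dressed energy is even and monotone on the real half-line. -/
theorem evenSlope_dressed (hγ : 0 < γ) (hγ' : γ < π / 2) (hJ : 0 < J)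
    (H : IsDressedEnergy γ J h Q ε) : EvenSlope 0 (fun x : ℝ => (ε x).re) := by
  have hQ := H.pos.le
  obtain ⟨S, hS, hS'⟩ := exists_evenSlope_dressed hγ hγ' hJ hQ H.dressed
  obtain ⟨M, hM⟩ := exists_bound_dressed_re hγ hγ' hQ H.dressed
  have hem := (continuous_dressed_re hγ hγ' hQ H.dressed).measurable
  obtain ⟨B, hB⟩ := exists_bound_potential (Q := Q) hγ hγ' hM
  have hpm := measurable_potential (Q := Q) hγ hγ' hem
  have h0 : |(0 : ℝ)| < γ / 2 := by simpa using hγ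
  have hsin : 0 < Real.sin γ := Real.sin_pos_of_pos_of_lt_pi hγ (by linarith)
  -- Each passage through the inverted equation halves the slope defect, because the driving term
  -- -`sechRe` is itself increasing on the half-line.
  refine EvenSlope.zero_of_pow (S := S) fun n => ?_
  induction n with
  | zero => simpa using hS'
  | succ n ih =>
    have hSn : 0 ≤ S * (1 / 2) ^ n := by positivity
    have h1 := (ih.potential hγ hγ' hQ hSn hem hM (by simp [H.fermi])).sech_convolution hγ h0 hSn
      hpm hB
    refine ⟨ih.1, fun x y hx hxy => ?_⟩
    have h2 := h1.2 x y hx hxy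
    have h3 : sechRe γ 0 y ≤ sechRe γ 0 x :=
      sechRe_le hγ h0 (by rwa [abs_of_nonneg hx, abs_of_nonneg (hx.trans hxy)])
    have h4 : 0 ≤ 4 * π * J * Real.sin γ * (sechRe γ 0 x - sechRe γ 0 y) :=
      mul_nonneg (by have := Real.pi_pos; positivity) (by linarith)
    have ex := (dressed_line hγ hγ' hQ H.dressed h0 x).1
    have ey := (dressed_line hγ hγ' hQ H.dressed h0 y).1
    simp only [ofReal_zero, zero_mul, add_zero] at ex ey
    rw [pow_succ, ← mul_assoc]
    simp only [ex, ey]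
    linarith

end Dressed

/-! ### Signs and monotonicity in the strip |Im z| < γ/2 -/

/-- Convolution with an odd kernel of one sign. -/
theorem EvenSlope.odd_convolution_nonneg {M : ℝ} {k φ : ℝ → ℝ} (hk : Integrable k)
    (hko : ∀ x, k (-x) = -k x) (hk0 : ∀ x, 0 ≤ x → k x ≤ 0) (hm : Measurable φ)
    (hM : ∀ x, |φ x| ≤ M) (hφ : EvenSlope 0 φ) {x : ℝ} (hx : 0 ≤ x) :
    0 ≤ ∫ t, k (x - t) * φ t := by
  have e0 : ∫ t, k (x - t) * φ t = ∫ s, k s * φ (x - s) := by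
    rw [← integral_sub_left_eq_self (fun s => k s * φ (x - s)) volume x]
    simp only [sub_sub_cancel]
  -- Oddness of k makes the convolution half the integral of k(s)(φ(x - s) - φ(x + s)), whose
  -- integrand is nonnegative.
  have e1 : ∫ s, k s * φ (x - s) = -∫ s, k s * φ (x + s) := by
    rw [← integral_neg_eq_self, ← integral_neg]
    congr 1
    funext s
    rw [hko, sub_neg_eq_add, neg_mul]
  have hi1 : Integrable (fun s => k s * φ (x - s)) :=
    hk.mul_bdd (c := M) (hm.comp (measurable_const.sub measurable_id)).aestronglyMeasurable
      (Eventually.of_forall fun s => hM _)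
  have hi2 : Integrable (fun s => k s * φ (x + s)) :=
    hk.mul_bdd (c := M) (hm.comp (measurable_const.add measurable_id)).aestronglyMeasurable
      (Eventually.of_forall fun s => hM _)
  have key : ∀ s, 0 ≤ s → 0 ≤ k s * φ (x - s) - k s * φ (x + s) := by
    intro s hs
    have h1 : φ (x - s) ≤ φ (x + s) := hφ.le_of_abs_le (by
      rw [abs_of_nonneg (by linarith : 0 ≤ x + s)]
      exact abs_le.2 ⟨by linarith, by linarith⟩)
    nlinarith [mul_nonneg (neg_nonneg.2 (hk0 s hs)) (sub_nonneg.2 h1)]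
  have key' : ∀ s, 0 ≤ k s * φ (x - s) - k s * φ (x + s) := by
    intro s
    rcases le_total 0 s with hs | hs
    · exact key s hs
    · have := key (-s) (by linarith)
      rw [hko, sub_neg_eq_add, ← sub_eq_add_neg] at this
      linarith
  have h2 := integral_nonneg (μ := volume) (f := fun s => k s * φ (x - s) - k s * φ (x + s)) key'
  rw [integral_sub hi1 hi2] at h2
  rw [e0]
  linarith

section Dressed

variable {γ J h Q : ℝ} {ε : ℂ → ℂ}

theorem coupling_pos (hγ : 0 < γ) (hγ' : γ < π / 2) (hJ : 0 < J) : 0 < 4 * π * J * Real.sin γ := by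
  have := Real.sin_pos_of_pos_of_lt_pi hγ (by linarith)
  have := Real.pi_pos
  positivity

theorem evenSlope_potential (hγ : 0 < γ) (hγ' : γ < π / 2) (hJ : 0 < J)
    (H : IsDressedEnergy γ J h Q ε) : EvenSlope 0 (potential γ Q (fun x : ℝ => (ε x).re)) := by
  obtain ⟨M, hM⟩ := exists_bound_dressed_re hγ hγ' H.pos.le H.dressed
  exact (evenSlope_dressed hγ hγ' hJ H).potential hγ hγ' H.pos.le le_rfl
    (continuous_dressed_re hγ hγ' H.pos.le H.dressed).measurable hM (by simp [H.fermi])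

/-- Adding back the driving term leaves a constant plus the unimodal kernel `sechRe` convolved with
a potential that is even and increasing on the half-line. -/
theorem dressed_add_sechRe_mono (hγ : 0 < γ) (hγ' : γ < π / 2) (hJ : 0 < J)
    (H : IsDressedEnergy γ J h Q ε) {y : ℝ} (hy : |y| < γ / 2) :
    MonotoneOn (fun x : ℝ => (ε (x + y * I)).re + 4 * π * J * Real.sin γ * sechRe γ y x)
      (Ici 0) := by
  have hQ := H.pos.le
  obtain ⟨M, hM⟩ := exists_bound_dressed_re hγ hγ' hQ H.dressed
  obtain ⟨B, hB⟩ := exists_bound_potential (Q := Q) hγ hγ' hM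
  have hpm := measurable_potential (Q := Q) hγ hγ'
    (continuous_dressed_re hγ hγ' hQ H.dressed).measurable
  have h1 := (evenSlope_potential hγ hγ' hJ H).sech_convolution hγ hy le_rfl hpm hB
  intro x hx x' _ hxx'
  have h2 := h1.2 x x' hx hxx'
  have e1 := (dressed_line hγ hγ' hQ H.dressed hy x).1
  have e2 := (dressed_line hγ hγ' hQ H.dressed hy x').1
  beta_reduce at h2 ⊢
  linarith

theorem dressed_strictMonoOn (hγ : 0 < γ) (hγ' : γ < π / 2) (hJ : 0 < J)
    (H : IsDressedEnergy γ J h Q ε) {y : ℝ} (hy : |y| < γ / 2) :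
    StrictMonoOn (fun x : ℝ => (ε (x + y * I)).re) (Ici 0) := by
  intro x hx x' hx' hxx'
  have h1 := dressed_add_sechRe_mono hγ hγ' hJ H hy hx hx' hxx'.le
  have h2 : sechRe γ y x' < sechRe γ y x := sechRe_lt hγ hy (by
    rwa [abs_of_nonneg (mem_Ici.1 hx), abs_of_nonneg (mem_Ici.1 hx')])
  have h3 := mul_lt_mul_of_pos_left h2 (coupling_pos hγ hγ' hJ)
  beta_reduce at h1 ⊢
  linarith

theorem hasDerivAt_dressed_line (hγ : 0 < γ) (hγ' : γ < π / 2) (hQ : 0 ≤ Q)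
    (H : IsDressedEnergyAt γ J h Q ε) {y : ℝ} (hy : |y| < γ / 2) (x : ℝ) :
    HasDerivAt (fun x : ℝ => ε (x + y * I)) (deriv ε (x + y * I)) x := by
  have h1 := (differentiableAt_dressed hγ hγ' hQ H (z := x + y * I) (by simpa using hy)).hasDerivAt
  have h2 : HasDerivAt (fun x : ℝ => (x + y * I : ℂ)) 1 x :=
    (HasDerivAt.ofReal_comp (hasDerivAt_id x)).add_const _
  have h3 := h1.comp x h2
  rwa [mul_one] at h3

theorem hasDerivAt_re {f : ℝ → ℂ} {f' : ℂ} {x : ℝ} (h : HasDerivAt f f' x) :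
    HasDerivAt (fun x => (f x).re) f'.re x :=
  (reCLM.hasFDerivAt (x := f x)).comp_hasDerivAt x h

theorem hasDerivAt_im {f : ℝ → ℂ} {f' : ℂ} {x : ℝ} (h : HasDerivAt f f' x) :
    HasDerivAt (fun x => (f x).im) f'.im x :=
  (imCLM.hasFDerivAt (x := f x)).comp_hasDerivAt x h

theorem deriv_nonneg_of_right {f : ℝ → ℝ} {d x : ℝ} (hd : HasDerivAt f d x)
    (h : ∀ y, x < y → f x ≤ f y) : 0 ≤ d := by
  have h1 := (hasDerivWithinAt_iff_tendsto_slope' self_notMem_Ioi).1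
    (hd.hasDerivWithinAt (s := Ioi x))
  refine ge_of_tendsto h1 ?_
  filter_upwards [self_mem_nhdsWithin] with y hy
  rw [slope_def_field]
  exact div_nonneg (sub_nonneg.2 (h y hy)) (sub_nonneg.2 (mem_Ioi.1 hy).le)

/-- Strict monotonicity alone would allow a vanishing derivative. Here Re ε is a monotone function
minus a positive multiple of `sechRe`, whose derivative is strictly negative for x > 0. -/
theorem deriv_dressed_re_pos (hγ : 0 < γ) (hγ' : γ < π / 2) (hJ : 0 < J)
    (H : IsDressedEnergy γ J h Q ε) {y : ℝ} (hy : |y| < γ / 2) {x : ℝ} (hx : 0 < x) :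
    0 < (deriv ε (x + y * I)).re := by
  obtain ⟨d, hd, hd'⟩ := sechRe_antitone_deriv hγ hy hx
  have h1 := hasDerivAt_re (hasDerivAt_dressed_line hγ hγ' H.pos.le H.dressed hy x)
  have h2 := deriv_nonneg_of_right (h1.add (hd'.const_mul (4 * π * J * Real.sin γ)))
    (fun x' hx' => dressed_add_sechRe_mono hγ hγ' hJ H hy hx.le (hx.trans hx').le hx'.le)
  have h3 := mul_neg_of_pos_of_neg (coupling_pos hγ hγ' hJ) hd
  linarith

/-- Im s is odd in x and nonpositive in the first quadrant of the strip, s being `sechKernel γ`. The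
driving term is then nonnegative, and so is the convolution with the increasing even potential. -/
theorem dressed_im_nonneg (hγ : 0 < γ) (hγ' : γ < π / 2) (hJ : 0 < J)
    (H : IsDressedEnergy γ J h Q ε) {y : ℝ} (hy0 : 0 ≤ y) (hy : y < γ / 2) {x : ℝ} (hx : 0 ≤ x) :
    0 ≤ (ε (x + y * I)).im := by
  have hy' : |y| < γ / 2 := by rwa [abs_of_nonneg hy0]
  have hQ := H.pos.le
  obtain ⟨M, hM⟩ := exists_bound_dressed_re hγ hγ' hQ H.dressed
  obtain ⟨B, hB⟩ := exists_bound_potential (Q := Q) hγ hγ' hM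
  have hpm := measurable_potential (Q := Q) hγ hγ'
    (continuous_dressed_re hγ hγ' hQ H.dressed).measurable
  rw [(dressed_line hγ hγ' hQ H.dressed hy' x).2]
  have h1 := (evenSlope_potential hγ hγ' hJ H).odd_convolution_nonneg (integrable_sechIm hγ hy')
    (sechIm_neg γ y) (fun x => sechIm_nonpos hγ hy0 hy) hpm hB hx
  have h2 := mul_nonneg (coupling_pos hγ hγ' hJ).le
    (neg_nonneg.2 (sechIm_nonpos (x := x) hγ hy0 hy hx))
  linarith

theorem dressed_imag_axis (hγ : 0 < γ) (hγ' : γ < π / 2) (hQ : 0 ≤ Q)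
    (H : IsDressedEnergyAt γ J h Q ε) {y : ℝ} (hy : |y| < γ / 2) : (ε (y * I)).im = 0 := by
  have him : ((y : ℂ) * I).im = y := by simp
  have h1 : (y * I : ℂ) ∈ domainUpsilon γ Q :=
    mem_domainUpsilon_of_im hγ hγ' (by rw [him]; linarith) (by rw [him]; linarith)
  have h2 : (y * I : ℂ) ∉ barePoles γ :=
    not_mem_barePoles_of_im hγ hγ' (by rw [him]; linarith) (by rw [him]; exact hy.ne)
  have h3 := dressed_conj hγ hγ' hQ H h1 h2
  rw [show (starRingEnd ℂ) (y * I : ℂ) = -(y * I) by simp, dressed_neg hγ hγ' hQ H h1 h2] at h3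
  exact conj_eq_iff_im.1 h3.symm

/-- Im ε vanishes on the imaginary axis and is nonnegative to its right, so its x-derivative there
is nonnegative. By Cauchy–Riemann this is minus the y-derivative of Re ε. -/
theorem dressed_imag_axis_le (hγ : 0 < γ) (hγ' : γ < π / 2) (hJ : 0 < J)
    (H : IsDressedEnergy γ J h Q ε) {y : ℝ} (hy0 : 0 ≤ y) (hy : y < γ / 2) :
    (ε (y * I)).re ≤ (ε 0).re := by
  have habs : ∀ s ∈ Ico 0 (γ / 2), |s| < γ / 2 := fun s hs => by
    rw [abs_of_nonneg hs.1]; exact hs.2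
  have hd : ∀ s ∈ Ico 0 (γ / 2), HasDerivAt (fun s : ℝ => (ε (s * I)).re)
      (-(deriv ε (s * I)).im) s := by
    intro s hs
    have h1 := (differentiableAt_dressed hγ hγ' H.pos.le H.dressed (z := s * I)
      (by simpa using habs s hs)).hasDerivAt
    have h2 : HasDerivAt (fun x : ℝ => (x * I : ℂ)) I s := by
      simpa using (HasDerivAt.ofReal_comp (hasDerivAt_id s)).mul_const I
    have h3 := hasDerivAt_re (h1.comp s h2)
    simpa using h3
  have hn : ∀ s ∈ Ico 0 (γ / 2), -(deriv ε (s * I)).im ≤ 0 := by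
    intro s hs
    have h1 := hasDerivAt_im (hasDerivAt_dressed_line hγ hγ' H.pos.le H.dressed (habs s hs) 0)
    rw [ofReal_zero, zero_add] at h1
    refine neg_nonpos.2 (deriv_nonneg_of_right h1 fun x hx => ?_)
    rw [ofReal_zero, zero_add, dressed_imag_axis hγ hγ' H.pos.le H.dressed (habs s hs)]
    exact dressed_im_nonneg hγ hγ' hJ H hs.1 hs.2 hx.le
  have hanti : AntitoneOn (fun s : ℝ => (ε (s * I)).re) (Ico 0 (γ / 2)) := by
    refine antitoneOn_of_deriv_nonpos (convex_Ico _ _)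
      (fun s hs => (hd s hs).continuousAt.continuousWithinAt)
      (fun s hs => (hd s (interior_subset hs)).differentiableAt.differentiableWithinAt)
      (fun s hs => ?_)
    rw [(hd s (interior_subset hs)).deriv]
    exact hn s (interior_subset hs)
  have := hanti (a := 0) (b := y) ⟨le_rfl, by linarith⟩ ⟨hy0, hy⟩ hy0
  simpa using this

/-- For x > Q the point is off the cuts and the poles at every height, and both kernels decay like
1/sinh². -/
theorem tendsto_dressed_line (hγ : 0 < γ) (hγ' : γ < π / 2) (hQ : 0 ≤ Q)
    (H : IsDressedEnergyAt γ J h Q ε) (y : ℝ) :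
    Tendsto (fun x : ℝ => ε (x + y * I)) atTop (𝓝 h) := by
  obtain ⟨M, hM⟩ := exists_bound_dressed_real hγ hγ' hQ H
  have hM0 : 0 ≤ M := (norm_nonneg _).trans (hM 0)
  rw [tendsto_iff_norm_sub_tendsto_zero]
  have hl : ∀ x₀, Tendsto (fun x : ℝ => 1 / (2 * π * 1) *
      ((Real.sinh (1 * (x - x₀)))⁻¹ * (Real.sinh (1 * (x - x₀)))⁻¹)) atTop (𝓝 0) := by
    intro x₀
    have := ((tendsto_inv_sinh one_pos x₀).mul (tendsto_inv_sinh one_pos x₀)).const_mul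
      (1 / (2 * π * 1))
    simpa only [mul_zero] using this
  have hl2 := ((hl 0).const_mul ‖((4 * π * J * Real.sin γ : ℝ) : ℂ)‖).add
    (((hl Q).mul_const M).mul_const |Q - -Q|)
  simp only [mul_zero, zero_mul, add_zero] at hl2
  refine squeeze_zero' (Eventually.of_forall fun _ => norm_nonneg _) ?_ hl2
  filter_upwards [eventually_gt_atTop Q] with x hx
  have hx0 : 0 < x := hQ.trans_lt hx
  have hre : ((x : ℂ) + y * I).re = x := by simp
  have e : ∀ a b c : ℂ, a - b - c - a = -(b + c) := fun a b c => by ring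
  rw [dressed_equation H (mem_domainUpsilon_of_re (by rw [hre, abs_of_pos hx0]; exact hx))
    (not_mem_barePoles_of_re (by rw [hre]; exact hx0.ne')), e, norm_neg]
  refine (norm_add_le _ _).trans (add_le_add ?_ ?_)
  · rw [norm_mul]
    refine mul_le_mul_of_nonneg_left ?_ (norm_nonneg _)
    have := norm_stripKernel_le' (b := 1) (θ := γ / 2) one_pos (z := x + y * I)
      (by rw [hre]; exact hx0.ne')
    rw [hre, abs_of_pos hx0, inv_one] at this
    rwa [sub_zero]
  · refine intervalIntegral.norm_integral_le_of_norm_le_const fun μ hμ => ?_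
    rw [uIoc_of_le (by linarith)] at hμ
    have hxμ : 0 < x - μ := by linarith [hμ.2]
    have hre' : ((x : ℂ) + y * I - μ).re = x - μ := by simp
    have := norm_stripKernel_le' (b := 1) (θ := γ) one_pos (z := x + y * I - μ)
      (by rw [hre']; exact hxμ.ne')
    rw [hre', abs_of_pos hxμ, inv_one] at this
    rw [norm_mul]
    refine mul_le_mul (this.trans ?_) (hM μ) (norm_nonneg _) ?_
    · have hs : 0 < Real.sinh (1 * (x - Q)) := Real.sinh_pos_iff.2 (by linarith)
      have hs2 : Real.sinh (1 * (x - Q)) ≤ Real.sinh (1 * (x - μ)) :=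
        Real.sinh_le_sinh.2 (by linarith [hμ.2])
      have hp := Real.pi_pos
      gcongr
    · have hp := Real.pi_pos
      exact mul_nonneg (by positivity) (mul_self_nonneg _)

theorem dressed_re_lt (hγ : 0 < γ) (hγ' : γ < π / 2) (hJ : 0 < J)
    (H : IsDressedEnergy γ J h Q ε) {y : ℝ} (hy : |y| < γ / 2) {x : ℝ} (hx : 0 ≤ x) :
    (ε (x + y * I)).re < h := by
  have hm := dressed_strictMonoOn hγ hγ' hJ H hy
  have h1 := hm (a := x) (b := x + 1) hx (by simp; linarith) (by linarith)
  refine h1.trans_le ?_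
  have h2 := (continuous_re.tendsto _).comp (tendsto_dressed_line hγ hγ' H.pos.le H.dressed y)
  rw [ofReal_re] at h2
  refine ge_of_tendsto h2 ?_
  filter_upwards [eventually_ge_atTop (x + 1)] with x' hx'
  exact hm.monotoneOn (by simp; linarith) (by simp; linarith) hx'

theorem dressed_real_lt (hγ : 0 < γ) (hγ' : γ < π / 2) (hJ : 0 < J)
    (H : IsDressedEnergy γ J h Q ε) (x : ℝ) : (ε x).re < h := by
  rw [← (evenSlope_dressed hγ hγ' hJ H).apply_abs]
  have := dressed_re_lt hγ hγ' hJ H (y := 0) (by simpa using hγ) (abs_nonneg x)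
  simpa using this

theorem dressed_real_lt_iff (hγ : 0 < γ) (hγ' : γ < π / 2) (hJ : 0 < J)
    (H : IsDressedEnergy γ J h Q ε) (x : ℝ) : ((ε x).re < 0 ↔ |x| < Q) ∧
      (0 < (ε x).re ↔ Q < |x|) := by
  have hm := dressed_strictMonoOn hγ hγ' hJ H (y := 0) (by simpa using hγ)
  simp only [ofReal_zero, zero_mul, add_zero] at hm
  have h0 : (ε (Q : ℂ)).re = 0 := by simp [H.fermi]
  have e := (evenSlope_dressed hγ hγ' hJ H).apply_abs x
  beta_reduce at e
  rw [← e, ← h0]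
  exact ⟨hm.lt_iff_lt (abs_nonneg x) H.pos.le, hm.lt_iff_lt H.pos.le (abs_nonneg x)⟩

theorem outerRe_dressed_nonneg (hγ : 0 < γ) (hγ' : γ < π / 2) (hJ : 0 < J)
    (H : IsDressedEnergy γ J h Q ε) (x : ℝ) : 0 ≤ outerRe Q (fun x : ℝ => (ε x).re) x := by
  refine indicator_nonneg (fun x hx => ?_) x
  refine ((dressed_real_lt_iff hγ hγ' hJ H x).2.2 ?_).le
  by_contra hc
  exact hx (abs_le.1 (not_lt.1 hc))

theorem outerRe_dressed_lt (hγ : 0 < γ) (hγ' : γ < π / 2) (hJ : 0 < J) (hh : 0 < h)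
    (H : IsDressedEnergy γ J h Q ε) (x : ℝ) : outerRe Q (fun x : ℝ => (ε x).re) x < h := by
  by_cases hx : x ∈ (Icc (-Q) Q)ᶜ
  · rw [outerRe, indicator_of_mem hx]
    exact dressed_real_lt hγ hγ' hJ H x
  · rwa [outerRe, indicator_of_notMem hx]

theorem dressed_imag_axis_neg (hγ : 0 < γ) (hγ' : γ < π / 2) (hJ : 0 < J)
    (H : IsDressedEnergy γ J h Q ε) {y : ℝ} (hy0 : 0 ≤ y) (hy : y < γ / 2) :
    (ε (y * I)).re < 0 := by
  refine (dressed_imag_axis_le hγ hγ' hJ H hy0 hy).trans_lt ?_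
  have := (dressed_real_lt_iff hγ hγ' hJ H 0).1.2 (by simpa using H.pos)
  simpa using this

end Dressed

/-! ### Real part of the coth kernels off the axis -/

theorem cothKernel_re (b x η : ℝ) :
    (cothKernel b (x + η * I)).re = -(1 / 2 * realKernel b η x) := by
  have r1 : (((x : ℂ) + η * I) / b).re = x / b := by rw [div_ofReal_re]; simp
  have r2 : (((x : ℂ) + η * I) / b).im = η / b := by rw [div_ofReal_im]; simp
  have e1 : cothKernel b (x + η * I) = ((1 / (2 * π * b) : ℝ) : ℂ) *
      (-I * (cosh ((x + η * I) / b) * (sinh ((x + η * I) / b))⁻¹)) := by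
    rw [cothKernel, show (1 / (2 * π * I * b) : ℂ) = 1 / (2 * π * b) * (I)⁻¹ by
      rw [one_div, one_div, ← mul_inv]; ring, inv_I]
    push_cast
    ring
  rw [e1, re_ofReal_mul, neg_mul, neg_re, I_mul_re, mul_im, inv_re, inv_im, normSq_eq_norm_sq,
    normSq_sinh, XXZ.cosh_re, XXZ.cosh_im, XXZ.sinh_re, XXZ.sinh_im, r1, r2, realKernel]
  have h1 : Real.sin (2 * η / b) = 2 * Real.sin (η / b) * Real.cos (η / b) := by
    rw [mul_div_assoc, Real.sin_two_mul]
  have h2 : Real.cosh (2 * x / b) - Real.cos (2 * η / b) =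
      2 * (Real.cosh (x / b) ^ 2 - Real.cos (η / b) ^ 2) := by
    rw [mul_div_assoc, mul_div_assoc, Real.cosh_two_mul, Real.cos_two_mul, Real.sinh_sq]
    ring
  have h3 := Real.sinh_sq (x / b)
  rw [h1, h2, mul_inv]
  simp only [div_eq_mul_inv, one_mul, mul_inv] at h3 ⊢
  linear_combination ((2 : ℝ)⁻¹ * π⁻¹ * b⁻¹ * Real.sin (η * b⁻¹) * Real.cos (η * b⁻¹) *
    (Real.cosh (x * b⁻¹) ^ 2 - Real.cos (η * b⁻¹) ^ 2)⁻¹) * h3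

theorem realKernel_neg_param (b θ x : ℝ) : realKernel b (-θ) x = -realKernel b θ x := by
  rw [realKernel, realKernel, mul_neg, neg_div, Real.sin_neg, Real.cos_neg]
  ring

theorem realKernel_period_sub {b : ℝ} (hb : b ≠ 0) (θ x : ℝ) :
    realKernel b (π * b - θ) x = -realKernel b θ x := by
  have e : 2 * (π * b - θ) / b = 2 * π - 2 * θ / b := by field_simp
  rw [realKernel, realKernel, e, Real.sin_two_pi_sub, Real.cos_two_pi_sub]
  ring

/-- Each coth term has, up to sign, half a real kernel as its real part. The real part on a
horizontal line is thus an average of two kernels whose signs and masses are known separately. -/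
theorem stripKernel_re (b θ : ℝ) (z : ℂ) : (stripKernel b θ z).re =
    1 / 2 * (realKernel b (θ + z.im) z.re + realKernel b (θ - z.im) z.re) := by
  have e1 : z - I * θ = ((z.re : ℝ) : ℂ) + ((-(θ - z.im) : ℝ) : ℂ) * I := by
    apply Complex.ext <;> simp
  have e2 : z + I * θ = ((z.re : ℝ) : ℂ) + ((θ + z.im : ℝ) : ℂ) * I := by
    apply Complex.ext <;> simp
    ring
  rw [stripKernel, sub_re, e1, e2, cothKernel_re, cothKernel_re, realKernel_neg_param]
  ring

theorem integrable_realKernel {b θ : ℝ} (hb : 0 < b) (hs : Real.sin (θ / b) ≠ 0) :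
    Integrable (realKernel b θ) := by
  have := integrable_stripKernel hb (θ := θ) (y := 0)
    (by rw [zero_sub, neg_div, Real.sin_neg]; exact neg_ne_zero.2 hs) (by rwa [zero_add])
  simp only [ofReal_zero, zero_mul, add_zero, stripKernel_ofReal hs] at this
  simpa using this.re

theorem sin_div_ne_zero {b θ : ℝ} (hb : 0 < b) (h1 : 0 < θ) (h2 : θ < π * b) :
    Real.sin (θ / b) ≠ 0 :=
  sin_ne_zero_of_Ioo (div_pos h1 hb) (by rwa [div_lt_iff₀ hb])

theorem integral_realKernel {b θ : ℝ} (hb : 0 < b) (h1 : 0 < θ) (h2 : θ < π * b) :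
    ∫ x, realKernel b θ x = 1 - 2 * θ / (π * b) := by
  have := integral_stripKernel_of_abs_lt (b := b) (θ := θ) (y := 0) hb (by simpa using h1)
    (by simpa using h2)
  simp only [ofReal_zero, zero_mul, add_zero, stripKernel_ofReal (sin_div_ne_zero hb h1 h2),
    integral_complex_ofReal] at this
  exact_mod_cast this

theorem integral_pos_of_pos {f : ℝ → ℝ} (hi : Integrable f) (hf : ∀ x, 0 < f x) :
    0 < ∫ x, f x := by
  rw [integral_pos_iff_support_of_nonneg (fun x => (hf x).le) hi]
  have : Function.support f = univ := eq_univ_of_forall fun x => (hf x).ne'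
  rw [this]
  simp

/-! ### Upper and lower bounds in the strip |Im z| < γ/2 -/

section Dressed

variable {γ J h Q : ℝ} {ε : ℂ → ℂ}

theorem measurable_outerRe_dressed (hγ : 0 < γ) (hγ' : γ < π / 2)
    (H : IsDressedEnergy γ J h Q ε) : Measurable (outerRe Q (fun x : ℝ => (ε x).re)) :=
  measurable_outerRe (continuous_dressed_re hγ hγ' H.pos.le H.dressed).measurable

theorem abs_outerRe_dressed_le (hγ : 0 < γ) (hγ' : γ < π / 2) (hJ : 0 < J) (hh : 0 < h)
    (H : IsDressedEnergy γ J h Q ε) (x : ℝ) : |outerRe Q (fun x : ℝ => (ε x).re) x| ≤ h :=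
  abs_le.2 ⟨by linarith [outerRe_dressed_nonneg hγ hγ' hJ H x],
    (outerRe_dressed_lt hγ hγ' hJ hh H x).le⟩

theorem integrable_mul_outerRe (hγ : 0 < γ) (hγ' : γ < π / 2) (hJ : 0 < J) (hh : 0 < h)
    (H : IsDressedEnergy γ J h Q ε) {k : ℝ → ℝ} (hk : Integrable k) (x : ℝ) :
    Integrable (fun μ => k (x - μ) * outerRe Q (fun x : ℝ => (ε x).re) μ) :=
  (hk.comp_sub_left x).mul_bdd (measurable_outerRe_dressed hγ hγ' H).aestronglyMeasurable
    (Eventually.of_forall (abs_outerRe_dressed_le hγ hγ' hJ hh H))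

/-- A positive kernel acts on the outer dressed energy, which lies between `0` and `h`. -/
theorem integral_mul_outerRe_bounds (hγ : 0 < γ) (hγ' : γ < π / 2) (hJ : 0 < J) (hh : 0 < h)
    (H : IsDressedEnergy γ J h Q ε) {k : ℝ → ℝ} (hk : Integrable k) (hk0 : ∀ x, 0 < k x) (x : ℝ) :
    0 ≤ ∫ μ, k (x - μ) * outerRe Q (fun x : ℝ => (ε x).re) μ ∧
      ∫ μ, k (x - μ) * outerRe Q (fun x : ℝ => (ε x).re) μ < h * ∫ x, k x := by
  have hi := integrable_mul_outerRe hγ hγ' hJ hh H hk x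
  refine ⟨integral_nonneg fun μ => mul_nonneg (hk0 _).le (outerRe_dressed_nonneg hγ hγ' hJ H μ), ?_⟩
  have h1 := integral_pos_of_pos (((hk.comp_sub_left x).const_mul h).sub hi) (fun μ => ?_)
  · simp only [Pi.sub_apply] at h1
    rw [integral_sub ((hk.comp_sub_left x).const_mul h) hi, integral_const_mul,
      integral_sub_left_eq_self] at h1
    linarith
  · have h2 := mul_pos (hk0 (x - μ)) (sub_pos.2 (outerRe_dressed_lt hγ hγ' hJ hh H μ))
    simp only [Pi.sub_apply]
    linarith

theorem potential_bounds (hγ : 0 < γ) (hγ' : γ < π / 2) (hJ : 0 < J) (hh : 0 < h)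
    (H : IsDressedEnergy γ J h Q ε) (t : ℝ) :
    0 ≤ potential γ Q (fun x : ℝ => (ε x).re) t ∧
      potential γ Q (fun x : ℝ => (ε x).re) t < h * (1 - γ / (π - γ)) := by
  rw [← integral_realKernel_outer hγ hγ']
  exact integral_mul_outerRe_bounds hγ hγ' hJ hh H (integrable_realKernel_outer hγ hγ')
    (realKernel_outer_pos hγ hγ') t

theorem one_div_one_sub (hγ' : γ < π / 2) (hγ : 0 < γ) : 1 / (1 - γ / π) = 1 + γ / (π - γ) := by
  have h1 : π - γ ≠ 0 := by linarith
  have h2 : 1 - γ / π = (π - γ) / π := by rw [sub_div, div_self Real.pi_ne_zero]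
  rw [h2, one_div_div, div_eq_iff h1, add_mul, div_mul_cancel₀ _ h1]
  ring

theorem re_add_im_mul_I (z : ℂ) : ((z.re : ℂ) + z.im * I) = z := Complex.re_add_im z

theorem upperEnergy_re (z : ℂ) : (upperEnergy γ J h z).re =
    h - 4 * π * J * Real.sin γ * sechRe γ z.im z.re := by
  have e : upperEnergy γ J h z = h - ((4 * π * J * Real.sin γ : ℝ) : ℂ) * sechKernel γ z := by
    rw [upperEnergy, sechKernel, div_eq_mul_inv, mul_assoc (2 : ℂ), mul_inv]
    push_cast
    ring
  rw [e, sub_re, re_ofReal_mul, ofReal_re, sechRe, re_add_im_mul_I]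

/-- The potential is below h(1 - γ/(π - γ)), and `sechRe` is positive with mass 1/2. The resulting
bound h/2 · (1 - γ/(π - γ)) and the constant h/2 · (1 + γ/(π - γ)) add up to h. -/
theorem dressed_re_lt_upperEnergy (hγ : 0 < γ) (hγ' : γ < π / 2) (hJ : 0 < J) (hh : 0 < h)
    (H : IsDressedEnergy γ J h Q ε) {z : ℂ} (hz : |z.im| < γ / 2) :
    (ε z).re < (upperEnergy γ J h z).re := by
  have hline := (dressed_line hγ hγ' H.pos.le H.dressed hz z.re).1
  rw [re_add_im_mul_I] at hline
  rw [hline, upperEnergy_re]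
  have hb := potential_bounds hγ hγ' hJ hh H
  have hmeas := measurable_potential (Q := Q) hγ hγ'
    (continuous_dressed_re hγ hγ' H.pos.le H.dressed).measurable
  have hk := (integrable_sechRe hγ hz).comp_sub_left z.re
  have hi : Integrable (fun t => sechRe γ z.im (z.re - t) *
      potential γ Q (fun x : ℝ => (ε x).re) t) :=
    hk.mul_bdd hmeas.aestronglyMeasurable (Eventually.of_forall fun t =>
      abs_le.2 ⟨by linarith [(hb t).1, (hb t).2], (hb t).2.le⟩)
  have h1 := integral_pos_of_pos ((hk.const_mul (h * (1 - γ / (π - γ)))).sub hi) (fun t => by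
    have := mul_pos (sechRe_pos hγ hz (z.re - t)) (sub_pos.2 (hb t).2)
    simp only [Pi.sub_apply]
    linarith)
  simp only [Pi.sub_apply] at h1
  rw [integral_sub (hk.const_mul _) hi, integral_const_mul, integral_sub_left_eq_self,
    integral_sechRe hγ hz] at h1
  have h2 : h / (2 * (1 - γ / π)) = h / 2 * (1 + γ / (π - γ)) := by
    rw [← one_div_one_sub hγ' hγ, div_mul_div_comm, mul_one]
  rw [h2]
  linarith

/-- Here cos(2 Im z) is positive and larger than cos(2γ), so the denominator cosh(2z) - cos(2γ) has
positive real part. -/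
theorem stripKernel_one_re_pos (hγ : 0 < γ) (hγ' : γ < π / 2) {z : ℂ} (hz : |z.im| < γ / 2) :
    0 < (stripKernel 1 γ z).re := by
  have hz' := abs_lt.1 hz
  have hreg := sub_mem_regularSet_of_im hγ' (z := z) (by linarith) 0
  rw [ofReal_zero, sub_zero] at hreg
  rw [stripKernel_eq hreg.1 hreg.2, re_ofReal_mul, inv_re]
  have hs : 0 < Real.sin (2 * γ / 1) :=
    Real.sin_pos_of_pos_of_lt_pi (by linarith) (by linarith)
  have h1 : 0 < (cosh (2 * z / (1 : ℝ)) - ((Real.cos (2 * γ / 1) : ℝ) : ℂ)).re := by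
    rw [sub_re, ofReal_re, XXZ.cosh_re]
    have r1 : (2 * z / ((1 : ℝ) : ℂ)).im = 2 * z.im := by simp
    rw [r1]
    have h2 : Real.cos (2 * γ / 1) < Real.cos (2 * z.im) := by
      rw [← Real.cos_abs (2 * z.im), abs_mul, abs_two]
      exact Real.cos_lt_cos_of_nonneg_of_le_pi (by positivity) (by linarith) (by linarith)
    have h3 : 0 < Real.cos (2 * z.im) :=
      Real.cos_pos_of_mem_Ioo ⟨by linarith, by linarith⟩
    nlinarith [Real.one_le_cosh (2 * z / ((1 : ℝ) : ℂ)).re]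
  refine mul_pos (by have := Real.pi_pos; positivity) (div_pos h1 (normSq_pos.2 fun h0 => ?_))
  rw [h0] at h1
  exact lt_irrefl _ h1

/-- On (-Q, Q) the dressed energy is negative while the kernel has positive real part, so the
subtracted integral is negative. -/
theorem bareEnergy_re_lt (hγ : 0 < γ) (hγ' : γ < π / 2) (hJ : 0 < J)
    (H : IsDressedEnergy γ J h Q ε) {z : ℂ} (hz : |z.im| < γ / 2) :
    (bareEnergy γ J h z).re < (ε z).re := by
  rw [H.dressed.equation z (mem_domainUpsilon_of_im hγ hγ' (by linarith) (by linarith))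
    (not_mem_barePoles_of_im hγ hγ' (by linarith) hz.ne), sub_re, lt_sub_comm, sub_self]
  have e : ∀ μ : ℝ, kernelK (z - μ) γ * ε μ = stripKernel 1 γ (z - μ) * (((ε μ).re : ℝ) : ℂ) := by
    intro μ
    rw [kernelK_eq, dressed_ofReal hγ hγ' H.pos.le H.dressed μ, ofReal_re]
  have hd : Continuous (fun μ : ℝ => stripKernel 1 γ (z - μ)) :=
    continuous_iff_continuousAt.2 fun μ => by
      have hreg := sub_mem_regularSet_of_im hγ' (z := z) (by linarith) μ
      exact (differentiableAt_stripKernel hreg.1 hreg.2).continuousAt.comp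
        (f := fun μ : ℝ => z - (μ : ℂ)) (by fun_prop)
  have hre := continuous_dressed_re hγ hγ' H.pos.le H.dressed
  have hi : IntervalIntegrable (fun μ : ℝ => stripKernel 1 γ (z - μ) * (((ε μ).re : ℝ) : ℂ))
      volume (-Q) Q := (hd.mul (continuous_ofReal.comp hre)).intervalIntegrable _ _
  simp only [e]
  have h1 : (∫ μ in (-Q)..Q, stripKernel 1 γ (z - μ) * (((ε μ).re : ℝ) : ℂ)).re =
      ∫ μ in (-Q)..Q, (stripKernel 1 γ (z - μ)).re * (ε μ).re := by
    have := reCLM.intervalIntegral_comp_comm hi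
    simpa only [reCLM_apply, re_mul_ofReal] using this.symm
  rw [h1]
  have h2 := intervalIntegral.intervalIntegral_pos_of_pos_on (a := -Q) (b := Q)
    (f := fun μ => (stripKernel 1 γ (z - μ)).re * -(ε μ).re)
    (((continuous_re.comp hd).mul hre.neg).intervalIntegrable _ _) (fun μ hμ => ?_)
    (by linarith [H.pos])
  · simp only [mul_neg] at h2
    rw [intervalIntegral.integral_neg] at h2
    linarith
  · exact mul_pos (stripKernel_one_re_pos hγ hγ' (by simpa using hz))
      (neg_pos.2 ((dressed_real_lt_iff hγ hγ' hJ H μ).1.2 (abs_lt.2 hμ)))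

end Dressed

/-! ### Lower bounds for |Im z| > γ/2 and the constant c -/

section Dressed

variable {γ J h Q : ℝ} {ε : ℂ → ℂ}

theorem outerPotential_re (hγ : 0 < γ) (hγ' : γ < π / 2) (hJ : 0 < J) (hh : 0 < h)
    (H : IsDressedEnergy γ J h Q ε) {w : ℂ} (h1 : Real.sin ((w.im - γ / 2) / (1 - γ / π)) ≠ 0)
    (h2 : Real.sin ((w.im + γ / 2) / (1 - γ / π)) ≠ 0) :
    (outerPotential γ Q (fun t : ℝ => ε t) w).re =
      ∫ μ, (stripKernel (1 - γ / π) (γ / 2) ((w.re - μ : ℝ) + w.im * I)).re *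
        outerRe Q (fun t : ℝ => (ε t).re) μ := by
  have hi := integrable_line_mul (z := w) (F := stripKernel (1 - γ / π) (γ / 2))
    (integrable_stripKernel (one_sub_div_pi_pos hγ') h1 h2)
    (g := fun μ => (outerRe Q (fun t : ℝ => (ε t).re) μ : ℂ))
    (measurable_ofReal.comp (measurable_outerRe_dressed hγ hγ' H)) (M := h)
    (fun μ => by
      rw [norm_real]; exact abs_outerRe_dressed_le hγ hγ' hJ hh H μ)
  have hre := integral_re hi
  simp only [RCLike.re_to_complex, re_mul_ofReal] at hre
  have e : outerPotential γ Q (fun t : ℝ => ε t) w =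
      ∫ μ : ℝ, stripKernel (1 - γ / π) (γ / 2) (w - μ) *
        (outerRe Q (fun t : ℝ => (ε t).re) μ : ℂ) := by
    rw [outerPotential]
    congr 1
    funext μ
    rw [← outer_ofReal]
    congr 3
    funext t
    exact dressed_ofReal hγ hγ' H.pos.le H.dressed t
  rw [e, ← hre]
  simp only [sub_ofReal_eq]

theorem outerPotential_re' (hγ : 0 < γ) (hγ' : γ < π / 2) (hJ : 0 < J) (hh : 0 < h)
    (H : IsDressedEnergy γ J h Q ε) {w : ℂ} (h1 : Real.sin ((γ / 2 - w.im) / (1 - γ / π)) ≠ 0)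
    (h2 : Real.sin ((γ / 2 + w.im) / (1 - γ / π)) ≠ 0) :
    (outerPotential γ Q (fun t : ℝ => ε t) w).re =
      1 / 2 * ((∫ μ, realKernel (1 - γ / π) (γ / 2 + w.im) (w.re - μ) *
        outerRe Q (fun t : ℝ => (ε t).re) μ) +
      ∫ μ, realKernel (1 - γ / π) (γ / 2 - w.im) (w.re - μ) *
        outerRe Q (fun t : ℝ => (ε t).re) μ) := by
  have ha := one_sub_div_pi_pos hγ'
  rw [outerPotential_re hγ hγ' hJ hh H
    (by rw [← neg_sub, neg_div, Real.sin_neg]; exact neg_ne_zero.2 h1) (by rwa [add_comm]),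
    ← integral_add (integrable_mul_outerRe hγ hγ' hJ hh H (integrable_realKernel ha h2) w.re)
    (integrable_mul_outerRe hγ hγ' hJ hh H (integrable_realKernel ha h1) w.re),
    ← integral_const_mul]
  congr 1
  funext μ
  rw [stripKernel_re]
  have r1 : (((w.re - μ : ℝ) : ℂ) + w.im * I).re = w.re - μ := by simp
  have r2 : (((w.re - μ : ℝ) : ℂ) + w.im * I).im = w.im := by simp
  rw [r1, r2]
  ring

theorem integral_realKernel_mul_outerRe_bounds (hγ : 0 < γ) (hγ' : γ < π / 2) (hJ : 0 < J)
    (hh : 0 < h) (H : IsDressedEnergy γ J h Q ε) {θ : ℝ} (h1 : 0 < θ) (h2 : 2 * θ < π - γ) (x : ℝ) :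
    0 ≤ ∫ μ, realKernel (1 - γ / π) θ (x - μ) * outerRe Q (fun t : ℝ => (ε t).re) μ ∧
      ∫ μ, realKernel (1 - γ / π) θ (x - μ) * outerRe Q (fun t : ℝ => (ε t).re) μ <
        h * (1 - 2 * θ / (π - γ)) := by
  have ha := one_sub_div_pi_pos hγ'
  have h3 : θ < π * (1 - γ / π) := by rw [pi_mul_one_sub]; linarith
  rw [← pi_mul_one_sub γ, ← integral_realKernel ha h1 h3]
  refine integral_mul_outerRe_bounds hγ hγ' hJ hh H
    (integrable_realKernel ha (sin_div_ne_zero ha h1 h3))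
    (fun x => realKernel_pos ha (by positivity) ?_ x) x
  rw [div_lt_iff₀ ha, pi_mul_one_sub]
  exact h2

theorem h_div_one_sub (hγ : 0 < γ) (hγ' : γ < π / 2) :
    (h / (1 - γ / π) : ℂ).re = h * (1 + γ / (π - γ)) := by
  rw [← one_div_one_sub hγ' hγ, mul_one_div,
    show (h / (1 - γ / π) : ℂ) = ((h / (1 - γ / π) : ℝ) : ℂ) by push_cast; rfl, ofReal_re]

/-- The dressed energy above the cut exceeds `h` far from the real axis. -/
theorem dressed_re_gt_of_far (hγ : 0 < γ) (hγ' : γ < π / 2) (hJ : 0 < J) (hh : 0 < h)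
    (H : IsDressedEnergy γ J h Q ε) {z : ℂ} (h1 : γ < z.im) (h1' : (π + γ) / 4 ≤ z.im)
    (h2 : z.im ≤ π / 2) : h < (ε z).re := by
  have ha := one_sub_div_pi_pos hγ'
  have hpa := pi_mul_one_sub γ
  have him : (z - γ / 2 * I).im = z.im - γ / 2 := by simp
  have hs1 : Real.sin (((z - γ / 2 * I).im - γ / 2) / (1 - γ / π)) ≠ 0 := by
    rw [him]
    exact sin_div_ne_zero ha (by linarith) (by linarith)
  have hs2 : Real.sin (((z - γ / 2 * I).im + γ / 2) / (1 - γ / π)) ≠ 0 := by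
    rw [him]
    exact sin_div_ne_zero ha (by linarith) (by linarith)
  rw [dressed_eq_of_gt hγ hγ' H.pos.le H.dressed h1 h2, add_re, h_div_one_sub hγ hγ',
    outerPotential_re hγ hγ' hJ hh H hs1 hs2]
  set v := (z - γ / 2 * I).im with hv
  -- On this line cos(2v/(1 - γ/π)) ≤ 0, so the kernel has negative real part, with mass -γ/(π - γ).
  -- As the outer energy is below h, less than hγ/(π - γ) is lost from h/(1 - γ/π) = h + hγ/(π - γ).
  set k : ℝ → ℝ := fun s => -(stripKernel (1 - γ / π) (γ / 2) (s + v * I)).re with hk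
  have hki : Integrable k := (integrable_stripKernel ha hs1 hs2).re.neg
  have hint : ∫ s, k s = γ / (π - γ) := by
    have h3 := integral_stripKernel_of_lt (b := 1 - γ / π) (θ := γ / 2) (y := v) ha (by linarith)
      (by rw [him]; linarith) (by rw [him]; linarith)
    have h4 := integral_re (integrable_stripKernel ha hs1 hs2)
    simp only [RCLike.re_to_complex] at h4
    rw [h3, ofReal_re, hpa, mul_div_cancel₀ γ two_ne_zero] at h4
    rw [hk, integral_neg, h4, neg_neg]
  have hpos : ∀ s, 0 < k s := by
    intro s
    have hr : (s + v * I : ℂ) ∈ regularSet (1 - γ / π) (γ / 2) :=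
      mem_regularSet_of_sin (by simpa using hs1) (by simpa using hs2)
    have r1 : (2 * (s + v * I) / ((1 - γ / π : ℝ) : ℂ)).im = 2 * v / (1 - γ / π) := by
      rw [div_ofReal_im]; simp
    have hm := two_mul_half_div_mem hγ hγ'
    have hlt : (cosh (2 * (s + v * I) / ((1 - γ / π : ℝ) : ℂ)) -
        ((Real.cos (2 * (γ / 2) / (1 - γ / π)) : ℝ) : ℂ)).re < 0 := by
      rw [sub_re, ofReal_re, XXZ.cosh_re, r1]
      have h5 : Real.cos (2 * v / (1 - γ / π)) ≤ 0 := by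
        refine Real.cos_nonpos_of_pi_div_two_le_of_le ?_ ?_
        · rw [le_div_iff₀ ha, him]; linarith
        · rw [div_le_iff₀ ha, him]; nlinarith
      have h6 : Real.cos (2 * v / (1 - γ / π)) < Real.cos (2 * (γ / 2) / (1 - γ / π)) := by
        refine Real.cos_lt_cos_of_nonneg_of_le_pi hm.1.le ?_ ?_
        · rw [div_le_iff₀ ha, him]; linarith
        · rw [him]; gcongr; linarith
      nlinarith [Real.one_le_cosh (2 * (s + v * I) / ((1 - γ / π : ℝ) : ℂ)).re]
    rw [hk]
    beta_reduce
    rw [stripKernel_eq hr.1 hr.2, re_ofReal_mul, inv_re, neg_pos]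
    have hs3 : 0 < Real.sin (2 * (γ / 2) / (1 - γ / π)) :=
      Real.sin_pos_of_pos_of_lt_pi hm.1 hm.2
    refine mul_neg_of_pos_of_neg (by have := Real.pi_pos; positivity)
      (div_neg_of_neg_of_pos hlt (normSq_pos.2 fun h0 => ?_))
    rw [h0] at hlt
    exact lt_irrefl _ hlt
  have h7 := (integral_mul_outerRe_bounds hγ hγ' hJ hh H hki hpos (z - γ / 2 * I).re).2
  rw [hint] at h7
  simp only [hk, neg_mul] at h7
  rw [integral_neg] at h7
  linarith

/-- The dressed energy above the cut exceeds `h / 2`. -/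
theorem dressed_re_gt_of_gt (hγ : 0 < γ) (hγ' : γ < π / 2) (hJ : 0 < J) (hh : 0 < h)
    (H : IsDressedEnergy γ J h Q ε) {z : ℂ} (h1 : γ < z.im) (h2 : z.im ≤ π / 2) :
    h / 2 < (ε z).re := by
  rcases le_or_gt ((π + γ) / 4) z.im with h3 | h3
  · linarith [dressed_re_gt_of_far hγ hγ' hJ hh H h1 h3 h2]
  have ha := one_sub_div_pi_pos hγ'
  have hpa := pi_mul_one_sub γ
  have him : (z - γ / 2 * I).im = z.im - γ / 2 := by simp
  have e1 : γ / 2 - (z.im - γ / 2) = -(z.im - γ) := by ring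
  have e2 : γ / 2 + (z.im - γ / 2) = z.im := by ring
  rw [dressed_eq_of_gt hγ hγ' H.pos.le H.dressed h1 h2, add_re, h_div_one_sub hγ hγ',
    outerPotential_re' hγ hγ' hJ hh H, him, e1, e2]
  · simp only [realKernel_neg_param, neg_mul]
    rw [integral_neg]
    -- γ < Im z < (π + γ)/4 forces 3γ < π and hence 2 Im z < π - γ. So the kernel of parameter Im z
    -- is positive and may be dropped, while the other one costs less than h/2.
    have b1 := (integral_realKernel_mul_outerRe_bounds hγ hγ' hJ hh H (θ := z.im) (by linarith)
      (by linarith) (z - γ / 2 * I).re).1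
    have b2 := (integral_realKernel_mul_outerRe_bounds hγ hγ' hJ hh H (θ := z.im - γ)
      (by linarith) (by linarith) (z - γ / 2 * I).re).2
    have b3 : 0 < h * (γ / (π - γ)) := mul_pos hh (div_pos hγ (by linarith))
    have b4 : 0 < h * (2 * (z.im - γ) / (π - γ)) :=
      mul_pos hh (div_pos (by linarith) (by linarith))
    linarith
  · rw [him, e1, neg_div, Real.sin_neg]
    exact neg_ne_zero.2 (sin_div_ne_zero ha (by linarith) (by linarith))
  · rw [him, e2]
    exact sin_div_ne_zero ha (by linarith) (by linarith)

theorem dressed_re_abs (hγ : 0 < γ) (hγ' : γ < π / 2) (hQ : 0 ≤ Q)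
    (H : IsDressedEnergyAt γ J h Q ε) {z : ℂ} (h1 : z ∈ domainUpsilon γ Q) (h2 : z ∉ barePoles γ) :
    (ε (((-z.re : ℝ) : ℂ) + z.im * I)).re = (ε z).re ∧
      (ε (((-z.re : ℝ) : ℂ) + z.im * I)).im = -(ε z).im := by
  have e : ((-z.re : ℝ) : ℂ) + z.im * I = -(starRingEnd ℂ) z := by
    apply Complex.ext <;> simp
  rw [e, dressed_neg hγ hγ' hQ H (conj_mem_domainUpsilon h1) (conj_not_mem_barePoles h2),
    dressed_conj hγ hγ' hQ H h1 h2]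
  simp

theorem dressed_re_lt' (hγ : 0 < γ) (hγ' : γ < π / 2) (hJ : 0 < J)
    (H : IsDressedEnergy γ J h Q ε) {z : ℂ} (hz : |z.im| < γ / 2) : (ε z).re < h := by
  rcases le_total 0 z.re with hx | hx
  · have := dressed_re_lt hγ hγ' hJ H hz hx
    rwa [re_add_im_mul_I] at this
  · have := dressed_re_lt hγ hγ' hJ H hz (x := -z.re) (by linarith)
    rwa [(dressed_re_abs hγ hγ' H.pos.le H.dressed
      (mem_domainUpsilon_of_im hγ hγ' (by linarith) (by linarith))
      (not_mem_barePoles_of_im hγ hγ' (by linarith) hz.ne)).1] at this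

/-- The dressed energy between its pole and the cut. -/
theorem dressed_re_gt_of_lt (hγ : 0 < γ) (hγ' : γ < π / 2) (hJ : 0 < J) (hh : 0 < h)
    (H : IsDressedEnergy γ J h Q ε) {z : ℂ} (h1 : γ / 2 < z.im) (h2 : z.im < γ) :
    min (h / 2) (h * γ / (π - γ)) < (ε z).re := by
  have ha := one_sub_div_pi_pos hγ'
  have hpa := pi_mul_one_sub γ
  have him : (z - γ / 2 * I).im = z.im - γ / 2 := by simp
  have e1 : γ / 2 - (z.im - γ / 2) = γ - z.im := by ring
  have e2 : γ / 2 + (z.im - γ / 2) = z.im := by ring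
  have hsum := congrArg re (dressed_add_dressed_eq hγ hγ' H.pos.le H.dressed h1 h2)
  rw [add_re, add_re, h_div_one_sub hγ hγ', outerPotential_re' hγ hγ' hJ hh H
    (by rw [him, e1]; exact sin_div_ne_zero ha (by linarith) (by linarith))
    (by rw [him, e2]; exact sin_div_ne_zero ha (by linarith) (by linarith)), him, e1, e2] at hsum
  have hlt : (ε (z - γ * I)).re < h := dressed_re_lt' hγ hγ' hJ H (by
    have : (z - γ * I).im = z.im - γ := by simp
    rw [this, abs_lt]
    constructor <;> linarith)
  have hpos : 0 < π - γ := by linarith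
  have b1 := (integral_realKernel_mul_outerRe_bounds hγ hγ' hJ hh H (θ := γ - z.im) (by linarith)
    (by linarith) (z - γ / 2 * I).re).1
  -- Since Re ε(z - iγ) < h, the sum identity leaves hγ/(π - γ) plus half the sum of two integrals.
  -- The integral with parameter γ - Im z is nonnegative. The kernel with parameter Im z is
  -- positive, zero or negative according to the sign of π - γ - 2 Im z.
  rcases lt_trichotomy (2 * z.im) (π - γ) with h3 | h3 | h3
  · have b2 := (integral_realKernel_mul_outerRe_bounds hγ hγ' hJ hh H (θ := z.im) (by linarith)
      h3 (z - γ / 2 * I).re).1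
    refine (min_le_right _ _).trans_lt ?_
    rw [mul_div_assoc]
    linarith
  · have b2 : ∫ μ, realKernel (1 - γ / π) z.im ((z - γ / 2 * I).re - μ) *
        outerRe Q (fun t : ℝ => (ε t).re) μ = 0 := by
      have e3 : 2 * z.im / (1 - γ / π) = π := by rw [div_eq_iff ha.ne', h3, hpa]
      simp [realKernel, e3]
    refine (min_le_right _ _).trans_lt ?_
    rw [mul_div_assoc]
    linarith
  · have b2 := (integral_realKernel_mul_outerRe_bounds hγ hγ' hJ hh H (θ := π - γ - z.im)
      (by linarith) (by linarith) (z - γ / 2 * I).re).2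
    rw [← hpa] at b2
    simp only [realKernel_period_sub ha.ne', neg_mul] at b2
    rw [integral_neg, hpa] at b2
    refine (min_le_left _ _).trans_lt ?_
    have e4 : h * (1 - 2 * (π - γ - z.im) / (π - γ)) = h * (2 * z.im / (π - γ) - 1) := by
      field_simp
      ring
    rw [e4] at b2
    -- In the negative case the lower bound exceeds h/2 by exactly h(γ - Im z)/(π - γ).
    have e5 : h * (1 + γ / (π - γ)) - 1 / 2 * (h * (2 * z.im / (π - γ) - 1)) - h - h / 2 =
        h * ((γ - z.im) / (π - γ)) := by
      field_simp
      ring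
    have b3 : 0 < h * ((γ - z.im) / (π - γ)) := mul_pos hh (div_pos (by linarith) hpos)
    linarith

theorem differentiableAt_dressed_of_re (hQ : 0 ≤ Q)
    (H : IsDressedEnergyAt γ J h Q ε) {z : ℂ} (hz : Q < |z.re|) : DifferentiableAt ℂ ε z := by
  have hne : ∀ w : ℂ, Q < |w.re| → w.re ≠ 0 := fun w hw h0 => by
    rw [h0, abs_zero] at hw
    linarith
  have hopen : {w : ℂ | Q < |w.re|} ∈ 𝓝 z :=
    (isOpen_lt continuous_const (by fun_prop)).mem_nhds hz
  have e : ε =ᶠ[𝓝 z] fun z => h - ((4 * π * J * Real.sin γ : ℝ) : ℂ) * stripKernel 1 (γ / 2) z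
      - ∫ μ in (-Q)..Q, stripKernel 1 γ (z - μ) * ε μ := by
    filter_upwards [hopen] with w hw
    exact dressed_equation H (mem_domainUpsilon_of_re hw) (not_mem_barePoles_of_re (hne w hw))
  refine DifferentiableAt.congr_of_eventuallyEq ?_ e
  have hr : z ∈ regularSet 1 (γ / 2) := mem_regularSet_of_re one_ne_zero (hne z hz)
  refine ((differentiableAt_const _).sub ((differentiableAt_stripKernel hr.1 hr.2).const_mul _)).sub
    (differentiableAt_dressed_integral hQ H fun μ hμ => mem_regularSet_of_re one_ne_zero ?_)
  rw [sub_re, ofReal_re]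
  intro h0
  rw [sub_eq_zero.1 h0] at hz
  exact absurd (abs_le.2 hμ) (not_le.2 hz)

theorem dressed_re_pos_of_im_pos (hγ : 0 < γ) (hγ' : γ < π / 2) (hJ : 0 < J) (hh : 0 < h)
    (H : IsDressedEnergy γ J h Q ε) {z : ℂ} (hd : z ∈ domainUpsilon γ Q) (h1 : γ / 2 < z.im)
    (h2 : z.im ≤ π / 2) : 0 < (ε z).re := by
  have hmin : 0 < min (h / 2) (h * γ / (π - γ)) :=
    lt_min (half_pos hh) (div_pos (mul_pos hh hγ) (by linarith))
  rcases lt_trichotomy z.im γ with h3 | h3 | h3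
  · exact hmin.trans (dressed_re_gt_of_lt hγ hγ' hJ hh H h1 h3)
  · have hz : Q < |z.re| := by
      by_contra hc
      refine (hd z.re (abs_le.1 (not_lt.1 hc)) 0).1 ?_
      apply Complex.ext <;> simp [h3]
    have hc := (differentiableAt_dressed_of_re H.pos.le H.dressed hz).continuousAt
    -- On the line Im z = γ itself, points of the domain lie outside the cut, where ε is continuous;
    -- the positive lower bound from just below carries over in the limit.
    have hc2 : ContinuousAt (fun t : ℝ => (ε (z - t * I)).re) 0 := by
      refine continuous_re.continuousAt.comp (ContinuousAt.comp (g := ε) ?_ (by fun_prop))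
      simpa using hc
    have hl : Tendsto (fun t : ℝ => (ε (z - t * I)).re) (𝓝[>] 0) (𝓝 (ε z).re) := by
      have := hc2.tendsto.mono_left (nhdsWithin_le_nhds (s := Ioi 0))
      simpa using this
    refine hmin.trans_le (ge_of_tendsto hl ?_)
    filter_upwards [Ioo_mem_nhdsGT (half_pos hγ)] with t ht
    refine (dressed_re_gt_of_lt hγ hγ' hJ hh H ?_ ?_).le
    · simp; linarith [ht.2]
    · simp; linarith [ht.1]
  · linarith [dressed_re_gt_of_gt hγ hγ' hJ hh H h3 h2]

theorem dressed_re_pos (hγ : 0 < γ) (hγ' : γ < π / 2) (hJ : 0 < J) (hh : 0 < h)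
    (H : IsDressedEnergy γ J h Q ε) {z : ℂ} (hz : z ∈ cylinderS γ Q) (h1 : γ / 2 < |z.im|) :
    0 < (ε z).re := by
  obtain ⟨hd, h2, h3⟩ := hz
  rcases le_total 0 z.im with h0 | h0
  · rw [abs_of_nonneg h0] at h1
    exact dressed_re_pos_of_im_pos hγ hγ' hJ hh H hd h1 h3.le
  · have habs : |z.im| = -z.im := abs_of_nonpos h0
    have hnp := not_mem_barePoles_of_im hγ hγ' (z := z) (abs_le.2 ⟨h2, h3.le⟩) h1.ne'
    have h4 := dressed_re_pos_of_im_pos hγ hγ' hJ hh H (conj_mem_domainUpsilon hd)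
      (by rw [conj_im, ← habs]; exact h1) (by rw [conj_im]; linarith)
    rwa [dressed_conj hγ hγ' H.pos.le H.dressed hd hnp, conj_re] at h4

theorem constIntegrand_eq (hγ : 0 < γ) (hγ' : γ < π / 2) (μ : ℝ) :
    constIntegrand γ ε μ =
      (1 - γ / π) * (realKernel (1 - γ / π) (γ / 2) μ * (ε μ).re) := by
  have ha := (one_sub_div_pi_pos hγ').ne'
  rw [constIntegrand, ofReal_div, kernelK_div _ ha, stripKernel_real_outer hγ hγ', mul_assoc,
    re_ofReal_mul, re_ofReal_mul]

theorem integrableOn_constIntegrand (hγ : 0 < γ) (hγ' : γ < π / 2)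
    (H : IsDressedEnergy γ J h Q ε) : IntegrableOn (constIntegrand γ ε) (Ioi Q) := by
  obtain ⟨M, hM⟩ := exists_bound_dressed_re hγ hγ' H.pos.le H.dressed
  have h1 : Integrable (fun μ : ℝ => (1 - γ / π) *
      (realKernel (1 - γ / π) (γ / 2) μ * (ε μ).re)) :=
    ((integrable_realKernel_outer hγ hγ').mul_bdd
      (continuous_dressed_re hγ hγ' H.pos.le H.dressed).aestronglyMeasurable
      (Eventually.of_forall hM)).const_mul _
  have e : constIntegrand γ ε = fun μ : ℝ => (1 - γ / π) *
      (realKernel (1 - γ / π) (γ / 2) μ * (ε μ).re) := funext (constIntegrand_eq hγ hγ')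
  rw [e]
  exact h1.integrableOn

theorem potential_zero (hγ : 0 < γ) (hγ' : γ < π / 2) (H : IsDressedEnergy γ J h Q ε) :
    potential γ Q (fun t : ℝ => (ε t).re) 0 =
      2 * ∫ μ in Ioi Q, realKernel (1 - γ / π) (γ / 2) μ * (ε μ).re := by
  obtain ⟨M, hM⟩ := exists_bound_dressed_re hγ hγ' H.pos.le H.dressed
  have hi : Integrable (fun μ : ℝ => realKernel (1 - γ / π) (γ / 2) μ * (ε μ).re) :=
    (integrable_realKernel_outer hγ hγ').mul_bdd
      (continuous_dressed_re hγ hγ' H.pos.le H.dressed).aestronglyMeasurable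
      (Eventually.of_forall hM)
  have e : (fun μ : ℝ => realKernel (1 - γ / π) (γ / 2) (0 - μ) *
      outerRe Q (fun t : ℝ => (ε t).re) μ) = indicator (Icc (-Q) Q)ᶜ
        (fun μ : ℝ => realKernel (1 - γ / π) (γ / 2) μ * (ε μ).re) := by
    funext μ
    rw [zero_sub, realKernel_neg]
    by_cases hμ : μ ∈ (Icc (-Q) Q)ᶜ
    · rw [outerRe, indicator_of_mem hμ, indicator_of_mem hμ]
    · rw [outerRe, indicator_of_notMem hμ, indicator_of_notMem hμ, mul_zero]
  have hs : (Icc (-Q) Q)ᶜ = Iio (-Q) ∪ Ioi Q := by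
    ext μ
    simp only [mem_compl_iff, mem_Icc, not_and_or, not_le, mem_union, mem_Iio, mem_Ioi]
  have hdisj : Disjoint (Iio (-Q)) (Ioi Q) := by
    rw [Set.disjoint_left]
    intro μ h1 h2
    rw [mem_Iio] at h1
    rw [mem_Ioi] at h2
    linarith [H.pos]
  rw [potential, e, integral_indicator measurableSet_Icc.compl, hs,
    setIntegral_union hdisj measurableSet_Ioi hi.integrableOn hi.integrableOn,
    ← integral_Iic_eq_integral_Iio, ← integral_comp_neg_Ioi Q
      (fun μ : ℝ => realKernel (1 - γ / π) (γ / 2) μ * (ε μ).re)]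
  simp only [realKernel_neg, dressed_re_neg hγ hγ' H.pos.le H.dressed]
  ring

/-- In this form c is half the right-hand side of `dressed_add_dressed_eq` at z = iγ/2, which is how
it enters the expansion at the pole. The integral over (Q, ∞) in c is half of the potential at 0 by
evenness, up to the rescaling factor of the kernel. -/
theorem constC_eq (hγ : 0 < γ) (hγ' : γ < π / 2) (H : IsDressedEnergy γ J h Q ε) :
    constC γ h Q ε =
      (h / (1 - γ / π) + potential γ Q (fun t : ℝ => (ε t).re) 0) / 2 := by
  have ha := (one_sub_div_pi_pos hγ').ne'
  rw [constC, potential_zero hγ hγ' H]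
  simp only [constIntegrand_eq hγ hγ']
  rw [integral_const_mul, mul_add, ← mul_assoc (1 / (1 - γ / π)), one_div_mul_cancel ha]
  ring

theorem constC_pos (hγ : 0 < γ) (hγ' : γ < π / 2) (hJ : 0 < J) (hh : 0 < h)
    (H : IsDressedEnergy γ J h Q ε) : 0 < constC γ h Q ε := by
  rw [constC_eq hγ hγ' H]
  have h1 := (potential_bounds hγ hγ' hJ hh H 0).1
  have h2 : 0 < h / (1 - γ / π) := div_pos hh (one_sub_div_pi_pos hγ')
  linarith

end Dressed

/-! ### The curve of zeros of the real part -/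

section Dressed

variable {γ J h Q : ℝ} {ε : ℂ → ℂ} {X : ℝ → ℝ}

theorem dressed_imag_axis_neg' (hγ : 0 < γ) (hγ' : γ < π / 2) (hJ : 0 < J)
    (H : IsDressedEnergy γ J h Q ε) {y : ℝ} (hy : |y| < γ / 2) : (ε (y * I)).re < 0 := by
  rcases le_total 0 y with h0 | h0
  · exact dressed_imag_axis_neg hγ hγ' hJ H h0 (by rwa [abs_of_nonneg h0] at hy)
  · have him : ((y : ℂ) * I).im = y := by simp
    have h1 := dressed_imag_axis_neg hγ hγ' hJ H (y := -y) (by linarith)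
      (by rwa [abs_of_nonpos h0] at hy)
    rwa [ofReal_neg, neg_mul, dressed_neg hγ hγ' H.pos.le H.dressed
      (mem_domainUpsilon_of_im hγ hγ' (by rw [him]; linarith) (by rw [him]; linarith))
      (not_mem_barePoles_of_im hγ hγ' (by rw [him]; linarith) (by rw [him]; exact hy.ne))] at h1

theorem exists_dressed_zero (hγ : 0 < γ) (hγ' : γ < π / 2) (hJ : 0 < J) (hh : 0 < h)
    (H : IsDressedEnergy γ J h Q ε) {y : ℝ} (hy : |y| < γ / 2) :
    ∃ x : ℝ, 0 < x ∧ (ε (x + y * I)).re = 0 := by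
  have hlim : Tendsto (fun x : ℝ => (ε (x + y * I)).re) atTop (𝓝 h) :=
    (continuous_re.tendsto _).comp (tendsto_dressed_line hγ hγ' H.pos.le H.dressed y)
  obtain ⟨b, hb0, hb⟩ :=
    ((eventually_ge_atTop (0 : ℝ)).and (hlim.eventually (lt_mem_nhds hh))).exists
  have hc : Continuous (fun x : ℝ => (ε (x + y * I)).re) :=
    continuous_iff_continuousAt.2 fun x =>
      (hasDerivAt_re (hasDerivAt_dressed_line hγ hγ' H.pos.le H.dressed hy x)).continuousAt
  have h0 := dressed_imag_axis_neg' hγ hγ' hJ H hy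
  obtain ⟨x, hx, hx0⟩ := intermediate_value_Icc hb0 hc.continuousOn
    ⟨by simpa using h0.le, le_of_lt hb⟩
  refine ⟨x, hx.1.lt_of_ne fun h' => ?_, hx0⟩
  rw [← h'] at hx0
  simp only [ofReal_zero, zero_add] at hx0
  exact h0.ne hx0

/-- The positive zeros of the real part of the dressed energy on horizontal lines. -/
def IsZeroCurve (γ : ℝ) (ε : ℂ → ℂ) (X : ℝ → ℝ) : Prop :=
  ∀ y, |y| < γ / 2 → 0 < X y ∧ (ε (X y + y * I)).re = 0

theorem exists_isZeroCurve (hγ : 0 < γ) (hγ' : γ < π / 2) (hJ : 0 < J) (hh : 0 < h)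
    (H : IsDressedEnergy γ J h Q ε) : ∃ X, IsZeroCurve γ ε X := by
  have := fun y (hy : |y| < γ / 2) => exists_dressed_zero hγ hγ' hJ hh H hy
  choose! X hX using this
  exact ⟨X, hX⟩

theorem IsZeroCurve.eq_iff (hγ : 0 < γ) (hγ' : γ < π / 2) (hJ : 0 < J)
    (H : IsDressedEnergy γ J h Q ε) (hX : IsZeroCurve γ ε X) {y : ℝ} (hy : |y| < γ / 2) {x : ℝ}
    (hx : 0 ≤ x) : (ε (x + y * I)).re = 0 ↔ x = X y := by
  have h1 := hX y hy
  have h2 := (dressed_strictMonoOn hγ hγ' hJ H hy).eq_iff_eq (a := x) (b := X y) hx h1.1.le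
  rw [h1.2] at h2
  exact h2

theorem IsZeroCurve.lt_iff (hγ : 0 < γ) (hγ' : γ < π / 2) (hJ : 0 < J)
    (H : IsDressedEnergy γ J h Q ε) (hX : IsZeroCurve γ ε X) {y : ℝ} (hy : |y| < γ / 2) {x : ℝ}
    (hx : 0 ≤ x) : 0 < (ε (x + y * I)).re ↔ X y < x := by
  have h1 := hX y hy
  have h2 := (dressed_strictMonoOn hγ hγ' hJ H hy).lt_iff_lt (a := X y) (b := x) h1.1.le hx
  rw [h1.2] at h2
  exact h2

theorem contDiffAt_dressed (hγ : 0 < γ) (hγ' : γ < π / 2) (hQ : 0 ≤ Q)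
    (H : IsDressedEnergyAt γ J h Q ε) {z : ℂ} (hz : |z.im| < γ / 2) :
    ContDiffAt ℝ ∞ ε z := by
  have hopen : {w : ℂ | |w.im| < γ / 2} ∈ 𝓝 z :=
    (isOpen_lt (by fun_prop) continuous_const).mem_nhds hz
  have hd : DifferentiableOn ℂ ε {w : ℂ | |w.im| < γ / 2} := fun w hw =>
    (differentiableAt_dressed hγ hγ' hQ H hw).differentiableWithinAt
  have h1 : ContDiffAt ℂ ∞ ε z := (hd.analyticAt hopen).contDiffAt
  exact h1.restrict_scalars ℝ

/-- The implicit function theorem applies because the x-derivative of Re ε is positive at the zero.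
Uniqueness of the positive zero on each line identifies the local implicit function with X. The
curve is defined for |y| < γ/2, so y = 0 is an interior point. -/
theorem IsZeroCurve.contDiffAt (hγ : 0 < γ) (hγ' : γ < π / 2) (hJ : 0 < J)
    (H : IsDressedEnergy γ J h Q ε) (hX : IsZeroCurve γ ε X) {y : ℝ} (hy : |y| < γ / 2) :
    ContDiffAt ℝ ∞ X y := by
  set f : ℝ × ℝ → ℝ := fun p => (ε (p.2 + p.1 * I)).re with hf
  set u : ℝ × ℝ := (y, X y) with hu
  have cdf : ContDiffAt ℝ ∞ f u := by
    have h1 := contDiffAt_dressed hγ hγ' H.pos.le H.dressed (z := X y + y * I) (by simpa using hy)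
    have h2 : ContDiffAt ℝ ∞ (fun p : ℝ × ℝ => (p.2 + p.1 * I : ℂ)) u :=
      (ofRealCLM.contDiff.contDiffAt.comp u contDiffAt_snd).add
        ((ofRealCLM.contDiff.contDiffAt.comp u contDiffAt_fst).mul contDiffAt_const)
    have h3 : ContDiffAt ℝ ∞ (fun p : ℝ × ℝ => ε (p.2 + p.1 * I)) u :=
      ContDiffAt.comp (f := fun p : ℝ × ℝ => (p.2 + p.1 * I : ℂ)) u h1 h2
    exact reCLM.contDiff.contDiffAt.comp u h3
  have pn : (∞ : WithTop ℕ∞) ≠ 0 := by simp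
  have hpos := deriv_dressed_re_pos hγ hγ' hJ H hy (hX y hy).1
  have hd : HasDerivAt (fun x : ℝ => f (y, x)) ((fderiv ℝ f u ∘L .inr ℝ ℝ ℝ) 1) (X y) := by
    have h1 := (cdf.differentiableAt pn).hasFDerivAt
    have h2 : HasDerivAt (fun x : ℝ => ((y, x) : ℝ × ℝ)) (0, 1) (X y) :=
      (hasDerivAt_const _ _).prodMk (hasDerivAt_id _)
    exact h1.comp_hasDerivAt (X y) h2
  have hval : (fderiv ℝ f u ∘L .inr ℝ ℝ ℝ) 1 = (deriv ε (X y + y * I)).re :=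
    hd.unique (hasDerivAt_re (hasDerivAt_dressed_line hγ hγ' H.pos.le H.dressed hy (X y)))
  have if₂ : (fderiv ℝ f u ∘L .inr ℝ ℝ ℝ).IsInvertible := by
    refine ⟨ContinuousLinearEquiv.unitsEquivAut ℝ (Units.mk0 _ hpos.ne'), ?_⟩
    ext
    rw [hval]
    simp
  refine (cdf.contDiffAt_implicitFunction pn if₂).congr_of_eventuallyEq ?_
  have hself := cdf.implicitFunction_apply_self pn if₂
  have hcont := (cdf.contDiffAt_implicitFunction pn if₂).continuousAt
  have hev1 : ∀ᶠ s in 𝓝 y, 0 < cdf.implicitFunction pn if₂ s :=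
    hcont.eventually (lt_mem_nhds (by rw [hself]; exact (hX y hy).1))
  have hev2 : ∀ᶠ s : ℝ in 𝓝 y, |s| < γ / 2 :=
    continuous_abs.continuousAt.eventually (gt_mem_nhds hy)
  filter_upwards [hev1, hev2, cdf.eventually_apply_implicitFunction pn if₂] with s h1 h2 h3
  have h4 : f u = 0 := (hX y hy).2
  rw [h4] at h3
  exact ((hX.eq_iff hγ hγ' hJ H h2 h1.le).1 h3).symm

/-- The imaginary part grows along the curve on which the real part vanishes. -/
theorem IsZeroCurve.hasDerivAt_im (hγ : 0 < γ) (hγ' : γ < π / 2) (hJ : 0 < J)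
    (H : IsDressedEnergy γ J h Q ε) (hX : IsZeroCurve γ ε X) {y : ℝ} (hy : |y| < γ / 2) :
    ∃ d, 0 < d ∧ HasDerivAt (fun s : ℝ => (ε (X s + s * I)).im) d y := by
  have hXd := ((hX.contDiffAt hγ hγ' hJ H hy).differentiableAt (by simp)).hasDerivAt
  have hpos := deriv_dressed_re_pos hγ hγ' hJ H hy (hX y hy).1
  have h1 := (differentiableAt_dressed hγ hγ' H.pos.le H.dressed (z := X y + y * I)
    (by simpa using hy)).hasDerivAt
  have h2 : HasDerivAt (fun s : ℝ => (X s + s * I : ℂ)) (deriv X y + I) y :=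
    (hXd.ofReal_comp.add ((hasDerivAt_id y).ofReal_comp.mul_const I)).congr_deriv (by simp)
  have h3 : HasDerivAt (fun s : ℝ => ε (X s + s * I))
      (deriv ε (X y + y * I) * (deriv X y + I)) y := h1.comp y h2
  have h4 := hasDerivAt_re h3
  have h5 : HasDerivAt (fun s : ℝ => (ε (X s + s * I)).re) 0 y := by
    refine (hasDerivAt_const y (0 : ℝ)).congr_of_eventuallyEq ?_
    filter_upwards [continuous_abs.continuousAt.eventually (gt_mem_nhds hy)] with s hs
    exact (hX s hs).2
  have h6 := h4.unique h5
  refine ⟨_, ?_, XXZ.hasDerivAt_im h3⟩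
  set p := deriv ε (X y + y * I)
  simp only [mul_re, mul_im, add_re, add_im, ofReal_re, ofReal_im, I_re, I_im] at h6 ⊢
  -- Vanishing of Re ε along the curve gives Re ε' · X' = Im ε'. Multiplying the derivative of Im ε
  -- along the curve by Re ε' > 0 then yields |ε'|².
  have h7 : p.re * deriv X y = p.im := by linarith
  have h8 : 0 < p.re * (p.re * (0 + 1) + p.im * (deriv X y + 0)) := by
    have : p.re * (p.re * (0 + 1) + p.im * (deriv X y + 0)) = p.re ^ 2 + p.im ^ 2 := by
      rw [← h7]; ring
    rw [this]
    positivity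
  exact pos_of_mul_pos_right h8 hpos.le |>.trans_eq rfl

theorem IsZeroCurve.zero (hγ : 0 < γ) (hγ' : γ < π / 2) (hJ : 0 < J)
    (H : IsDressedEnergy γ J h Q ε) (hX : IsZeroCurve γ ε X) : X 0 = Q := by
  refine ((hX.eq_iff hγ hγ' hJ H (y := 0) (by simpa using hγ) H.pos.le).1 ?_).symm
  simp [H.fermi]

theorem IsZeroCurve.strictMonoOn_im (hγ : 0 < γ) (hγ' : γ < π / 2) (hJ : 0 < J)
    (H : IsDressedEnergy γ J h Q ε) (hX : IsZeroCurve γ ε X) :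
    StrictMonoOn (fun s : ℝ => (ε (X s + s * I)).im) (Ico 0 (γ / 2)) := by
  have habs : ∀ s ∈ Ico 0 (γ / 2), |s| < γ / 2 := fun s hs => by
    rw [abs_of_nonneg hs.1]; exact hs.2
  refine strictMonoOn_of_deriv_pos (convex_Ico _ _) (fun s hs => ?_) (fun s hs => ?_)
  · obtain ⟨d, _, hd⟩ := hX.hasDerivAt_im hγ hγ' hJ H (habs s hs)
    exact hd.continuousAt.continuousWithinAt
  · obtain ⟨d, hd0, hd⟩ := hX.hasDerivAt_im hγ hγ' hJ H (habs s (interior_subset hs))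
    rw [hd.deriv]
    exact hd0

end Dressed

/-! ### Laurent expansion at the pole iγ/2 -/

/-- w coth w = cosh w / (sinh w / w) extends differentiably to 0 with value 1, and its difference
quotient there is coth w - 1/w. Only the existence of the limit is needed. -/
theorem exists_tendsto_cothKernel_sub_inv :
    ∃ L, Tendsto (fun w => cothKernel 1 w - 1 / (2 * π * I) * w⁻¹) (𝓝[≠] 0) (𝓝 L) := by
  set p : ℂ → ℂ := fun w => cosh w * (dslope sinh 0 w)⁻¹ with hp
  have hds : dslope sinh 0 0 = 1 := by
    rw [dslope_same, Complex.deriv_sinh, Complex.cosh_zero]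
  have hd : DifferentiableAt ℂ (dslope sinh 0) 0 :=
    ((differentiableOn_dslope univ_mem).2 Complex.differentiable_sinh.differentiableOn).differentiableAt
      univ_mem
  have hpd : DifferentiableAt ℂ p 0 :=
    Complex.differentiable_cosh.differentiableAt.mul (hd.inv (by rw [hds]; exact one_ne_zero))
  have hs := hasDerivAt_iff_tendsto_slope.1 hpd.hasDerivAt
  refine ⟨_, (hs.const_mul (1 / (2 * π * I))).congr' ?_⟩
  filter_upwards [self_mem_nhdsWithin] with w hw
  have hw : w ≠ 0 := hw
  rw [slope_def_field]
  simp only [hp]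
  rw [hds, dslope_of_ne _ hw, slope_def_field, Complex.sinh_zero, Complex.cosh_zero, cothKernel]
  simp only [sub_zero, inv_one, mul_one, ofReal_one, div_one, inv_div]
  have e : (cosh w * (w / sinh w) - 1) / w = cosh w * (sinh w)⁻¹ - w⁻¹ := by
    rw [sub_div, mul_div_assoc, div_right_comm, div_self hw, one_div, one_div]
  rw [e]
  ring

section Dressed

variable {γ J h Q : ℝ} {ε : ℂ → ℂ} {X : ℝ → ℝ}

/-- Among all terms of the equation only coth(z - iγ/2) is singular at iγ/2, and its coefficient
gives the residue 2iJ sin γ. The limit L is identified later by a symmetry argument instead of being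
computed here. -/
theorem exists_tendsto_dressed_sub_pole (hγ : 0 < γ) (hγ' : γ < π / 2) (hQ : 0 ≤ Q)
    (H : IsDressedEnergyAt γ J h Q ε) :
    ∃ L, Tendsto (fun w => ε (γ / 2 * I + w) - ((2 * J * Real.sin γ : ℝ) : ℂ) * I * w⁻¹)
      (𝓝[≠] 0) (𝓝 L) := by
  obtain ⟨L, hL⟩ := exists_tendsto_cothKernel_sub_inv
  have h1 : Tendsto (fun w : ℂ => cothKernel 1 (γ * I + w)) (𝓝[≠] 0) (𝓝 (cothKernel 1 (γ * I))) := by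
    have hd : DifferentiableAt ℂ (cothKernel 1) (γ * I + 0) := by
      refine differentiableAt_cothKernel ?_
      refine sinh_div_ne_zero_of_sin ?_
      simpa using sin_ne_zero_of_Ioo hγ (by linarith)
    have hc : ContinuousAt (fun w : ℂ => cothKernel 1 (γ * I + w)) 0 :=
      ContinuousAt.comp (g := cothKernel 1) hd.continuousAt (by fun_prop)
    have := hc.tendsto.mono_left (nhdsWithin_le_nhds (s := {0}ᶜ))
    simpa using this
  have h2 : Tendsto (fun w : ℂ => ∫ μ in (-Q)..Q, stripKernel 1 γ (γ / 2 * I + w - μ) * ε μ)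
      (𝓝[≠] 0) (𝓝 (∫ μ in (-Q)..Q, stripKernel 1 γ (γ / 2 * I - μ) * ε μ)) := by
    have habs : |γ / 2| < γ := by rw [abs_of_pos (half_pos hγ)]; linarith
    have hd := differentiableAt_dressed_integral hQ H (z := γ / 2 * I + 0) (fun μ _ =>
      sub_mem_regularSet_of_im hγ' (by simpa using habs) μ)
    have hc : ContinuousAt
        (fun w : ℂ => ∫ μ in (-Q)..Q, stripKernel 1 γ (γ / 2 * I + w - μ) * ε μ) 0 :=
      ContinuousAt.comp (g := fun z : ℂ => ∫ μ in (-Q)..Q, stripKernel 1 γ (z - μ) * ε μ)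
        hd.continuousAt (by fun_prop)
    have := hc.tendsto.mono_left (nhdsWithin_le_nhds (s := {0}ᶜ))
    simpa using this
  refine ⟨_, ((((hL.sub h1).const_mul
    ((4 * π * J * Real.sin γ : ℝ) : ℂ)).const_sub (h : ℂ)).sub h2).congr' ?_⟩
  have hev : ∀ᶠ w : ℂ in 𝓝[≠] 0, |w.im| < γ / 2 := by
    refine Filter.Eventually.filter_mono nhdsWithin_le_nhds ?_
    exact (continuous_im.abs.tendsto (0 : ℂ)).eventually (gt_mem_nhds (by simpa using hγ))
  filter_upwards [self_mem_nhdsWithin, hev] with w hw hwi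
  have hw : w ≠ 0 := hw
  have hwi' := abs_lt.1 hwi
  have him : (γ / 2 * I + w : ℂ).im = γ / 2 + w.im := by simp
  have hre : (γ / 2 * I + w : ℂ).re = w.re := by simp
  have hpos : 0 < γ / 2 + w.im := by linarith
  have hpole : (γ / 2 * I + w : ℂ) ∉ barePoles γ := by
    by_cases h0 : w.re = 0
    · refine not_mem_barePoles_of_im hγ hγ' ?_ ?_
      · rw [him, abs_of_pos hpos]; linarith
      · rw [him, abs_of_pos hpos]
        intro h3
        exact hw (Complex.ext h0 (by rw [zero_im]; linarith))
    · exact not_mem_barePoles_of_re (by rwa [hre])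
  have hdom : (γ / 2 * I + w : ℂ) ∈ domainUpsilon γ Q :=
    mem_domainUpsilon_of_im hγ hγ' (by rw [him, abs_of_pos hpos]; linarith)
      (by rw [him, abs_of_pos hpos]; linarith)
  rw [dressed_equation H hdom hpole, stripKernel]
  have e1 : (γ / 2 * I + w - I * ((γ / 2 : ℝ) : ℂ) : ℂ) = w := by push_cast; ring
  have e2 : (γ / 2 * I + w + I * ((γ / 2 : ℝ) : ℂ) : ℂ) = γ * I + w := by push_cast; ring
  rw [e1, e2]
  have e3 : ((4 * π * J * Real.sin γ : ℝ) : ℂ) * (1 / (2 * π * I)) =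
      -(((2 * J * Real.sin γ : ℝ) : ℂ) * I) := by
    have hp : (π : ℂ) ≠ 0 := by exact_mod_cast Real.pi_ne_zero
    rw [mul_one_div, div_eq_iff (by simp [hp])]
    push_cast
    linear_combination (4 * π * J * Complex.sin γ) * I_mul_I
  linear_combination w⁻¹ * e3

/-- Dominated convergence: near δ = 0 the sines in `norm_stripKernel_le` stay away from 0, so a
fixed multiple of 1/cosh is a majorant. -/
theorem tendsto_outerPotential_zero (hγ : 0 < γ) (hγ' : γ < π / 2) {f : ℝ → ℂ} (hf : Measurable f)
    {M : ℝ} (hM : ∀ x, ‖f x‖ ≤ M) :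
    Tendsto (fun δ : ℝ => outerPotential γ Q f (δ * I)) (𝓝[>] 0) (𝓝 (outerPotential γ Q f 0)) := by
  have ha := one_sub_div_pi_pos hγ'
  have hs := sin_half_div_pos hγ hγ' (pi_mul_one_sub γ) ha
  set s : ℝ → ℝ := fun δ => |Real.sin ((δ - γ / 2) / (1 - γ / π))|⁻¹ *
    |Real.sin ((δ + γ / 2) / (1 - γ / π))|⁻¹ with hsd
  have hn1 : Real.sin ((0 - γ / 2) / (1 - γ / π)) ≠ 0 := by
    rw [zero_sub, neg_div, Real.sin_neg]
    exact neg_ne_zero.2 hs.ne'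
  have hn2 : Real.sin ((0 + γ / 2) / (1 - γ / π)) ≠ 0 := by
    rw [zero_add]
    exact hs.ne'
  have hc1 : Continuous (fun δ : ℝ => Real.sin ((δ - γ / 2) / (1 - γ / π))) := by fun_prop
  have hc2 : Continuous (fun δ : ℝ => Real.sin ((δ + γ / 2) / (1 - γ / π))) := by fun_prop
  have hsc : ContinuousAt s 0 :=
    (hc1.abs.continuousAt.inv₀ (abs_ne_zero.2 hn1)).mul
      (hc2.abs.continuousAt.inv₀ (abs_ne_zero.2 hn2))
  have hev1 : ∀ᶠ δ in 𝓝[>] (0 : ℝ), s δ < s 0 + 1 :=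
    (hsc.eventually (gt_mem_nhds (lt_add_one _))).filter_mono nhdsWithin_le_nhds
  have hev2 : ∀ᶠ δ in 𝓝[>] (0 : ℝ), δ < γ / 2 :=
    (gt_mem_nhds (half_pos hγ)).filter_mono nhdsWithin_le_nhds
  have hM0 : 0 ≤ M := (norm_nonneg _).trans (hM 0)
  have hp := Real.pi_pos
  refine tendsto_integral_filter_of_dominated_convergence
    (fun μ => 1 / (2 * π * (1 - γ / π)) * (s 0 + 1) *
      (Real.cosh ((1 - γ / π)⁻¹ * (0 - μ)))⁻¹ * M) ?_ ?_ ?_ ?_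
  · filter_upwards [hev2, self_mem_nhdsWithin] with δ h1 h2
    have h2 : 0 < δ := h2
    refine (integrable_line_mul (F := stripKernel (1 - γ / π) (γ / 2)) (z := δ * I) ?_
      (measurable_outer hf) (norm_outer_le hM)).aestronglyMeasurable
    have him : ((δ : ℂ) * I).im = δ := by simp
    rw [him]
    refine integrable_stripKernel ha ?_ ?_
    · rw [← neg_sub, neg_div, Real.sin_neg]
      exact neg_ne_zero.2 (sin_div_ne_zero ha (by linarith)
        (by rw [pi_mul_one_sub]; linarith))
    · exact sin_div_ne_zero ha (by linarith) (by rw [pi_mul_one_sub]; linarith)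
  · filter_upwards [hev1, hev2, self_mem_nhdsWithin] with δ h1 h2 h3
    have h3 : 0 < δ := h3
    refine Eventually.of_forall fun μ => ?_
    rw [norm_mul]
    refine mul_le_mul ?_ (norm_outer_le hM μ) (norm_nonneg _) ?_
    · have him : ((δ : ℂ) * I - μ).im = δ := by simp
      have hre : ((δ : ℂ) * I - μ).re = 0 - μ := by simp
      have h4 := norm_stripKernel_le ha (θ := γ / 2) (z := δ * I - μ)
        (by rw [him, ← neg_sub, neg_div, Real.sin_neg]
            exact neg_ne_zero.2 (sin_div_ne_zero ha (by linarith)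
              (by rw [pi_mul_one_sub]; linarith)))
        (by rw [him]
            exact sin_div_ne_zero ha (by linarith) (by rw [pi_mul_one_sub]; linarith))
      rw [him, hre] at h4
      refine h4.trans (mul_le_mul_of_nonneg_right (mul_le_mul_of_nonneg_left h1.le (by positivity))
        (inv_nonneg.2 (Real.cosh_pos _).le))
    · refine mul_nonneg (mul_nonneg (by positivity) ?_) (inv_nonneg.2 (Real.cosh_pos _).le)
      have : 0 ≤ s 0 := by simp only [hsd]; positivity
      linarith
  · have h5 := ((integrable_sech_mul (inv_pos.2 ha)).comp_sub_left 0).const_mul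
      (1 / (2 * π * (1 - γ / π)) * (s 0 + 1))
    exact h5.mul_const M
  · refine Eventually.of_forall fun μ => ?_
    have hd : DifferentiableAt ℂ (stripKernel (1 - γ / π) (γ / 2)) (((0 : ℝ) : ℂ) * I - μ) :=
      differentiableAt_stripKernel_of_sin (by simpa using hn1) (by simpa using hn2)
    have hc : ContinuousAt (fun δ : ℝ => stripKernel (1 - γ / π) (γ / 2) ((δ : ℂ) * I - μ)) 0 :=
      ContinuousAt.comp (g := stripKernel (1 - γ / π) (γ / 2)) hd.continuousAt (by fun_prop)
    have h6 := (hc.tendsto.mono_left (nhdsWithin_le_nhds (s := Ioi 0))).mul_const (outer Q f μ)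
    simpa using h6

/-- Approaching the pole along w = iδ and w = -iδ, the polar terms cancel in the sum, whose limit is
2L. Evenness turns ε(iγ/2 - iδ) into ε(-iγ/2 + iδ), so `dressed_add_dressed_eq` evaluates the same
sum, and its limit is 2c. -/
theorem tendsto_dressed_sub_pole (hγ : 0 < γ) (hγ' : γ < π / 2) (H : IsDressedEnergy γ J h Q ε) :
    Tendsto (fun w => ε (γ / 2 * I + w) - ((2 * J * Real.sin γ : ℝ) : ℂ) * I * w⁻¹)
      (𝓝[≠] 0) (𝓝 (constC γ h Q ε : ℂ)) := by
  have hQ := H.pos.le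
  obtain ⟨L, hL⟩ := exists_tendsto_dressed_sub_pole hγ hγ' hQ H.dressed
  obtain ⟨M, hM⟩ := exists_bound_dressed_real hγ hγ' hQ H.dressed
  have hG := tendsto_outerPotential_zero (Q := Q) hγ hγ'
    (continuous_dressed_real hγ hγ' hQ H.dressed).measurable hM
  have hup : ∀ a : ℂ, a ≠ 0 → Tendsto (fun δ : ℝ => (δ : ℂ) * a) (𝓝[>] 0) (𝓝[≠] 0) := by
    intro a ha
    refine tendsto_nhdsWithin_iff.2 ⟨?_, ?_⟩
    · have hc : Continuous (fun δ : ℝ => (δ : ℂ) * a) := by fun_prop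
      have := (hc.tendsto 0).mono_left (nhdsWithin_le_nhds (s := Ioi 0))
      simpa using this
    · filter_upwards [self_mem_nhdsWithin] with δ hδ
      have hδ : 0 < δ := hδ
      have : (δ : ℂ) ≠ 0 := by exact_mod_cast hδ.ne'
      exact mul_ne_zero this ha
  have hsum := (hL.comp (hup I I_ne_zero)).add (hL.comp (hup (-I) (neg_ne_zero.2 I_ne_zero)))
  have hlim := hG.const_add (h / (1 - γ / π) : ℂ)
  have hev : ∀ᶠ δ in 𝓝[>] (0 : ℝ), δ < γ / 2 :=
    (gt_mem_nhds (half_pos hγ)).filter_mono nhdsWithin_le_nhds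
  have heq := tendsto_nhds_unique (hsum.congr' ?_) hlim
  · have h0 : (0 : ℂ) = ((0 : ℝ) : ℂ) := by simp
    rw [h0, outerPotential_dressed hγ hγ' hQ H.dressed] at heq
    have hLc : L = (constC γ h Q ε : ℂ) := by
      rw [constC_eq hγ hγ' H]
      push_cast
      linear_combination (1 / 2) * heq
    rwa [← hLc]
  · filter_upwards [hev, self_mem_nhdsWithin] with δ h1 h2
    have h2 : 0 < δ := h2
    have him : (γ / 2 * I + δ * I : ℂ).im = γ / 2 + δ := by simp
    have hid := dressed_add_dressed_eq hγ hγ' hQ H.dressed (z := γ / 2 * I + δ * I)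
      (by rw [him]; linarith) (by rw [him]; linarith)
    have e1 : (γ / 2 * I + δ * I - γ * I : ℂ) = -(γ / 2 * I + δ * -I) := by ring
    have e2 : (γ / 2 * I + δ * I - γ / 2 * I : ℂ) = δ * I := by ring
    have him2 : (γ / 2 * I + δ * -I : ℂ).im = γ / 2 - δ := by simp; ring
    have habs : |γ / 2 - δ| < γ / 2 := abs_lt.2 ⟨by linarith, by linarith⟩
    rw [e1, e2, dressed_neg hγ hγ' hQ H.dressed
      (mem_domainUpsilon_of_im hγ hγ' (by rw [him2]; linarith) (by rw [him2]; linarith))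
      (not_mem_barePoles_of_im hγ hγ' (by rw [him2]; linarith) (by rw [him2]; exact habs.ne))] at hid
    rw [← hid]
    simp only [Function.comp_apply, mul_neg, inv_neg]
    ring

end Dressed

/-! ### Asymptotics of the curve at the pole -/

theorem re_im_I_mul_inv (x δ : ℝ) : (I * (x - δ * I : ℂ)⁻¹).re = -(δ / (x ^ 2 + δ ^ 2)) ∧
    (I * (x - δ * I : ℂ)⁻¹).im = x / (x ^ 2 + δ ^ 2) := by
  have hn : normSq (x - δ * I : ℂ) = x ^ 2 + δ ^ 2 := by
    rw [normSq_apply]; simp; ring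
  rw [I_mul_re, I_mul_im, inv_re, inv_im, hn]
  constructor <;> simp

section Dressed

variable {γ J h Q : ℝ} {ε : ℂ → ℂ} {X : ℝ → ℝ}

/-- The regular part of the dressed energy at its pole `iγ / 2`. -/
noncomputable def dressedRegular (γ J : ℝ) (ε : ℂ → ℂ) (w : ℂ) : ℂ :=
  ε (γ / 2 * I + w) - ((2 * J * Real.sin γ : ℝ) : ℂ) * I * w⁻¹

theorem dressed_near_pole (γ J : ℝ) (ε : ℂ → ℂ) (x y : ℝ) :
    (ε (x + y * I)).re = -(2 * J * Real.sin γ * ((γ / 2 - y) / (x ^ 2 + (γ / 2 - y) ^ 2))) +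
      (dressedRegular γ J ε (x - (γ / 2 - y : ℝ) * I)).re ∧
    (ε (x + y * I)).im = 2 * J * Real.sin γ * (x / (x ^ 2 + (γ / 2 - y) ^ 2)) +
      (dressedRegular γ J ε (x - (γ / 2 - y : ℝ) * I)).im := by
  have e : (γ / 2 * I + (x - (γ / 2 - y : ℝ) * I) : ℂ) = x + y * I := by push_cast; ring
  rw [dressedRegular, e, mul_assoc _ I, sub_re, sub_im, re_ofReal_mul, im_ofReal_mul,
    (re_im_I_mul_inv _ _).1, (re_im_I_mul_inv _ _).2]
  constructor <;> ring

theorem eventually_sub_pos (hγ : 0 < γ) :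
    ∀ᶠ y in 𝓝[<] (γ / 2), 0 < y ∧ 0 < γ / 2 - y ∧ |y| < γ / 2 := by
  filter_upwards [Ioo_mem_nhdsLT (half_pos hγ)] with y hy
  exact ⟨hy.1, sub_pos.2 hy.2, abs_lt.2 ⟨by linarith [hy.1], hy.2⟩⟩

theorem tendsto_sub_half (γ : ℝ) : Tendsto (fun y : ℝ => γ / 2 - y) (𝓝[<] (γ / 2)) (𝓝 0) := by
  have h : Continuous (fun y : ℝ => γ / 2 - y) := by fun_prop
  have := (h.tendsto (γ / 2)).mono_left (nhdsWithin_le_nhds (s := Iio (γ / 2)))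
  simpa using this

theorem two_mul_J_sin_pos (hγ : 0 < γ) (hγ' : γ < π / 2) (hJ : 0 < J) :
    0 < 2 * J * Real.sin γ := by
  have := Real.sin_pos_of_pos_of_lt_pi hγ (by linarith)
  positivity

/-- At a fixed small x₀ > 0 the polar part of Re ε is O(γ/2 - y), whereas the regular part stays
above c/2 > 0. So Re ε > 0 at x₀, and by monotonicity the zero lies to the left of x₀. -/
theorem IsZeroCurve.tendsto_zero (hγ : 0 < γ) (hγ' : γ < π / 2) (hJ : 0 < J) (hh : 0 < h)
    (H : IsDressedEnergy γ J h Q ε) (hX : IsZeroCurve γ ε X) :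
    Tendsto X (𝓝[<] (γ / 2)) (𝓝 0) := by
  have hB := two_mul_J_sin_pos hγ hγ' hJ
  have hc := constC_pos hγ hγ' hJ hh H
  refine tendsto_order.2 ⟨fun a ha => ?_, fun η hη => ?_⟩
  · filter_upwards [eventually_sub_pos hγ] with y hy
    exact ha.trans (hX y hy.2.2).1
  have h1 : Tendsto (fun w => (dressedRegular γ J ε w).re) (𝓝[≠] 0) (𝓝 (constC γ h Q ε)) := by
    have := (continuous_re.tendsto _).comp (tendsto_dressed_sub_pole hγ hγ' H)
    rwa [ofReal_re] at this
  have h2 := h1.eventually (lt_mem_nhds (half_lt_self hc))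
  rw [eventually_nhdsWithin_iff, Metric.eventually_nhds_iff] at h2
  obtain ⟨ρ, hρ, h2⟩ := h2
  -- At most half of ρ, to leave room for the imaginary part γ/2 - y < ρ/2.
  set x₀ := min η ρ / 2 with hx₀
  have hm : 0 < min η ρ := lt_min hη hρ
  have hx0 : 0 < x₀ := half_pos hm
  have h3 := (tendsto_sub_half γ).eventually (gt_mem_nhds (half_pos hρ))
  have h0 : 2 * J * Real.sin γ / x₀ ^ 2 * 0 < constC γ h Q ε / 2 := by
    rw [mul_zero]; exact half_pos hc
  have h4 := ((tendsto_sub_half γ).const_mul (2 * J * Real.sin γ / x₀ ^ 2)).eventually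
    (gt_mem_nhds h0)
  filter_upwards [eventually_sub_pos hγ, h3, h4] with y hy h3 h4
  have h5 : (x₀ - (γ / 2 - y : ℝ) * I : ℂ) ≠ 0 := fun h0 => by
    have := congrArg re h0
    simp at this
    linarith
  have h6 : dist (x₀ - (γ / 2 - y : ℝ) * I : ℂ) 0 < ρ := by
    rw [dist_zero_right]
    refine (norm_sub_le _ _).trans_lt ?_
    rw [norm_mul, norm_I, mul_one, norm_real, norm_real, Real.norm_of_nonneg hx0.le,
      Real.norm_of_nonneg hy.2.1.le]
    have := min_le_right η ρ
    linarith
  have h7 := h2 h6 h5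
  have h8 : 0 < (ε (x₀ + y * I)).re := by
    rw [(dressed_near_pole γ J ε x₀ y).1]
    have h9 : (γ / 2 - y) / (x₀ ^ 2 + (γ / 2 - y) ^ 2) ≤ (γ / 2 - y) / x₀ ^ 2 :=
      div_le_div_of_nonneg_left hy.2.1.le (by positivity) (by nlinarith)
    have h10 := mul_le_mul_of_nonneg_left h9 hB.le
    have h11 : 2 * J * Real.sin γ * ((γ / 2 - y) / x₀ ^ 2) =
      2 * J * Real.sin γ / x₀ ^ 2 * (γ / 2 - y) := by ring
    linarith
  have h12 := (hX.lt_iff hγ hγ' hJ H hy.2.2 hx0.le).1 h8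
  have := min_le_left η ρ
  linarith

theorem IsZeroCurve.tendsto_regular (hγ : 0 < γ) (hγ' : γ < π / 2) (hJ : 0 < J) (hh : 0 < h)
    (H : IsDressedEnergy γ J h Q ε) (hX : IsZeroCurve γ ε X) :
    Tendsto (fun y => dressedRegular γ J ε (X y - (γ / 2 - y : ℝ) * I)) (𝓝[<] (γ / 2))
      (𝓝 (constC γ h Q ε : ℂ)) := by
  refine Tendsto.comp (g := dressedRegular γ J ε) (tendsto_dressed_sub_pole hγ hγ' H)
    (tendsto_nhdsWithin_iff.2 ⟨?_, ?_⟩)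
  · have h1 := ((continuous_ofReal.tendsto _).comp (hX.tendsto_zero hγ hγ' hJ hh H)).sub
      (((continuous_ofReal.tendsto _).comp (tendsto_sub_half γ)).mul_const I)
    simpa using h1
  · filter_upwards [eventually_sub_pos hγ] with y hy h0
    have := congrArg re h0
    simp at this
    linarith [(hX y hy.2.2).1]

/-- On the curve Re ε = 0, so the negative polar part balances the regular part exactly, and the
latter tends to c. -/
theorem IsZeroCurve.tendsto_ratio (hγ : 0 < γ) (hγ' : γ < π / 2) (hJ : 0 < J) (hh : 0 < h)
    (H : IsDressedEnergy γ J h Q ε) (hX : IsZeroCurve γ ε X) :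
    Tendsto (fun y => 2 * J * Real.sin γ * ((γ / 2 - y) / (X y ^ 2 + (γ / 2 - y) ^ 2)))
      (𝓝[<] (γ / 2)) (𝓝 (constC γ h Q ε)) := by
  have h1 := (continuous_re.tendsto _).comp (hX.tendsto_regular hγ hγ' hJ hh H)
  rw [ofReal_re] at h1
  refine h1.congr' ?_
  filter_upwards [eventually_sub_pos hγ] with y hy
  have h2 := (dressed_near_pole γ J ε (X y) y).1
  rw [(hX y hy.2.2).2] at h2
  simp only [Function.comp_apply]
  linarith

/-- With δ = γ/2 - y and B = 2J sin γ, the quotient X²/δ equals B divided by the ratio of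
`tendsto_ratio`, minus δ. -/
theorem IsZeroCurve.tendsto_sq_div (hγ : 0 < γ) (hγ' : γ < π / 2) (hJ : 0 < J) (hh : 0 < h)
    (H : IsDressedEnergy γ J h Q ε) (hX : IsZeroCurve γ ε X) :
    Tendsto (fun y => X y ^ 2 / (γ / 2 - y)) (𝓝[<] (γ / 2))
      (𝓝 (2 * J * Real.sin γ / constC γ h Q ε)) := by
  have hB := two_mul_J_sin_pos hγ hγ' hJ
  have hc := constC_pos hγ hγ' hJ hh H
  have h1 := (tendsto_const_nhds.div (hX.tendsto_ratio hγ hγ' hJ hh H) hc.ne' :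
    Tendsto (fun y => 2 * J * Real.sin γ / (2 * J * Real.sin γ *
      ((γ / 2 - y) / (X y ^ 2 + (γ / 2 - y) ^ 2)))) _ _).sub (tendsto_sub_half γ)
  rw [sub_zero] at h1
  refine h1.congr' ?_
  filter_upwards [eventually_sub_pos hγ] with y hy
  have hδ := hy.2.1
  set δ := γ / 2 - y
  have h2 : 0 < X y ^ 2 + δ ^ 2 := by positivity
  change 2 * J * Real.sin γ / (2 * J * Real.sin γ * (δ / (X y ^ 2 + δ ^ 2))) - δ = _
  rw [div_mul_eq_div_div, div_self hB.ne', one_div_div, add_div, sq δ, mul_div_assoc,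
    div_self hδ.ne', mul_one, add_sub_cancel_right]

theorem IsZeroCurve.isEquivalent (hγ : 0 < γ) (hγ' : γ < π / 2) (hJ : 0 < J) (hh : 0 < h)
    (H : IsDressedEnergy γ J h Q ε) (hX : IsZeroCurve γ ε X) :
    Asymptotics.IsEquivalent (𝓝[<] (γ / 2)) X
      (fun y => √(2 * J * Real.sin γ / constC γ h Q ε * (γ / 2 - y))) := by
  have hB := two_mul_J_sin_pos hγ hγ' hJ
  have hc := constC_pos hγ hγ' hJ hh H
  refine Asymptotics.isEquivalent_of_tendsto_one ?_
  have hκ : 0 < 2 * J * Real.sin γ / constC γ h Q ε := div_pos hB hc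
  have h1 := ((hX.tendsto_sq_div hγ hγ' hJ hh H).div_const
    (2 * J * Real.sin γ / constC γ h Q ε)).sqrt
  rw [div_self hκ.ne', Real.sqrt_one] at h1
  refine h1.congr' ?_
  filter_upwards [eventually_sub_pos hγ] with y hy
  rw [Pi.div_apply, div_div, mul_comm (γ / 2 - y), Real.sqrt_div (sq_nonneg _),
    Real.sqrt_sq (hX y hy.2.2).1.le]

theorem IsZeroCurve.isEquivalent_im (hγ : 0 < γ) (hγ' : γ < π / 2) (hJ : 0 < J) (hh : 0 < h)
    (H : IsDressedEnergy γ J h Q ε) (hX : IsZeroCurve γ ε X) :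
    Asymptotics.IsEquivalent (𝓝[<] (γ / 2)) (fun y : ℝ => (ε (X y + y * I)).im)
      (fun y => √(2 * J * Real.sin γ * constC γ h Q ε / (γ / 2 - y))) := by
  have hB := two_mul_J_sin_pos hγ hγ' hJ
  have hc := constC_pos hγ hγ' hJ hh H
  have hr := (continuous_im.tendsto _).comp (hX.tendsto_regular hγ hγ' hJ hh H)
  rw [ofReal_im] at hr
  set B := 2 * J * Real.sin γ with hBd
  set c := constC γ h Q ε with hcd
  refine Asymptotics.isEquivalent_of_tendsto_one ?_
  -- After division by the square root, the polar part of Im ε is the ratio Bδ/(X² + δ²) times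
  -- √(X²/δ/(Bc)) and tends to 1. The regular part has imaginary part tending to 0, as c is real,
  -- and is moreover multiplied by √(δ/(Bc)) → 0.
  have h1 := (hX.tendsto_ratio hγ hγ' hJ hh H).mul
    (((hX.tendsto_sq_div hγ hγ' hJ hh H).div_const (B * c)).sqrt)
  have h2 := hr.mul (((tendsto_sub_half γ).div_const (B * c)).sqrt)
  have h3 := h1.add h2
  have e1 : c * √(B / c / (B * c)) + 0 * √(0 / (B * c)) = 1 := by
    have : B / c / (B * c) = (1 / c) ^ 2 := by field_simp
    rw [this, Real.sqrt_sq (by positivity)]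
    field_simp
    simp
  rw [e1] at h3
  refine h3.congr' ?_
  filter_upwards [eventually_sub_pos hγ] with y hy
  have hδ := hy.2.1
  have hx := (hX y hy.2.2).1
  rw [Pi.div_apply, (dressed_near_pole γ J ε (X y) y).2, ← hBd]
  simp only [Function.comp_apply]
  set δ := γ / 2 - y
  have e2 : √(B * c / δ) = (√(δ / (B * c)))⁻¹ := by rw [← Real.sqrt_inv, inv_div]
  have e3 : √(X y ^ 2 / δ / (B * c)) = X y / δ * √(δ / (B * c)) := by
    have : X y ^ 2 / δ / (B * c) = (X y / δ) ^ 2 * (δ / (B * c)) := by field_simp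
    rw [this, Real.sqrt_mul (sq_nonneg _), Real.sqrt_sq (by positivity)]
  rw [e2, e3, div_inv_eq_mul, add_mul]
  have e4 : B * (δ / (X y ^ 2 + δ ^ 2)) * (X y / δ * √(δ / (B * c))) =
      B * (X y / (X y ^ 2 + δ ^ 2)) * √(δ / (B * c)) := by
    field_simp
  rw [e4]

end Dressed

end XXZ

/-! ### The theorem -/

theorem theorem2 (γ J h QF : ℝ) (hγ : 0 < γ) (hγ' : γ < π / 2) (hJ : 0 < J)
    (hh : 0 < h) (hhc : h < XXZ.upperCriticalField γ J) (ε : ℂ → ℂ)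
    (hε : XXZ.IsDressedEnergy γ J h QF ε) :
    -- the real part is even in `x` and in `y`
    (∀ x y : ℝ, (⟨x, y⟩ : ℂ) ∈ XXZ.cylinderS γ QF → (⟨x, y⟩ : ℂ) ∉ XXZ.barePoles γ →
      (ε ⟨-x, y⟩).re = (ε ⟨x, y⟩).re ∧ (ε ⟨x, -y⟩).re = (ε ⟨x, y⟩).re) ∧
    -- monotonicity in the strip `0 ≤ y < γ/2`
    (∀ y ∈ Set.Ico 0 (γ / 2), StrictMonoOn (fun x : ℝ => (ε ⟨x, y⟩).re) (Set.Ici 0)) ∧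
    -- the constant `c` is given by a convergent integral and is positive
    MeasureTheory.IntegrableOn (XXZ.constIntegrand γ ε) (Set.Ioi QF) ∧
    0 < XXZ.constC γ h QF ε ∧
    (∃ X : ℝ → ℝ,
      -- `X y` is the only zero on the half-line, and it is simple
      (∀ y ∈ Set.Ico 0 (γ / 2), 0 < X y ∧
        (∀ x : ℝ, 0 ≤ x → ((ε ⟨x, y⟩).re = 0 ↔ x = X y)) ∧
        ∃ d : ℝ, d ≠ 0 ∧ HasDerivAt (fun x : ℝ => (ε ⟨x, y⟩).re) d (X y)) ∧
      -- smoothness and behaviour at the boundaries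
      ContDiffOn ℝ ∞ X (Set.Ico 0 (γ / 2)) ∧
      X 0 = QF ∧
      Asymptotics.IsEquivalent (𝓝[<] (γ / 2)) X
        (fun y => √(2 * J * Real.sin γ / XXZ.constC γ h QF ε * (γ / 2 - y))) ∧
      -- the imaginary part along the curve
      (∀ y ∈ Set.Ioo 0 (γ / 2), ∃ d : ℝ, 0 < d ∧
        HasDerivAt (fun s : ℝ => (ε ⟨X s, s⟩).im) d y) ∧
      StrictMonoOn (fun y : ℝ => (ε ⟨X y, y⟩).im) (Set.Ico 0 (γ / 2)) ∧
      (ε ⟨X 0, 0⟩).im = 0 ∧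
      Asymptotics.IsEquivalent (𝓝[<] (γ / 2)) (fun y : ℝ => (ε ⟨X y, y⟩).im)
        (fun y => √(2 * J * Real.sin γ * XXZ.constC γ h QF ε / (γ / 2 - y)))) ∧
    -- bounds in the strip `|Im z| < γ/2`
    (∀ z : ℂ, |z.im| < γ / 2 →
      (XXZ.bareEnergy γ J h z).re < (ε z).re ∧
      (ε z).re < (XXZ.upperEnergy γ J h z).re) ∧
    -- positivity and lower bounds for `|Im z| > γ/2`
    (∀ z ∈ XXZ.cylinderS γ QF, γ / 2 < |z.im| → 0 < (ε z).re) ∧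
    (∀ z ∈ XXZ.cylinderS γ QF,
      π / 2 - 1 / 2 * (π / 2 - γ) < z.im → z.im < π / 2 → h < (ε z).re) ∧
    (∀ z ∈ XXZ.cylinderS γ QF,
      γ < z.im → z.im < π / 2 - 1 / 2 * (π / 2 - γ) → h / 2 < (ε z).re) ∧
    (∀ z ∈ XXZ.cylinderS γ QF,
      γ / 2 < z.im → z.im < γ → min (h / 2) (h * γ / (π - γ)) < (ε z).re) ∧
    -- the imaginary part is odd in `x` and in `y`
    (∀ x y : ℝ, (⟨x, y⟩ : ℂ) ∈ XXZ.cylinderS γ QF → (⟨x, y⟩ : ℂ) ∉ XXZ.barePoles γ →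
      (ε ⟨-x, y⟩).im = -(ε ⟨x, y⟩).im ∧ (ε ⟨x, -y⟩).im = -(ε ⟨x, y⟩).im) := by
  have hQ := hε.pos.le
  have habs : ∀ y ∈ Set.Ico 0 (γ / 2), |y| < γ / 2 := fun y hy => by
    rw [abs_of_nonneg hy.1]; exact hy.2
  have hmk : ∀ x y : ℝ, (⟨x, y⟩ : ℂ) = x + y * Complex.I := Complex.mk_eq_add_mul_I
  have hsym : ∀ x y : ℝ, (⟨x, y⟩ : ℂ) ∈ XXZ.cylinderS γ QF → (⟨x, y⟩ : ℂ) ∉ XXZ.barePoles γ →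
      ε ⟨-x, y⟩ = (starRingEnd ℂ) (ε ⟨x, y⟩) ∧ ε ⟨x, -y⟩ = (starRingEnd ℂ) (ε ⟨x, y⟩) := by
    intro x y h1 h2
    have e1 : (⟨-x, y⟩ : ℂ) = -(starRingEnd ℂ) ⟨x, y⟩ := by apply Complex.ext <;> simp
    have e2 : (⟨x, -y⟩ : ℂ) = (starRingEnd ℂ) ⟨x, y⟩ := by apply Complex.ext <;> simp
    rw [e1, e2, XXZ.dressed_neg hγ hγ' hQ hε.dressed (XXZ.conj_mem_domainUpsilon h1.1)
      (XXZ.conj_not_mem_barePoles h2), XXZ.dressed_conj hγ hγ' hQ hε.dressed h1.1 h2]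
    exact ⟨rfl, rfl⟩
  obtain ⟨X, hX⟩ := XXZ.exists_isZeroCurve hγ hγ' hJ hh hε
  refine ⟨fun x y h1 h2 => ?_, fun y hy => ?_, XXZ.integrableOn_constIntegrand hγ hγ' hε,
    XXZ.constC_pos hγ hγ' hJ hh hε, ⟨X, fun y hy => ⟨(hX y (habs y hy)).1, fun x hx => ?_, ?_⟩,
      fun y hy => (hX.contDiffAt hγ hγ' hJ hε (habs y hy)).contDiffWithinAt,
      hX.zero hγ hγ' hJ hε, hX.isEquivalent hγ hγ' hJ hh hε, fun y hy => ?_, ?_, ?_, ?_⟩,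
    fun z hz => ⟨XXZ.bareEnergy_re_lt hγ hγ' hJ hε hz,
      XXZ.dressed_re_lt_upperEnergy hγ hγ' hJ hh hε hz⟩,
    fun z hz h1 => XXZ.dressed_re_pos hγ hγ' hJ hh hε hz h1,
    -- The threshold π/2 - (π/2 - γ)/2 = (π + 2γ)/4 lies above both γ and (π + γ)/4.
    fun z hz h1 h2 => XXZ.dressed_re_gt_of_far hγ hγ' hJ hh hε (by linarith) (by linarith) h2.le,
    fun z hz h1 h2 => XXZ.dressed_re_gt_of_gt hγ hγ' hJ hh hε h1 (by linarith),
    fun z hz h1 h2 => XXZ.dressed_re_gt_of_lt hγ hγ' hJ hh hε h1 h2, fun x y h1 h2 => ?_⟩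
  · rw [(hsym x y h1 h2).1, (hsym x y h1 h2).2, Complex.conj_re]
    exact ⟨rfl, rfl⟩
  · simp only [hmk]
    exact XXZ.dressed_strictMonoOn hγ hγ' hJ hε (habs y hy)
  · rw [hmk]
    exact hX.eq_iff hγ hγ' hJ hε (habs y hy) hx
  · simp only [hmk]
    exact ⟨_, (XXZ.deriv_dressed_re_pos hγ hγ' hJ hε (habs y hy) (hX y (habs y hy)).1).ne',
      XXZ.hasDerivAt_re (XXZ.hasDerivAt_dressed_line hγ hγ' hQ hε.dressed (habs y hy) (X y))⟩
  · simp only [hmk]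
    exact hX.hasDerivAt_im hγ hγ' hJ hε (habs y ⟨hy.1.le, hy.2⟩)
  · simp only [hmk]
    exact hX.strictMonoOn_im hγ hγ' hJ hε
  · rw [hmk, hX.zero hγ hγ' hJ hε]
    simp [hε.fermi]
  · simp only [hmk]
    exact hX.isEquivalent_im hγ hγ' hJ hh hε
  · rw [(hsym x y h1 h2).1, (hsym x y h1 h2).2, Complex.conj_im]
    exact ⟨rfl, rfl⟩
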